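/- Let $\Bbbk$ be a commutative ring. All dg categories are small and $\Bbbk$-linear, with cohomological grading (differentials of degree $+1$). In a dg category $\mathcal C$ write $f\simeq g$ if $f-g=d(h)$ for some $h$. A homotopy idempotent is a closed $e\in\mathrm{End}^0_{\mathcal C}(X)$ with $e^2\simeq e$; an object $Y$ is an image of $e$ if there are closed degree-zero morphisms $\sigma\colon Y\to X$, $\pi\colon X\to Y$ with $\pi\sigma\simeq \mathrm{id}_Y$ and $\sigma\pi\simeq e$. The dg category $\mathcal C$ is homotopy idempotent complete if every homotopy idempotent in $\mathcal C$ has an image. $\mathbf{Hqe}$ denotes the localization of the category of dg categories and dg functors at the quasi-equivalences; its morphisms are called quasi-functors. An $A_\infty$-idempotent $(X,\underline e,\underline h)$ in $\mathcal C$ is an object $X\in\mathcal C$ with $e_k\in \mathrm{End}^{-2k}_{\mathcal C}(X)$ and $h_k\in\mathrm{End}^{-1-2k}_{\mathcal C}(X)$ for $k\ge 0$ such that $$d(e_k)=\sum_{i+j=k-1}(e_ih_j-h_ie_j),\qquad d(h_k)=e_k-\sum_{i+j=k}e_ie_j-\sum_{i+j=k-1}h_ih_j .$$ Let $\Sigma^{\Pi}\mathcal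 C$ be the dg category of formal products $\prod_{i\in I}\Sigma^{a_i}X^i$ ($I\subset\mathbb Z$, $X^i\in\mathcal C$, $a_i\in\mathbb Z$), whose degree $l$ morphisms to $\prod_{j\in J}\Sigma^{b_j}Y^j$ are the matrices $(f_{ji})$ with $f_{ji}\in\mathrm{Hom}_{\mathcal C}^{l+b_j-a_i}(X^i,Y^j)$, each row of which has finitely many nonzero entries, with matrix multiplication as composition and differential $(f_{ji})\mapsto((-1)^{b_j}d f_{ji})$. For a dg category $\mathcal B$ let $\mathrm{Tw}(\mathcal B)$ be the dg category of pairs $\mathrm{tw}_\alpha(X)$ with $X\in\mathcal B$, $\alpha\in\mathrm{End}^1_{\mathcal B}(X)$, $d\alpha+\alpha^2=0$, with the morphisms and composition of $\mathcal B$ and differential $f\mapsto d f+\beta f-(-1)^{|f|}f\alpha$ on morphisms $\mathrm{tw}_\alpha(X)\to\mathrm{tw}_\beta(Y)$. Let $Z(X,\underline e,\underline h)=\mathrm{tw}_\delta\big(\prod_{i\ge 0}\Sigma^{-i}X\big)\in\mathrm{Tw}(\Sigma^{\Pi}\mathcal C)$, where for $k\ge 0$ $$\delta_{i+1+2k,\,i}=\begin{cases}-e_k^{\perp}&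 i\text{ even}\\ e_k& i\text{ odd}\end{cases},\qquad \delta_{i+2+2k,\,i}=\begin{cases}h_k& i\text{ even}\\ -h_k& i\text{ odd}\end{cases},$$ $e_0^\perp=\mathrm{id}_X-e_0$, $e_k^\perp=-e_k$ for $k\ge1$, and all other components of $\delta$ are zero. Define $\mathrm{Kar}^{dg}(\mathcal C)$ as the full dg subcategory of $\mathrm{Tw}(\Sigma^{\Pi}\mathcal C)$ on the objects homotopy equivalent to $Z(X,\underline e,\underline h)$ for some $A_\infty$-idempotent $(X,\underline e,\underline h)$ in $\mathcal C$. **Theorem.** Let $\mathcal C$ be a dg category. 1. $X\mapsto \mathrm{tw}_0(X)$ defines a dg functor $\iota\colon\mathcal C\to\mathrm{Kar}^{dg}(\mathcal C)$ that is injective on objects and bijective on morphism complexes, and $\mathrm{Kar}^{dg}(\mathcal C)$ is homotopy idempotent complete. 2. For every homotopy idempotent complete dg category $\mathcal D$ and every dg functor $F\colon\mathcal C\to\mathcal D$ there is a unique morphism (quasi-functor) $\widetilde F\colon\mathrm{Kar}^{dg}(\mathcal C)\to\mathcal D$ in $\mathbf{Hqe}$ with $\widetilde F\circ\iota=F$ in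 $\mathbf{Hqe}$. 3. This property characterizes $\mathrm{Kar}^{dg}(\mathcal C)$ up to quasi-equivalence: a dg functor $J\colon\mathcal C\to\mathcal K$ has the property that $\mathcal K$ is homotopy idempotent complete and $J$ satisfies the universal property in 2 if and only if there is an isomorphism $\varphi\colon\mathrm{Kar}^{dg}(\mathcal C)\to\mathcal K$ in $\mathbf{Hqe}$ with $\varphi\circ\iota=J$ in $\mathbf{Hqe}$; in this case $\mathrm{Kar}^{dg}(\mathcal C)$ and $\mathcal K$ are connected by a zigzag of quasi-equivalences. 4. $\mathcal C$ is homotopy idempotent complete if and only if $\iota$ is a quasi-equivalence. -/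

import Mathlib

open CategoryTheory

universe w u

/-- A (small) differential graded category over a commutative ring `k`: a category enriched in
cochain complexes of `k`-modules.  `comp h g f` is the composite `g ∘ f`. -/
structure DGCat (k : Type w) [CommRing k] where
  /-- objects -/
  Obj : Type u
  /-- morphisms of each cohomological degree -/
  Hom : Obj → Obj → ℤ → Type u
  [addCommGroup : ∀ X Y n, AddCommGroup (Hom X Y n)]
  [module : ∀ X Y n, Module k (Hom X Y n)]
  /-- the differential, of degree `1` -/
  d : ∀ {X Y : Obj} (n m : ℤ), n + 1 = m → (Hom X Y n →ₗ[k] Hom X Y m)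
  /-- identities -/
  id : ∀ X : Obj, Hom X X 0
  /-- composition, bilinear and additive on degrees -/
  comp : ∀ {X Y Z : Obj} {q p n : ℤ}, q + p = n →
    (Hom Y Z q →ₗ[k] Hom X Y p →ₗ[k] Hom X Z n)
  d_d : ∀ {X Y : Obj} {n m l : ℤ} (h : n + 1 = m) (h' : m + 1 = l) (f : Hom X Y n),
    d m l h' (d n m h f) = 0
  d_id : ∀ {X : Obj} {m : ℤ} (h : 0 + 1 = m), d 0 m h (id X) = 0
  leibniz : ∀ {X Y Z : Obj} {q p n q' p' n' : ℤ} (h : q + p = n) (hq : q + 1 = q')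
    (hp : p + 1 = p') (hn : n + 1 = n') (h₁ : q' + p = n') (h₂ : q + p' = n')
    (g : Hom Y Z q) (f : Hom X Y p),
    d n n' hn (comp h g f) =
      comp h₁ (d q q' hq g) f + (q.negOnePow : ℤ) • comp h₂ g (d p p' hp f)
  id_comp : ∀ {X Y : Obj} {p : ℤ} (h : 0 + p = p) (f : Hom X Y p), comp h (id Y) f = f
  comp_id : ∀ {X Y : Obj} {p : ℤ} (h : p + 0 = p) (f : Hom X Y p), comp h f (id X) = f
  assoc : ∀ {W X Y Z : Obj} {r q p rq qp n : ℤ} (h₁ : r + q = rq) (h₂ : q + p = qp)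
    (h₃ : rq + p = n) (h₄ : r + qp = n) (h : Hom Y Z r) (g : Hom X Y q) (f : Hom W X p),
    comp h₃ (comp h₁ h g) f = comp h₄ h (comp h₂ g f)

namespace DGCat

attribute [instance] DGCat.addCommGroup DGCat.module

variable {k : Type w} [CommRing k]

/-! ### DG functors and the category of dg categories -/

/-- A dg functor: a functor acting on hom complexes by degree zero chain maps. -/
@[ext]
structure DGFunctor (C D : DGCat.{w, u} k) where
  /-- action on objects -/
  obj : C.Obj → D.Obj
  /-- action on morphisms of each degree -/
  map : ∀ {X Y : C.Obj} (n : ℤ), C.Hom X Y n →ₗ[k] D.Hom (obj X) (obj Y) n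
  map_d : ∀ {X Y : C.Obj} {n m : ℤ} (h : n + 1 = m) (f : C.Hom X Y n),
    map m (C.d n m h f) = D.d n m h (map n f)
  map_id : ∀ X : C.Obj, map 0 (C.id X) = D.id (obj X)
  map_comp : ∀ {X Y Z : C.Obj} {q p n : ℤ} (h : q + p = n) (g : C.Hom Y Z q) (f : C.Hom X Y p),
    map n (C.comp h g f) = D.comp h (map q g) (map p f)

/-- The category `dgcat` of small dg categories and dg functors. -/
instance : Category (DGCat.{w, u} k) where
  Hom C D := DGFunctor C D
  id C :=
    { obj := fun X => X
      map := fun _ => LinearMap.id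
      map_d := fun _ _ => rfl
      map_id := fun _ => rfl
      map_comp := fun _ _ _ => rfl }
  comp F G :=
    { obj := fun X => G.obj (F.obj X)
      map := fun n => (G.map n).comp (F.map n)
      map_d := fun h f => by simp [F.map_d, G.map_d]
      map_id := fun X => by simp [F.map_id, G.map_id]
      map_comp := fun h g f => by simp [F.map_comp, G.map_comp] }

/-! ### Homotopies, homotopy equivalences, cohomology -/

section Basic

variable (C : DGCat.{w, u} k)

/-- A morphism is closed if its differential vanishes. -/
def IsClosed {X Y : C.Obj} {n : ℤ} (f : C.Hom X Y n) : Prop :=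
  C.d n (n + 1) rfl f = 0

/-- `f ≃ g`: the difference `f - g` is the differential of a morphism of degree one less. -/
def Homotopic {X Y : C.Obj} {n : ℤ} (f g : C.Hom X Y n) : Prop :=
  ∃ h : C.Hom X Y (n - 1), C.d (n - 1) n (by omega) h = f - g

/-- Composition of morphisms of degree zero. -/
def comp₀ {X Y Z : C.Obj} (g : C.Hom Y Z 0) (f : C.Hom X Y 0) : C.Hom X Z 0 :=
  C.comp (zero_add 0) g f

/-- `X` and `Y` are homotopy equivalent: some closed degree zero morphism `X → Y` is invertible
up to homotopy, that is, becomes an isomorphism in the cohomology category `H⁰`. -/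
def HomotopyEquivalent (X Y : C.Obj) : Prop :=
  ∃ (f : C.Hom X Y 0) (g : C.Hom Y X 0), C.IsClosed f ∧ C.IsClosed g ∧
    C.Homotopic (C.comp₀ g f) (C.id X) ∧ C.Homotopic (C.comp₀ f g) (C.id Y)

/-- A homotopy idempotent: a closed degree zero endomorphism `e` with `e ∘ e ≃ e`. -/
def IsHomotopyIdempotent {X : C.Obj} (e : C.Hom X X 0) : Prop :=
  C.IsClosed e ∧ C.Homotopic (C.comp₀ e e) e

/-- `Y` is an image of the endomorphism `e` of `X`: there are closed degree zero morphisms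
`σ : Y → X` and `π : X → Y` with `π ∘ σ ≃ id` and `σ ∘ π ≃ e`. -/
def IsImage {X : C.Obj} (e : C.Hom X X 0) (Y : C.Obj) : Prop :=
  ∃ (σ : C.Hom Y X 0) (π : C.Hom X Y 0), C.IsClosed σ ∧ C.IsClosed π ∧
    C.Homotopic (C.comp₀ π σ) (C.id Y) ∧ C.Homotopic (C.comp₀ σ π) e

/-- `C` is homotopy idempotent complete: each homotopy idempotent has an image. -/
def HomotopyIdempotentComplete : Prop :=
  ∀ (X : C.Obj) (e : C.Hom X X 0), C.IsHomotopyIdempotent e → ∃ Y : C.Obj, C.IsImage e Y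

/-- Closed morphisms of degree `n`. -/
def cocycles (X Y : C.Obj) (n : ℤ) : Submodule k (C.Hom X Y n) :=
  LinearMap.ker (C.d (X := X) (Y := Y) n (n + 1) rfl)

/-- Exact morphisms of degree `n`, as a submodule of the closed ones. -/
def coboundaries (X Y : C.Obj) (n : ℤ) : Submodule k (C.cocycles X Y n) :=
  (LinearMap.range (C.d (X := X) (Y := Y) (n - 1) n (by omega))).comap
    (C.cocycles X Y n).subtype

/-- The cohomology `Hⁿ(Hom(X, Y))`. -/
abbrev Cohomology (X Y : C.Obj) (n : ℤ) : Type u :=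
  C.cocycles X Y n ⧸ C.coboundaries X Y n

end Basic

section Functors

variable {C D : DGCat.{w, u} k}

/-- The action of a dg functor on closed morphisms. -/
def DGFunctor.mapCocycles (F : DGFunctor C D) (X Y : C.Obj) (n : ℤ) :
    C.cocycles X Y n →ₗ[k] D.cocycles (F.obj X) (F.obj Y) n :=
  (F.map n).restrict (fun f hf => by
    have hf' : C.d n (n + 1) rfl f = 0 := hf
    change D.d n (n + 1) rfl (F.map n f) = 0
    rw [← F.map_d, hf', map_zero])

/-- The map induced by a dg functor on the cohomology of hom complexes. -/
def DGFunctor.mapCohomology (F : DGFunctor C D) (X Y : C.Obj) (n : ℤ) :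
    C.Cohomology X Y n →ₗ[k] D.Cohomology (F.obj X) (F.obj Y) n :=
  Submodule.mapQ _ _ (F.mapCocycles X Y n) (by
    rintro ⟨f, hf⟩ ⟨g, hg⟩
    exact ⟨F.map (n - 1) g, by rw [← F.map_d, hg]; rfl⟩)

/-- `F` restricts to quasi-isomorphisms on hom complexes. -/
def DGFunctor.QuasiFullyFaithful (F : DGFunctor C D) : Prop :=
  ∀ (X Y : C.Obj) (n : ℤ), Function.Bijective (F.mapCohomology X Y n)

/-- Every object of the target is homotopy equivalent to an object in the image; that is,
`H⁰(F)` is essentially surjective. -/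
def DGFunctor.QuasiEssSurj (F : DGFunctor C D) : Prop :=
  ∀ Y : D.Obj, ∃ X : C.Obj, D.HomotopyEquivalent (F.obj X) Y

end Functors

/-- The class of quasi-equivalences, as a property of morphisms of `dgcat`. -/
def quasiEquivalences (k : Type w) [CommRing k] : MorphismProperty (DGCat.{w, u} k) :=
  fun _ _ F => DGFunctor.QuasiFullyFaithful F ∧ DGFunctor.QuasiEssSurj F

/-- Two dg categories are quasi-equivalent if they are connected by a zigzag of
quasi-equivalences. -/
def QuasiEquivalent : DGCat.{w, u} k → DGCat.{w, u} k → Prop :=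
  Relation.EqvGen fun C D => ∃ F : C ⟶ D, quasiEquivalences k F

/-- The localization `Hqe` of `dgcat` at the quasi-equivalences; its morphisms are the
quasi-functors. -/
abbrev Hqe (k : Type w) [CommRing k] : Type (max w (u + 1)) :=
  (quasiEquivalences.{w, u} k).Localization

/-- The localization functor `dgcat ⥤ Hqe`. -/
abbrev toHqe (k : Type w) [CommRing k] : DGCat.{w, u} k ⥤ Hqe.{w, u} k :=
  (quasiEquivalences.{w, u} k).Q


/-! ### Auxiliary facts on degrees -/

section Cast

variable (C : DGCat.{w, u} k)

/-- The identity, as a morphism between equal objects. -/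
def idTo {X Y : C.Obj} (h : X = Y) : C.Hom X Y 0 :=
  h ▸ C.id X

/-- Transport of a morphism along an equality of degrees. -/
def castDeg {X Y : C.Obj} {m n : ℤ} (h : m = n) (f : C.Hom X Y m) : C.Hom X Y n :=
  h ▸ f

variable {C}

@[simp] theorem castDeg_rfl {X Y : C.Obj} {m : ℤ} (h : m = m) (f : C.Hom X Y m) :
    C.castDeg h f = f := rfl

@[simp] theorem castDeg_castDeg {X Y : C.Obj} {l m n : ℤ} (h : l = m) (h' : m = n)
    (f : C.Hom X Y l) : C.castDeg h' (C.castDeg h f) = C.castDeg (h.trans h') f := by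
  subst h h'; rfl

@[simp] theorem castDeg_zero {X Y : C.Obj} {m n : ℤ} (h : m = n) :
    C.castDeg h (0 : C.Hom X Y m) = 0 := by subst h; rfl

@[simp] theorem castDeg_add {X Y : C.Obj} {m n : ℤ} (h : m = n) (f g : C.Hom X Y m) :
    C.castDeg h (f + g) = C.castDeg h f + C.castDeg h g := by subst h; rfl

@[simp] theorem castDeg_sub {X Y : C.Obj} {m n : ℤ} (h : m = n) (f g : C.Hom X Y m) :
    C.castDeg h (f - g) = C.castDeg h f - C.castDeg h g := by subst h; rfl

@[simp] theorem castDeg_neg {X Y : C.Obj} {m n : ℤ} (h : m = n) (f : C.Hom X Y m) :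
    C.castDeg h (-f) = -C.castDeg h f := by subst h; rfl

theorem castDeg_smul {X Y : C.Obj} {m n : ℤ} (h : m = n) (c : k) (f : C.Hom X Y m) :
    C.castDeg h (c • f) = c • C.castDeg h f := by subst h; rfl

theorem castDeg_sum {X Y : C.Obj} {m n : ℤ} (h : m = n) {ι : Type*} (s : Finset ι)
    (f : ι → C.Hom X Y m) :
    C.castDeg h (∑ i ∈ s, f i) = ∑ i ∈ s, C.castDeg h (f i) := by subst h; rfl

theorem d_castDeg {X Y : C.Obj} {m n l : ℤ} (h : m = n) (hl : n + 1 = l) (f : C.Hom X Y m) :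
    C.d n l hl (C.castDeg h f) = C.d m l (by omega) f := by subst h; rfl

theorem castDeg_d {X Y : C.Obj} {m n l : ℤ} (h : n = l) (hl : m + 1 = n) (f : C.Hom X Y m) :
    C.castDeg h (C.d m n hl f) = C.d m l (by omega) f := by subst h; rfl

theorem comp_castDeg_left {X Y Z : C.Obj} {q q' p n : ℤ} (h : q = q') (hn : q' + p = n)
    (g : C.Hom Y Z q) (f : C.Hom X Y p) :
    C.comp hn (C.castDeg h g) f = C.comp (by omega) g f := by subst h; rfl

theorem comp_castDeg_right {X Y Z : C.Obj} {q p p' n : ℤ} (h : p = p') (hn : q + p' = n)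
    (g : C.Hom Y Z q) (f : C.Hom X Y p) :
    C.comp hn g (C.castDeg h f) = C.comp (by omega) g f := by subst h; rfl

theorem castDeg_comp {X Y Z : C.Obj} {q p n m : ℤ} (h : n = m) (hn : q + p = n)
    (g : C.Hom Y Z q) (f : C.Hom X Y p) :
    C.castDeg h (C.comp hn g f) = C.comp (by omega) g f := by subst h; rfl

theorem castDeg_id_comp {X Y : C.Obj} {q p n : ℤ} (h : 0 = q) (hn : q + p = n)
    (f : C.Hom X Y p) : C.comp hn (C.castDeg h (C.id Y)) f = C.castDeg (by omega) f := by
  subst h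
  obtain rfl : p = n := by omega
  simp [C.id_comp]

theorem comp_castDeg_id {X Y : C.Obj} {q p n : ℤ} (h : 0 = p) (hn : q + p = n)
    (f : C.Hom X Y q) : C.comp hn f (C.castDeg h (C.id X)) = C.castDeg (by omega) f := by
  subst h
  obtain rfl : q = n := by omega
  simp [C.comp_id]

theorem d_castDeg_id {X : C.Obj} {n m : ℤ} (h : 0 = n) (hm : n + 1 = m) :
    C.d n m hm (C.castDeg h (C.id X)) = 0 := by
  subst h; exact C.d_id _

end Cast

theorem negOnePow_mul_self (n : ℤ) : (n.negOnePow : ℤ) * n.negOnePow = 1 := by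
  rw [← Units.val_mul, Int.units_mul_self, Units.val_one]

theorem negOnePow_succ_coe (n : ℤ) : ((n + 1).negOnePow : ℤ) = -n.negOnePow := by
  rw [Int.negOnePow_succ, Units.val_neg]

/-! ### The twisted envelope -/

section Tw

variable (C : DGCat.{w, u} k)

/-- An object `tw_α(X)`: an object `X` with a Maurer–Cartan endomorphism `α` of degree one,
`d α + α ∘ α = 0`. -/
structure TwObj where
  /-- the underlying object -/
  X : C.Obj
  /-- the twist -/
  α : C.Hom X X 1
  maurerCartan : C.d 1 2 rfl α + C.comp (show (1 : ℤ) + 1 = 2 from rfl) α α = 0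

variable {C} in
/-- The twisted differential `f ↦ d f + β ∘ f - (-1)^|f| f ∘ α`. -/
def twD (T S : TwObj C) (n m : ℤ) (h : n + 1 = m) : C.Hom T.X S.X n →ₗ[k] C.Hom T.X S.X m :=
  C.d n m h + C.comp (by omega) S.α - (n.negOnePow : ℤ) • (C.comp h).flip T.α

variable {C} in
theorem twD_apply (T S : TwObj C) (n m : ℤ) (h : n + 1 = m) (f : C.Hom T.X S.X n) :
    twD T S n m h f = C.d n m h f + C.comp (by omega) S.α f -
      (n.negOnePow : ℤ) • C.comp h f T.α := rfl

/-- The twisted envelope `Tw(C)`. -/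
@[reducible] def Tw : DGCat.{w, u} k where
  Obj := TwObj C
  Hom T S n := C.Hom T.X S.X n
  d {T S} n m h := twD T S n m h
  id T := C.id T.X
  comp h := C.comp h
  d_d {T S n m l} h h' f := by
    obtain rfl := h
    obtain rfl := h'
    simp only [twD_apply, map_sub, map_add, map_zsmul, C.d_d]
    rw [C.leibniz (q' := 2) (p' := n + 1) _ rfl rfl rfl (by omega) (by omega) S.α f,
      C.leibniz (q' := n + 1) (p' := 2) _ rfl rfl rfl (by omega) (by omega) f T.α,
      ← C.assoc (rq := 2) rfl _ (by omega) _ S.α S.α f,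
      C.assoc (rq := n + 1) (qp := 2) rfl rfl rfl (by omega) f T.α T.α,
      C.assoc (rq := n + 1) (qp := n + 1) (by omega) rfl (by omega) (by omega) S.α f T.α]
    have hS := congrArg (fun x => C.comp (show (2 : ℤ) + n = n + 1 + 1 by omega) x f)
      S.maurerCartan
    have hT := congrArg (fun x => C.comp (show n + 2 = n + 1 + 1 by omega) f x)
      T.maurerCartan
    simp only [map_add, LinearMap.add_apply, map_zero, LinearMap.zero_apply] at hS hT
    rw [negOnePow_succ_coe]
    rw [add_eq_zero_iff_eq_neg] at hS hT
    rw [hS, hT]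
    simp only [smul_add, smul_sub, neg_smul, smul_neg, smul_smul, negOnePow_mul_self,
      Int.negOnePow_one, Units.val_neg, Units.val_one, one_smul]
    abel
  d_id {T m} h := by
    obtain rfl := h
    have e1 := C.comp_id (show (1 : ℤ) + 0 = 1 by omega) T.α
    have e2 := C.id_comp (show (0 : ℤ) + 1 = 1 by omega) T.α
    simp only [twD_apply, C.d_id, zero_add]
    simp only [Int.negOnePow_zero, Units.val_one, one_smul]
    exact sub_eq_zero.2 (e1.trans e2.symm)
  leibniz {T S R q p n q' p' n'} h hq hp hn h₁ h₂ g f := by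
    subst h hq hp hn
    simp only [twD_apply, map_sub, map_add, map_zsmul, LinearMap.sub_apply, LinearMap.add_apply,
      LinearMap.smul_apply]
    rw [C.leibniz (q' := q + 1) (p' := p + 1) _ rfl rfl rfl h₁ h₂ g f,
      C.assoc (rq := q + 1) (qp := q + p) (by omega) rfl (by omega) (by omega) R.α g f,
      C.assoc (rq := q + 1) (qp := p + 1) rfl (by omega) h₁ (by omega) g S.α f,
      C.assoc (rq := q + p) (qp := p + 1) rfl rfl rfl h₂ g f T.α]
    simp only [smul_add, smul_sub, smul_smul, Int.negOnePow_add, Units.val_mul]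
    abel
  id_comp h f := C.id_comp h f
  comp_id h f := C.comp_id h f
  assoc h₁ h₂ h₃ h₄ h g f := C.assoc h₁ h₂ h₃ h₄ h g f

end Tw

/-! ### The additive suspended envelope with countable products -/

section SigmaPi

variable (C : DGCat.{w, u} k)

/-- An object `∏_{i ∈ I} Σ^{a i} (X i)`, with `I` an arbitrary subset of `ℤ`. -/
structure SigmaObj where
  /-- the indexing set -/
  I : Set ℤ
  /-- the entries -/
  X : I → C.Obj
  /-- the shifts -/
  a : I → ℤ

variable {C}

/-- Morphisms of degree `n` from `∏_i Σ^{a i} (X i)` to `∏_j Σ^{b j} (Y j)`: matrices `(f j i)`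
with `f j i` of degree `n + b j - a i`, each row of which has only finitely many nonzero
entries. -/
def sigmaHom (x y : SigmaObj C) (n : ℤ) :
    Submodule k (∀ (j : y.I) (i : x.I), C.Hom (x.X i) (y.X j) (n + y.a j - x.a i)) where
  carrier := {f | ∀ j, {i | f j i ≠ 0}.Finite}
  zero_mem' j := by simp
  add_mem' {f g} hf hg j := ((hf j).union (hg j)).subset (fun i hi => by
    by_contra h
    simp only [Set.mem_union, Set.mem_ofPred_eq, not_or, not_not] at h
    exact hi (by simp [h.1, h.2]))
  smul_mem' c f hf j := (hf j).subset (fun i hi h => hi (by simp [h]))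

@[ext] theorem sigmaHom_ext {x y : SigmaObj C} {n : ℤ} {f g : sigmaHom x y n}
    (h : ∀ j i, f.1 j i = g.1 j i) : f = g :=
  Subtype.ext (funext fun j => funext fun i => h j i)

/-- The differential `(f j i) ↦ ((-1)^{b j} d (f j i))`. -/
def sigmaD (x y : SigmaObj C) (n m : ℤ) (h : n + 1 = m) :
    sigmaHom x y n →ₗ[k] sigmaHom x y m where
  toFun f := ⟨fun j i => ((y.a j).negOnePow : ℤ) • C.d _ _ (by omega) (f.1 j i), fun j =>
    (f.2 j).subset (fun i hi h => hi (by
      change ((y.a j).negOnePow : ℤ) • C.d _ _ _ (f.1 j i) = 0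
      rw [h, map_zero, smul_zero]))⟩
  map_add' f g := by ext j i; simp
  map_smul' c f := by ext j i; simp [smul_comm c]

/-- The entry `(l, i)` of a matrix product. -/
noncomputable def sigmaCompEntry {x y z : SigmaObj C} {q p n : ℤ} (h : q + p = n)
    (g : sigmaHom y z q) (f : sigmaHom x y p) (l : z.I) (i : x.I) :
    C.Hom (x.X i) (z.X l) (n + z.a l - x.a i) :=
  ∑ᶠ j : y.I, C.comp (by omega) (g.1 l j) (f.1 j i)

theorem sigmaCompEntry_eq_sum {x y z : SigmaObj C} {q p n : ℤ} (h : q + p = n)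
    (g : sigmaHom y z q) (f : sigmaHom x y p) (l : z.I) (i : x.I) (s : Finset y.I)
    (hs : ∀ j, j ∉ s → C.comp (show q + z.a l - y.a j + (p + y.a j - x.a i) = n + z.a l - x.a i by
      omega) (g.1 l j) (f.1 j i) = 0) :
    sigmaCompEntry h g f l i = ∑ j ∈ s, C.comp (by omega) (g.1 l j) (f.1 j i) :=
  finsum_eq_sum_of_support_subset _ (fun j hj => by
    by_contra hjs
    exact hj (hs j hjs))

theorem sigmaCompEntry_eq_sum_row {x y z : SigmaObj C} {q p n : ℤ} (h : q + p = n)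
    (g : sigmaHom y z q) (f : sigmaHom x y p) (l : z.I) (i : x.I) (s : Finset y.I)
    (hs : ∀ j, j ∉ s → g.1 l j = 0) :
    sigmaCompEntry h g f l i = ∑ j ∈ s, C.comp (by omega) (g.1 l j) (f.1 j i) :=
  sigmaCompEntry_eq_sum h g f l i s (fun j hj => by rw [hs j hj]; simp)

theorem exists_row {x y : SigmaObj C} {n : ℤ} (f : sigmaHom x y n) (j : y.I) :
    ∃ s : Finset x.I, ∀ i, i ∉ s → f.1 j i = 0 :=
  ⟨(f.2 j).toFinset, fun i hi => by simpa using hi⟩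

theorem exists_rows {x y : SigmaObj C} {n : ℤ} (f : sigmaHom x y n) (t : Finset y.I) :
    ∃ s : Finset x.I, ∀ j ∈ t, ∀ i, i ∉ s → f.1 j i = 0 := by
  classical
  choose s hs using exists_row f
  exact ⟨t.biUnion s, fun j hj i hi => hs j i fun h => hi (Finset.mem_biUnion.2 ⟨j, hj, h⟩)⟩

/-- Matrix multiplication. -/
noncomputable def sigmaCompFun {x y z : SigmaObj C} {q p n : ℤ} (h : q + p = n)
    (g : sigmaHom y z q) (f : sigmaHom x y p) : sigmaHom x z n :=
  ⟨fun l i => sigmaCompEntry h g f l i, fun l => by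
    obtain ⟨s, hs⟩ := exists_row g l
    obtain ⟨t, ht⟩ := exists_rows f s
    refine t.finite_toSet.subset (fun i hi => ?_)
    by_contra hit
    refine hi ?_
    change sigmaCompEntry h g f l i = 0
    rw [sigmaCompEntry_eq_sum_row h g f l i s hs]
    exact Finset.sum_eq_zero (fun j hj => by rw [ht j hj i hit, map_zero])⟩

/-- Matrix multiplication as a bilinear map. -/
noncomputable def sigmaComp {x y z : SigmaObj C} {q p n : ℤ} (h : q + p = n) :
    sigmaHom y z q →ₗ[k] sigmaHom x y p →ₗ[k] sigmaHom x z n :=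
  LinearMap.mk₂ k (sigmaCompFun h)
    (fun g g' f => by
      classical
      ext l i
      obtain ⟨s, hs⟩ := exists_row g l
      obtain ⟨s', hs'⟩ := exists_row g' l
      change sigmaCompEntry h (g + g') f l i = sigmaCompEntry h g f l i + sigmaCompEntry h g' f l i
      rw [sigmaCompEntry_eq_sum_row h g f l i (s ∪ s') (fun j hj => hs j (by grind)),
        sigmaCompEntry_eq_sum_row h g' f l i (s ∪ s') (fun j hj => hs' j (by grind)),
        sigmaCompEntry_eq_sum_row h (g + g') f l i (s ∪ s') (fun j hj => by
          change g.1 l j + g'.1 l j = 0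
          rw [hs j (by grind), hs' j (by grind), add_zero]), ← Finset.sum_add_distrib]
      exact Finset.sum_congr rfl (fun j _ => by simp))
    (fun c g f => by
      ext l i
      obtain ⟨s, hs⟩ := exists_row g l
      change sigmaCompEntry h (c • g) f l i = c • sigmaCompEntry h g f l i
      rw [sigmaCompEntry_eq_sum_row h g f l i s hs,
        sigmaCompEntry_eq_sum_row h (c • g) f l i s (fun j hj => by
          change c • g.1 l j = 0
          rw [hs j hj, smul_zero]), Finset.smul_sum]
      exact Finset.sum_congr rfl (fun j _ => by simp))
    (fun g f f' => by
      ext l i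
      obtain ⟨s, hs⟩ := exists_row g l
      change sigmaCompEntry h g (f + f') l i = sigmaCompEntry h g f l i + sigmaCompEntry h g f' l i
      simp only [sigmaCompEntry_eq_sum_row h g _ l i s hs]
      rw [← Finset.sum_add_distrib]
      exact Finset.sum_congr rfl (fun j _ => by simp))
    (fun c g f => by
      ext l i
      obtain ⟨s, hs⟩ := exists_row g l
      change sigmaCompEntry h g (c • f) l i = c • sigmaCompEntry h g f l i
      simp only [sigmaCompEntry_eq_sum_row h g _ l i s hs]
      rw [Finset.smul_sum]
      exact Finset.sum_congr rfl (fun j _ => by simp))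

open Classical in
/-- The identity matrix. -/
noncomputable def sigmaId (x : SigmaObj C) : sigmaHom x x 0 :=
  ⟨fun j i => if h : i = j then C.castDeg (by subst h; omega) (C.idTo (congrArg x.X h)) else 0,
    fun j => (Set.finite_singleton j).subset (fun i hi => by
      by_contra hij
      exact hi (dif_neg hij))⟩

theorem sigmaId_self (x : SigmaObj C) (i : x.I) :
    (sigmaId x).1 i i = C.castDeg (by omega) (C.id (x.X i)) := by
  simp [sigmaId, idTo]

theorem sigmaId_of_ne (x : SigmaObj C) {i j : x.I} (h : i ≠ j) : (sigmaId x).1 j i = 0 := by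
  simp [sigmaId, h]

variable (C) in
/-- The additive suspended envelope `Σ^Π C` with countable direct products. -/
@[reducible] noncomputable def SigmaPi : DGCat.{w, u} k where
  Obj := SigmaObj C
  Hom x y n := sigmaHom x y n
  d {x y} n m h := sigmaD x y n m h
  id x := sigmaId x
  comp h := sigmaComp h
  d_d {x y n m l} h h' f := by
    ext j i
    change ((y.a j).negOnePow : ℤ) • C.d _ _ _ (((y.a j).negOnePow : ℤ) • C.d _ _ _ (f.1 j i)) = 0
    rw [map_zsmul, C.d_d, smul_zero, smul_zero]
  d_id {x m} h := by
    ext j i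
    change ((x.a j).negOnePow : ℤ) • C.d _ _ _ ((sigmaId x).1 j i) = 0
    by_cases hij : i = j
    · subst hij
      rw [sigmaId_self, d_castDeg_id, smul_zero]
    · rw [sigmaId_of_ne x hij, map_zero, smul_zero]
  leibniz {x y z q p n q' p' n'} h hq hp hn h₁ h₂ g f := by
    ext l i
    obtain ⟨s, hs⟩ := exists_row g l
    change ((z.a l).negOnePow : ℤ) • C.d _ _ _ (sigmaCompEntry h g f l i) =
      sigmaCompEntry h₁ (sigmaD y z q q' hq g) f l i +
        (q.negOnePow : ℤ) • sigmaCompEntry h₂ g (sigmaD x y p p' hp f) l i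
    rw [sigmaCompEntry_eq_sum_row h g f l i s hs,
      sigmaCompEntry_eq_sum_row h₂ g _ l i s hs,
      sigmaCompEntry_eq_sum_row h₁ (sigmaD y z q q' hq g) f l i s (fun j hj => by
        change ((z.a l).negOnePow : ℤ) • C.d _ _ _ (g.1 l j) = 0
        rw [hs j hj, map_zero, smul_zero]),
      map_sum, Finset.smul_sum, Finset.smul_sum, ← Finset.sum_add_distrib]
    refine Finset.sum_congr rfl (fun j _ => ?_)
    change _ = C.comp _ (((z.a l).negOnePow : ℤ) • C.d _ _ _ (g.1 l j)) (f.1 j i) +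
      (q.negOnePow : ℤ) • C.comp _ (g.1 l j) (((y.a j).negOnePow : ℤ) • C.d _ _ _ (f.1 j i))
    rw [C.leibniz (q' := q' + z.a l - y.a j) (p' := p' + y.a j - x.a i) _ (by omega) (by omega)
      (by omega) (by omega) (by omega), smul_add, smul_smul]
    simp only [map_zsmul, LinearMap.smul_apply, smul_smul]
    congr 2
    rw [← Units.val_mul, ← Units.val_mul, ← Int.negOnePow_add, ← Int.negOnePow_add]
    congr 1
    rw [Int.negOnePow_eq_iff]
    exact ⟨z.a l - y.a j, by ring⟩
  id_comp {x y p} h f := by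
    ext j i
    change sigmaCompEntry h (sigmaId y) f j i = _
    rw [sigmaCompEntry_eq_sum_row h (sigmaId y) f j i {j} (fun m hm => sigmaId_of_ne y (by
      simpa using hm)), Finset.sum_singleton, sigmaId_self, castDeg_id_comp, castDeg_rfl]
  comp_id {x y p} h f := by
    ext j i
    change sigmaCompEntry h f (sigmaId x) j i = _
    rw [sigmaCompEntry_eq_sum h f (sigmaId x) j i {i} (fun m hm => by
      rw [sigmaId_of_ne x (by simpa [eq_comm] using hm), map_zero]), Finset.sum_singleton,
      sigmaId_self, comp_castDeg_id, castDeg_rfl]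
  assoc {v x y z r q p rq qp n} h₁ h₂ h₃ h₄ h g f := by
    ext l i
    obtain ⟨s, hs⟩ := exists_row h l
    obtain ⟨t, ht⟩ := exists_rows g s
    change sigmaCompEntry h₃ (sigmaCompFun h₁ h g) f l i =
      sigmaCompEntry h₄ h (sigmaCompFun h₂ g f) l i
    have e : ∀ m, (sigmaCompFun h₁ h g).1 l m =
        ∑ j ∈ s, C.comp (by omega) (h.1 l j) (g.1 j m) :=
      fun m => sigmaCompEntry_eq_sum_row h₁ h g l m s hs
    rw [sigmaCompEntry_eq_sum_row h₄ h _ l i s hs,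
      sigmaCompEntry_eq_sum_row h₃ _ f l i t (fun m hm => by
        rw [e]
        exact Finset.sum_eq_zero (fun j hj => by rw [ht j hj m hm, map_zero]))]
    have e' : ∀ j ∈ s, (sigmaCompFun h₂ g f).1 j i =
        ∑ m ∈ t, C.comp (by omega) (g.1 j m) (f.1 m i) :=
      fun j hj => sigmaCompEntry_eq_sum_row h₂ g f j i t (ht j hj)
    have e'' := Finset.sum_congr (rfl : s = s) (fun j hj =>
      congrArg (fun x => C.comp (show r + z.a l - y.a j + (qp + y.a j - v.a i) =
        n + z.a l - v.a i by omega) (h.1 l j) x) (e' j hj))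
    refine Eq.trans ?_ e''.symm
    simp only [e, map_sum, LinearMap.sum_apply]
    rw [Finset.sum_comm]
    refine Finset.sum_congr rfl (fun j _ => Finset.sum_congr rfl (fun m _ => ?_))
    exact C.assoc _ _ _ _ _ _ _

end SigmaPi

/-! ### Coherent homotopy idempotents and their images -/

section AInf

variable (C : DGCat.{w, u} k)

/-- An `A_∞`-idempotent in `C`: an object `X` with endomorphisms `e j` of degree `-2 j` and `h j`
of degree `-1 - 2 j` satisfying
`d (e j) = ∑_{a + b = j - 1} (e a ∘ h b - h a ∘ e b)` and
`d (h j) = e j - ∑_{a + b = j} e a ∘ e b - ∑_{a + b = j - 1} h a ∘ h b`. -/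
structure AInfIdempotent where
  /-- the underlying object -/
  X : C.Obj
  /-- the components of even degree -/
  e : ∀ j : ℕ, C.Hom X X (-2 * j)
  /-- the components of odd degree -/
  h : ∀ j : ℕ, C.Hom X X (-1 - 2 * j)
  d_e : ∀ j : ℕ, C.d (-2 * j) (1 - 2 * j) (by omega) (e j) =
    ∑ a : Fin j, (C.comp (by omega) (e a) (h (j - 1 - a)) -
      C.comp (by omega) (h a) (e (j - 1 - a)))
  d_h : ∀ j : ℕ, C.d (-1 - 2 * j) (-2 * j) (by omega) (h j) =
    e j - ∑ a : Fin (j + 1), C.comp (by omega) (e a) (e (j - a)) -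
      ∑ a : Fin j, C.comp (by omega) (h a) (h (j - 1 - a))

variable {C}

/-- The even components of the complementary `A_∞`-idempotent: `id - e 0` and `- e j` for
`j ≥ 1`. -/
def AInfIdempotent.ePerp (A : AInfIdempotent C) (j : ℕ) : C.Hom A.X A.X (-2 * j) :=
  if h : j = 0 then C.castDeg (by omega) (C.id A.X) - A.e j else -A.e j

open Classical in
/-- The component from position `i` to position `j` of the twist defining the image of an
`A_∞`-idempotent. -/
noncomputable def AInfIdempotent.entry (A : AInfIdempotent C) (j i : ℤ) :
    C.Hom A.X A.X (1 + -j - -i) :=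
  if h : ∃ m : ℕ, j = i + 1 + 2 * m then
    C.castDeg (by have := h.choose_spec; omega)
      (if Even i then -A.ePerp h.choose else A.e h.choose)
  else if h : ∃ m : ℕ, j = i + 2 * m + 2 then
    C.castDeg (by have := h.choose_spec; omega)
      (if Even i then A.h h.choose else -A.h h.choose)
  else 0

/-- The product `X × Σ⁻¹ X × Σ⁻² X × ⋯`. -/
abbrev tower (X : C.Obj) : SigmaObj C where
  I := {i | 0 ≤ i}
  X := fun _ => X
  a := fun i => -i.1

/-- Composition with a total degree that is not tied to the degrees of the factors (zero unless
the degrees match); only used in computations. -/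
def tcomp {X Y Z : C.Obj} {q p : ℤ} (n : ℤ) (g : C.Hom Y Z q) (f : C.Hom X Y p) : C.Hom X Z n :=
  if h : q + p = n then C.comp h g f else 0

theorem comp_eq_tcomp {X Y Z : C.Obj} {q p n : ℤ} (h : q + p = n) (g : C.Hom Y Z q)
    (f : C.Hom X Y p) : C.comp h g f = C.tcomp n g f := by simp [tcomp, h]

theorem tcomp_castDeg_left {X Y Z : C.Obj} {q q' p n : ℤ} (h : q = q')
    (g : C.Hom Y Z q) (f : C.Hom X Y p) :
    C.tcomp n (C.castDeg h g) f = C.tcomp n g f := by subst h; rfl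

theorem tcomp_castDeg_right {X Y Z : C.Obj} {q p p' n : ℤ} (h : p = p')
    (g : C.Hom Y Z q) (f : C.Hom X Y p) :
    C.tcomp n g (C.castDeg h f) = C.tcomp n g f := by subst h; rfl

theorem tcomp_sub_left {X Y Z : C.Obj} {q p n : ℤ} (g g' : C.Hom Y Z q) (f : C.Hom X Y p) :
    C.tcomp n (g - g') f = C.tcomp n g f - C.tcomp n g' f := by
  unfold tcomp; split_ifs <;> simp

theorem tcomp_sub_right {X Y Z : C.Obj} {q p n : ℤ} (g : C.Hom Y Z q) (f f' : C.Hom X Y p) :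
    C.tcomp n g (f - f') = C.tcomp n g f - C.tcomp n g f' := by
  unfold tcomp; split_ifs <;> simp

theorem tcomp_neg_left {X Y Z : C.Obj} {q p n : ℤ} (g : C.Hom Y Z q) (f : C.Hom X Y p) :
    C.tcomp n (-g) f = -C.tcomp n g f := by
  unfold tcomp; split_ifs <;> simp

theorem tcomp_neg_right {X Y Z : C.Obj} {q p n : ℤ} (g : C.Hom Y Z q) (f : C.Hom X Y p) :
    C.tcomp n g (-f) = -C.tcomp n g f := by
  unfold tcomp; split_ifs <;> simp

/-- The identity in degree zero and zero in all other degrees. -/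
def idDeg (X : C.Obj) (n : ℤ) : C.Hom X X n :=
  if h : 0 = n then C.castDeg h (C.id X) else 0

theorem idDeg_of_ne (X : C.Obj) {n : ℤ} (h : n ≠ 0) : C.idDeg X n = 0 := by
  simp [idDeg, h.symm]

theorem d_idDeg (X : C.Obj) (n m : ℤ) (h : n + 1 = m) : C.d n m h (C.idDeg X n) = 0 := by
  unfold idDeg
  split_ifs
  · exact d_castDeg_id _ _
  · simp

theorem tcomp_idDeg {X Y : C.Obj} {q p n : ℤ} (h : q = n) (hp : p = 0) (g : C.Hom X Y q) :
    C.tcomp n g (C.idDeg X p) = C.castDeg h g := by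
  subst h hp
  simp [tcomp, idDeg, C.comp_id]

theorem idDeg_tcomp {X Y : C.Obj} {q p n : ℤ} (h : p = n) (hq : q = 0) (f : C.Hom X Y p) :
    C.tcomp n (C.idDeg Y q) f = C.castDeg h f := by
  subst h hq
  simp [tcomp, idDeg, C.id_comp]

theorem tcomp_zero_left {X Y Z : C.Obj} {q p n : ℤ} (f : C.Hom X Y p) :
    C.tcomp n (0 : C.Hom Y Z q) f = 0 := by
  unfold tcomp; split_ifs <;> simp

theorem tcomp_zero_right {X Y Z : C.Obj} {q p n : ℤ} (g : C.Hom Y Z q) :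
    C.tcomp n g (0 : C.Hom X Y p) = 0 := by
  unfold tcomp; split_ifs <;> simp

namespace AInfIdempotent

variable (A : AInfIdempotent C)

theorem neg_ePerp (j : ℕ) : -A.ePerp j = A.e j - C.idDeg A.X (-2 * j) := by
  unfold ePerp idDeg
  by_cases h : j = 0
  · subst h; simp
  · rw [dif_neg h, dif_neg (by omega)]; simp

theorem e_congr {m m' : ℕ} (h : m = m') :
    A.e m = C.castDeg (by omega) (A.e m') := by subst h; rfl

theorem h_congr {m m' : ℕ} (h : m = m') :
    A.h m = C.castDeg (by omega) (A.h m') := by subst h; rfl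

theorem entry_odd_even {j i : ℤ} (m : ℕ) (h : j = i + 1 + 2 * m) (hi : Even i) :
    A.entry j i = C.castDeg (by omega) (A.e m - C.idDeg A.X (-2 * m)) := by
  have hex : ∃ m : ℕ, j = i + 1 + 2 * m := ⟨m, h⟩
  have hc : hex.choose = m := by have := hex.choose_spec; omega
  rw [entry, dif_pos hex]
  simp only [if_pos hi, neg_ePerp]
  generalize_proofs at hc ⊢
  revert hc
  generalize Exists.choose _ = c at *
  rintro rfl; rfl

theorem entry_odd_odd {j i : ℤ} (m : ℕ) (h : j = i + 1 + 2 * m) (hi : ¬ Even i) :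
    A.entry j i = C.castDeg (by omega) (A.e m) := by
  have hex : ∃ m : ℕ, j = i + 1 + 2 * m := ⟨m, h⟩
  have hc : hex.choose = m := by have := hex.choose_spec; omega
  rw [entry, dif_pos hex, if_neg hi, A.e_congr hc, castDeg_castDeg]

theorem entry_even_even {j i : ℤ} (m : ℕ) (h : j = i + 2 * m + 2) (hi : Even i) :
    A.entry j i = C.castDeg (by omega) (A.h m) := by
  have hex : ∃ m : ℕ, j = i + 2 * m + 2 := ⟨m, h⟩
  have hc : hex.choose = m := by have := hex.choose_spec; omega
  rw [entry, dif_neg (by rintro ⟨m', h'⟩; omega), dif_pos hex, if_pos hi, A.h_congr hc,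
    castDeg_castDeg]

theorem entry_even_odd {j i : ℤ} (m : ℕ) (h : j = i + 2 * m + 2) (hi : ¬ Even i) :
    A.entry j i = -C.castDeg (by omega) (A.h m) := by
  have hex : ∃ m : ℕ, j = i + 2 * m + 2 := ⟨m, h⟩
  have hc : hex.choose = m := by have := hex.choose_spec; omega
  rw [entry, dif_neg (by rintro ⟨m', h'⟩; omega), dif_pos hex, if_neg hi, A.h_congr hc,
    castDeg_neg, castDeg_castDeg]

theorem entry_of_le {j i : ℤ} (h : j ≤ i) : A.entry j i = 0 := by
  rw [entry, dif_neg (by rintro ⟨m', h'⟩; omega), dif_neg (by rintro ⟨m', h'⟩; omega)]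

/-- The twist on `X × Σ⁻¹ X × ⋯` attached to an `A_∞`-idempotent. -/
noncomputable def twist : sigmaHom (tower A.X) (tower A.X) 1 :=
  ⟨fun j i => A.entry j.1 i.1, fun j => by
    refine Set.Finite.of_finite_image (f := Subtype.val) ((Set.finite_Ico 0 j.1).subset ?_)
      Subtype.val_injective.injOn
    rintro _ ⟨i, hi, rfl⟩
    refine ⟨i.2, ?_⟩
    by_contra hij
    exact hi (A.entry_of_le (not_lt.1 hij))⟩

theorem d_e' (j : ℕ) (n m : ℤ) (hn : -2 * (j + 1 : ℕ) = n) (hm : n + 1 = m) :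
    C.d n m hm (C.castDeg hn (A.e (j + 1))) =
      ∑ a ∈ Finset.range (j + 1), (C.tcomp m (A.e a) (A.h (j - a)) -
        C.tcomp m (A.h a) (A.e (j - a))) := by
  obtain rfl : m = 1 - 2 * (j + 1 : ℕ) := by omega
  rw [d_castDeg, A.d_e, Finset.sum_range]
  refine Finset.sum_congr rfl (fun a _ => ?_)
  simp only [comp_eq_tcomp]
  rfl

theorem d_e_zero (n m : ℤ) (hn : -2 * (0 : ℕ) = n) (hm : n + 1 = m) :
    C.d n m hm (C.castDeg hn (A.e 0)) = 0 := by
  obtain rfl : m = 1 - 2 * (0 : ℕ) := by omega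
  rw [d_castDeg, A.d_e]
  rfl

theorem d_h' (j : ℕ) (n m : ℤ) (hn : -1 - 2 * (j : ℤ) = n) (hm : n + 1 = m) :
    C.d n m hm (C.castDeg hn (A.h j)) =
      C.castDeg (by omega) (A.e j) -
        ∑ a ∈ Finset.range (j + 1), C.tcomp m (A.e a) (A.e (j - a)) -
        ∑ a ∈ Finset.range j, C.tcomp m (A.h a) (A.h (j - 1 - a)) := by
  obtain rfl : m = -2 * (j : ℤ) := by omega
  rw [d_castDeg, A.d_h, Finset.sum_range, Finset.sum_range]
  simp only [comp_eq_tcomp]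
  rfl

theorem sum_range_even {M : Type*} [AddCommGroup M] (F : ℕ → M) (K : ℕ) :
    ∑ a ∈ Finset.range (2 * K), F a =
      ∑ b ∈ Finset.range K, (F (2 * b) + F (2 * b + 1)) := by
  induction K with
  | zero => simp
  | succ K ih =>
    rw [Finset.sum_range_succ, ← ih, Nat.mul_succ, Finset.sum_range_succ, Finset.sum_range_succ,
      add_assoc]

theorem sum_range_odd {M : Type*} [AddCommGroup M] (F : ℕ → M) (K : ℕ) :
    ∑ a ∈ Finset.range (2 * K + 1), F a =
      ∑ b ∈ Finset.range (K + 1), F (2 * b) + ∑ b ∈ Finset.range K, F (2 * b + 1) := by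
  rw [Finset.sum_range_succ, sum_range_even, Finset.sum_add_distrib, Finset.sum_range_succ]
  abel

theorem reflect {M : Type*} [AddCommGroup M] (F : ℕ → ℕ → M) (K : ℕ) :
    ∑ b ∈ Finset.range (K + 1), F (K - b) b = ∑ b ∈ Finset.range (K + 1), F b (K - b) := by
  rw [← Finset.sum_range_reflect]
  refine Finset.sum_congr rfl (fun b hb => ?_)
  have := Finset.mem_range.1 hb
  congr 1; omega

theorem reflect' {M : Type*} [AddCommGroup M] (F : ℕ → ℕ → M) (K : ℕ) :
    ∑ b ∈ Finset.range K, F (K - 1 - b) b = ∑ b ∈ Finset.range K, F b (K - 1 - b) := by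
  rw [← Finset.sum_range_reflect]
  refine Finset.sum_congr rfl (fun b hb => ?_)
  have := Finset.mem_range.1 hb
  congr 1; omega

theorem sum_idDeg_right {Y : C.Obj} {X : C.Obj} {n : ℤ} (q : ℕ → ℤ)
    (f : ∀ b, C.Hom X Y (q b)) (K : ℕ) (h : q K = n) :
    ∑ b ∈ Finset.range (K + 1), C.tcomp n (f (K - b)) (C.idDeg X (-2 * (b : ℤ))) =
      C.castDeg h (f K) := by
  rw [Finset.sum_eq_single 0]
  · exact tcomp_idDeg h (by simp) _
  · intro b _ hb
    rw [idDeg_of_ne _ (by omega), tcomp_zero_right]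
  · simp

theorem sum_idDeg_left {Y : C.Obj} {X : C.Obj} {n : ℤ} (q : ℕ → ℤ)
    (f : ∀ b, C.Hom X Y (q b)) (K : ℕ) (h : q K = n) :
    ∑ b ∈ Finset.range (K + 1), C.tcomp n (C.idDeg Y (-2 * ((K - b : ℕ) : ℤ))) (f b) =
      C.castDeg h (f K) := by
  rw [Finset.sum_eq_single K]
  · exact idDeg_tcomp h (by simp) _
  · intro b hb hbK
    have := Finset.mem_range.1 hb
    rw [idDeg_of_ne _ (by omega), tcomp_zero_left]
  · simp

theorem comp_twist_entry (j i : (tower A.X).I) (N : ℕ) (h : j.1 = i.1 + 1 + N)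
    (n : ℤ) (hn : n = 2 + -j.1 - -i.1) :
    sigmaCompEntry (show (1 : ℤ) + 1 = 2 from rfl) A.twist A.twist j i =
      C.castDeg (by subst hn; rfl) (∑ a ∈ Finset.range N, C.tcomp n
        (A.entry j.1 (i.1 + 1 + a)) (A.entry (i.1 + 1 + a) i.1)) := by
  classical
  subst hn
  have hi : 0 ≤ i.1 := i.2
  let φ : ℕ → (tower A.X).I := fun a => ⟨i.1 + 1 + a, by change 0 ≤ i.1 + 1 + (a : ℤ); omega⟩
  have hφ : Function.Injective φ := fun a b hab => by
    have : i.1 + 1 + (a : ℤ) = i.1 + 1 + b := congrArg Subtype.val hab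
    omega
  rw [sigmaCompEntry_eq_sum _ _ _ j i ((Finset.range N).image φ) (fun l hl => ?_),
    Finset.sum_image hφ.injOn, castDeg_sum]
  · refine Finset.sum_congr rfl (fun a _ => ?_)
    rw [comp_eq_tcomp]
    rfl
  · by_cases h1 : l.1 ≤ i.1
    · have : A.twist.1 l i = 0 := A.entry_of_le h1
      rw [this, map_zero]
    · have h2 : j.1 ≤ l.1 := by
        by_contra h2
        refine hl (Finset.mem_image.2 ⟨(l.1 - i.1 - 1).toNat, Finset.mem_range.2 (by omega), ?_⟩)
        apply Subtype.ext
        change i.1 + 1 + ((l.1 - i.1 - 1).toNat : ℤ) = l.1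
        omega
      have : A.twist.1 j l = 0 := A.entry_of_le h2
      rw [this, map_zero, LinearMap.zero_apply]

theorem comp_twist_entry_of_le (j i : (tower A.X).I) (h : j.1 ≤ i.1) :
    sigmaCompEntry (show (1 : ℤ) + 1 = 2 from rfl) A.twist A.twist j i = 0 := by
  rw [sigmaCompEntry_eq_sum _ _ _ j i ∅ (fun l _ => ?_), Finset.sum_empty]
  by_cases h1 : l.1 ≤ i.1
  · have : A.twist.1 l i = 0 := A.entry_of_le h1
    rw [this, map_zero]
  · have : A.twist.1 j l = 0 := A.entry_of_le (by omega)
    rw [this, map_zero, LinearMap.zero_apply]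

theorem negOnePow_neg_coe_even {j : ℤ} (h : Even j) : ((-j).negOnePow : ℤ) = 1 := by
  rw [Int.negOnePow_even _ h.neg]; rfl

theorem negOnePow_neg_coe_odd {j : ℤ} (h : Odd j) : ((-j).negOnePow : ℤ) = -1 := by
  rw [Int.negOnePow_odd _ h.neg]; rfl

theorem mc_odd (j i : ℤ) (K : ℕ) (hj : j = i + 1 + (2 * (K + 1) : ℕ)) (n m : ℤ)
    (hn : n = 1 + -j - -i) (hm : n + 1 = m) :
    ((-j).negOnePow : ℤ) • C.d n m hm (C.castDeg hn.symm (A.entry j i)) +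
      ∑ a ∈ Finset.range (2 * (K + 1)), C.tcomp m
        (A.entry j (i + 1 + a)) (A.entry (i + 1 + a) i) = 0 := by
  have hK : ∀ b ∈ Finset.range (K + 1), b ≤ K := fun b hb => by
    have := Finset.mem_range.1 hb; omega
  have h1 := reflect (fun a b => C.tcomp m (A.e a) (A.h b)) K
  have h2 := reflect (fun a b => C.tcomp m (A.h a) (A.e b)) K
  have h3 := sum_idDeg_right (X := A.X) (n := m) (fun b => -1 - 2 * (b : ℤ)) A.h K (by omega)
  have h4 := sum_idDeg_left (Y := A.X) (n := m) (fun b => -1 - 2 * (b : ℤ)) A.h K (by omega)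
  have hd := A.d_e' K n m (by omega) hm
  rw [sum_range_even]
  by_cases hi : Even i
  · have hjo : Odd j := by
      rw [hj]; push_cast
      exact (hi.add_one).add_even (even_two_mul _)
    rw [Finset.sum_congr rfl (g := fun b =>
      -(C.tcomp m (A.h (K - b)) (A.e b) - C.tcomp m (A.h (K - b)) (C.idDeg A.X (-2 * (b : ℤ)))) +
      (C.tcomp m (A.e (K - b)) (A.h b) -
        C.tcomp m (C.idDeg A.X (-2 * ((K - b : ℕ) : ℤ))) (A.h b))) (fun b hb => by
      have := hK b hb
      rw [A.entry_even_odd (K - b) (by omega) (by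
          rw [Int.not_even_iff_odd]
          exact (hi.add_one).add_even (by push_cast; exact even_two_mul _)),
        A.entry_odd_even b (by omega) hi,
        A.entry_odd_even (K - b) (by omega) (by
          have : i + 1 + ((2 * b + 1 : ℕ) : ℤ) = i + 2 * (b + 1) := by push_cast; ring
          rw [this]
          exact hi.add (even_two_mul _)),
        A.entry_even_even b (by omega) hi]
      simp only [tcomp_neg_left, tcomp_castDeg_left, tcomp_castDeg_right, tcomp_sub_left,
        tcomp_sub_right]
      abel)]
    rw [A.entry_odd_even (K + 1) (by omega) hi, castDeg_castDeg, negOnePow_neg_coe_odd hjo,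
      castDeg_sub, map_sub, hd, idDeg_of_ne _ (by omega), castDeg_zero, map_zero]
    simp only [Finset.sum_add_distrib, Finset.sum_neg_distrib, Finset.sum_sub_distrib]
    rw [h1, h2, h3, h4]
    simp only [sub_zero, neg_smul, one_smul]
    abel
  · have hio : Odd i := Int.not_even_iff_odd.1 hi
    have hje : Even j := by
      rw [hj]; push_cast
      exact (hio.add_one).add (even_two_mul _)
    rw [Finset.sum_congr rfl (g := fun b =>
      C.tcomp m (A.h (K - b)) (A.e b) + -C.tcomp m (A.e (K - b)) (A.h b)) (fun b hb => by
      have := hK b hb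
      rw [A.entry_even_even (K - b) (by omega)
          ((hio.add_one).add (by push_cast; exact even_two_mul _)),
        A.entry_odd_odd b (by omega) hi,
        A.entry_odd_odd (K - b) (by omega) (by
          have : i + 1 + ((2 * b + 1 : ℕ) : ℤ) = i + 2 * (b + 1) := by push_cast; ring
          rw [this, Int.not_even_iff_odd]
          exact hio.add_even (even_two_mul _)),
        A.entry_even_odd b (by omega) hi]
      simp only [tcomp_neg_right, tcomp_castDeg_left, tcomp_castDeg_right])]
    rw [A.entry_odd_odd (K + 1) (by omega) hi, castDeg_castDeg, negOnePow_neg_coe_even hje, hd]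
    simp only [Finset.sum_add_distrib, Finset.sum_neg_distrib, Finset.sum_sub_distrib]
    rw [h1, h2]
    simp only [one_smul]
    abel

theorem mc_even (j i : ℤ) (K : ℕ) (hj : j = i + 1 + (2 * K + 1 : ℕ)) (n m : ℤ)
    (hn : n = 1 + -j - -i) (hm : n + 1 = m) :
    ((-j).negOnePow : ℤ) • C.d n m hm (C.castDeg hn.symm (A.entry j i)) +
      ∑ a ∈ Finset.range (2 * K + 1), C.tcomp m
        (A.entry j (i + 1 + a)) (A.entry (i + 1 + a) i) = 0 := by
  have hK : ∀ b ∈ Finset.range (K + 1), b ≤ K := fun b hb => by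
    have := Finset.mem_range.1 hb; omega
  have h1 := reflect (fun a b => C.tcomp m (A.e a) (A.e b)) K
  have h2 := reflect' (fun a b => C.tcomp m (A.h a) (A.h b)) K
  have h3 := sum_idDeg_right (X := A.X) (n := m) (fun b => -2 * (b : ℤ)) A.e K (by omega)
  have h4 := sum_idDeg_left (Y := A.X) (n := m) (fun b => -2 * (b : ℤ)) A.e K (by omega)
  have hd := A.d_h' K n m (by omega) hm
  rw [sum_range_odd]
  by_cases hi : Even i
  · have hje : Even j := by
      have : j = i + 2 * (K + 1) := by rw [hj]; push_cast; ring
      rw [this]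
      exact hi.add (even_two_mul _)
    rw [Finset.sum_congr rfl (g := fun b =>
      C.tcomp m (A.e (K - b)) (A.e b) -
        C.tcomp m (A.e (K - b)) (C.idDeg A.X (-2 * (b : ℤ)))) (fun b hb => by
      have := hK b hb
      rw [A.entry_odd_odd (K - b) (by omega) (by
          rw [Int.not_even_iff_odd]
          exact (hi.add_one).add_even (by push_cast; exact even_two_mul _)),
        A.entry_odd_even b (by omega) hi]
      simp only [tcomp_castDeg_left, tcomp_castDeg_right, tcomp_sub_right]),
      Finset.sum_congr (s₁ := Finset.range K) rfl (g := fun b =>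
        C.tcomp m (A.h (K - 1 - b)) (A.h b)) (fun b hb => by
      have := Finset.mem_range.1 hb
      rw [A.entry_even_even (K - 1 - b) (by omega) (by
          have : i + 1 + ((2 * b + 1 : ℕ) : ℤ) = i + 2 * (b + 1) := by push_cast; ring
          rw [this]
          exact hi.add (even_two_mul _)),
        A.entry_even_even b (by omega) hi]
      simp only [tcomp_castDeg_left, tcomp_castDeg_right])]
    rw [A.entry_even_even K (by omega) hi, castDeg_castDeg, negOnePow_neg_coe_even hje, hd]
    simp only [Finset.sum_sub_distrib]
    rw [h1, h2, h3]
    simp only [one_smul]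
    abel
  · have hio : Odd i := Int.not_even_iff_odd.1 hi
    have hjo : Odd j := by
      have : j = i + 2 * (K + 1) := by rw [hj]; push_cast; ring
      rw [this]
      exact hio.add_even (even_two_mul _)
    rw [Finset.sum_congr rfl (g := fun b =>
      C.tcomp m (A.e (K - b)) (A.e b) -
        C.tcomp m (C.idDeg A.X (-2 * ((K - b : ℕ) : ℤ))) (A.e b)) (fun b hb => by
      have := hK b hb
      rw [A.entry_odd_even (K - b) (by omega)
          ((hio.add_one).add (by push_cast; exact even_two_mul _)),
        A.entry_odd_odd b (by omega) hi]
      simp only [tcomp_castDeg_left, tcomp_castDeg_right, tcomp_sub_left]),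
      Finset.sum_congr (s₁ := Finset.range K) rfl (g := fun b =>
        C.tcomp m (A.h (K - 1 - b)) (A.h b)) (fun b hb => by
      have := Finset.mem_range.1 hb
      rw [A.entry_even_odd (K - 1 - b) (by omega) (by
          have : i + 1 + ((2 * b + 1 : ℕ) : ℤ) = i + 2 * (b + 1) := by push_cast; ring
          rw [this, Int.not_even_iff_odd]
          exact hio.add_even (even_two_mul _)),
        A.entry_even_odd b (by omega) hi]
      simp only [tcomp_neg_left, tcomp_neg_right, neg_neg, tcomp_castDeg_left,
        tcomp_castDeg_right])]
    rw [A.entry_even_odd K (by omega) hi, castDeg_neg, castDeg_castDeg,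
      negOnePow_neg_coe_odd hjo, map_neg, hd]
    simp only [Finset.sum_sub_distrib]
    rw [h1, h2, h4]
    simp only [neg_smul, one_smul]
    abel

theorem twist_maurerCartan :
    sigmaD _ _ 1 2 rfl A.twist +
      sigmaComp (show (1 : ℤ) + 1 = 2 from rfl) A.twist A.twist = 0 := by
  refine sigmaHom_ext (fun j i => ?_)
  change ((-j.1).negOnePow : ℤ) • C.d (1 + -j.1 - -i.1) (2 + -j.1 - -i.1) (by omega)
    (A.entry j.1 i.1) + sigmaCompEntry (show (1 : ℤ) + 1 = 2 from rfl) A.twist A.twist j i = 0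
  rcases le_or_gt j.1 i.1 with hji | hji
  · rw [A.comp_twist_entry_of_le j i hji, A.entry_of_le hji, map_zero, smul_zero, add_zero]
  · obtain ⟨N, hN⟩ : ∃ N : ℕ, j.1 = i.1 + 1 + N := ⟨(j.1 - i.1 - 1).toNat, by omega⟩
    rw [A.comp_twist_entry j i N hN _ rfl, castDeg_rfl]
    obtain ⟨K, rfl | rfl⟩ : ∃ K, N = 2 * K ∨ N = 2 * K + 1 := ⟨N / 2, by omega⟩
    · rcases K with _ | K
      · rw [Nat.mul_zero, Finset.range_zero, Finset.sum_empty, add_zero]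
        by_cases hi : Even i.1
        · rw [A.entry_odd_even 0 (by omega) hi, castDeg_sub, map_sub, A.d_e_zero, d_castDeg,
            d_idDeg, sub_zero, smul_zero]
        · rw [A.entry_odd_odd 0 (by omega) hi, A.d_e_zero, smul_zero]
      · exact A.mc_odd j.1 i.1 K hN _ _ rfl _
    · exact A.mc_even j.1 i.1 K hN _ _ rfl _

/-- The twisted complex `Z(X, e, h)` in `Tw(Σ^Π C)` attached to an `A_∞`-idempotent. -/
noncomputable def Z : (Tw (SigmaPi C)).Obj where
  X := tower A.X
  α := A.twist
  maurerCartan := A.twist_maurerCartan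

/-- The `A_∞`-idempotent given by the identity of `X`. -/
abbrev ofId (X : C.Obj) : AInfIdempotent C where
  X := X
  e j := C.idDeg X (-2 * j)
  h _ := 0
  d_e j := by simp [d_idDeg]
  d_h j := by
    simp only [map_zero, Finset.sum_const_zero, sub_zero]
    rw [eq_comm, sub_eq_zero, Finset.sum_eq_single 0]
    · rw [comp_eq_tcomp, idDeg_tcomp (by simp) (by simp)]
      rfl
    · intro a _ ha
      rw [idDeg_of_ne X (n := -2 * ((a : ℕ) : ℤ)) (by
        have : (a : ℕ) ≠ 0 := fun h => ha (Fin.ext h)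
        omega), map_zero, LinearMap.zero_apply]
    · simp

theorem ofId_entry (X : C.Obj) (j i : ℤ) :
    (ofId X).entry j i = if j = i + 1 ∧ Odd i then C.idDeg X _ else 0 := by
  by_cases h1 : ∃ m : ℕ, j = i + 1 + 2 * m
  · obtain ⟨m, hm⟩ := h1
    by_cases hi : Even i
    · rw [entry_odd_even _ m hm hi, if_neg (by simp [hi])]
      change C.castDeg _ (C.idDeg X _ - C.idDeg X _) = 0
      rw [sub_self, castDeg_zero]
    · rw [entry_odd_odd _ m hm hi]
      have hio := Int.not_even_iff_odd.1 hi
      by_cases hm0 : m = 0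
      · subst hm0
        rw [if_pos ⟨by simpa using hm, hio⟩]
        have : (1 + -j - -i) = 0 := by omega
        simp [ofId, idDeg, this]
      · rw [if_neg (by omega)]
        simp only [ofId]
        rw [idDeg_of_ne _ (by omega), castDeg_zero]
  · by_cases h2 : ∃ m : ℕ, j = i + 2 * m + 2
    · obtain ⟨m, hm⟩ := h2
      rw [if_neg (by omega)]
      by_cases hi : Even i
      · rw [entry_even_even _ m hm hi]
        change C.castDeg _ (0 : C.Hom X X _) = 0
        rw [castDeg_zero]
      · rw [entry_even_odd _ m hm hi]
        change -C.castDeg _ (0 : C.Hom X X _) = 0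
        rw [castDeg_zero, neg_zero]
    · rw [if_neg (by rintro ⟨h, -⟩; exact h1 ⟨0, by simpa using h⟩), entry, dif_neg h1,
        dif_neg h2]

end AInfIdempotent

end AInf

/-! ### The dg Karoubi envelope -/

section Kar

variable (C : DGCat.{w, u} k)

/-- The full dg subcategory on the objects satisfying `P`. -/
@[reducible] def FullSub (P : C.Obj → Prop) : DGCat.{w, u} k where
  Obj := {X : C.Obj // P X}
  Hom X Y n := C.Hom X.1 Y.1 n
  d n m h := C.d n m h
  id X := C.id X.1
  comp h := C.comp h
  d_d h h' f := C.d_d h h' f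
  d_id h := C.d_id h
  leibniz h hq hp hn h₁ h₂ g f := C.leibniz h hq hp hn h₁ h₂ g f
  id_comp h f := C.id_comp h f
  comp_id h f := C.comp_id h f
  assoc h₁ h₂ h₃ h₄ h g f := C.assoc h₁ h₂ h₃ h₄ h g f

/-- The dg Karoubi envelope `Kar^dg(C)`: the full dg subcategory of `Tw(Σ^Π C)` on the twisted
complexes homotopy equivalent to `Z(X, e, h)` for some `A_∞`-idempotent `(X, e, h)` in `C`. -/
noncomputable def Kar : DGCat.{w, u} k :=
  (Tw (SigmaPi C)).FullSub fun T =>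
    ∃ A : AInfIdempotent C, (Tw (SigmaPi C)).HomotopyEquivalent T A.Z

variable {C}

/-- The one-entry family `Σ⁰ X`. -/
abbrev single (X : C.Obj) : SigmaObj C where
  I := {0}
  X := fun _ => X
  a := fun _ => 0

/-- The object `tw_0(X)` of `Tw(Σ^Π C)`. -/
noncomputable abbrev twSingle (X : C.Obj) : TwObj (SigmaPi C) where
  X := single X
  α := (0 : sigmaHom (single X) (single X) 1)
  maurerCartan := by
    change sigmaD _ _ 1 2 rfl 0 + sigmaComp _ 0 0 = 0
    simp

/-- A morphism of `C`, as a matrix with one entry. -/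
def singleMap {X Y : C.Obj} (n : ℤ) : C.Hom X Y n →ₗ[k] sigmaHom (single X) (single Y) n where
  toFun f := ⟨fun _ _ => C.castDeg (by simp) f, fun _ =>
    Set.Finite.subset (Set.finite_univ_iff.2 (inferInstanceAs (Finite ({0} : Set ℤ))))
      (Set.subset_univ _)⟩
  map_add' f g := by ext j i; exact castDeg_add _ f g
  map_smul' c f := by ext j i; exact castDeg_smul _ c f

/-- The inclusion of `X` in the first factor of `X × Σ⁻¹ X × ⋯`. -/
def towerIn (X : C.Obj) : sigmaHom (single X) (tower X) 0 :=
  ⟨fun _ _ => C.idDeg X _, fun _ =>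
    Set.Finite.subset (Set.finite_univ_iff.2 (inferInstanceAs (Finite ({0} : Set ℤ))))
      (Set.subset_univ _)⟩

/-- The projection of `X × Σ⁻¹ X × ⋯` to the first factor. -/
def towerOut (X : C.Obj) : sigmaHom (tower X) (single X) 0 :=
  ⟨fun _ _ => C.idDeg X _, fun j => by
    refine Set.Finite.of_finite_image (f := Subtype.val) ((Set.finite_singleton 0).subset ?_)
      Subtype.val_injective.injOn
    rintro _ ⟨i, hi, rfl⟩
    change i.1 = 0
    by_contra h
    refine hi (C.idDeg_of_ne X ?_)
    change (0 : ℤ) + 0 - -i.1 ≠ 0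
    omega⟩

open Classical in
/-- A homotopy contracting `X × Σ⁻¹ X × ⋯`, with the twist of the identity idempotent, to its
first factor. -/
noncomputable def towerHomotopy (X : C.Obj) : sigmaHom (tower X) (tower X) (-1) :=
  ⟨fun j i => if i.1 = j.1 + 1 ∧ Odd j.1 then -C.idDeg X _ else 0, fun j => by
    refine Set.Finite.of_finite_image (f := Subtype.val)
      ((Set.finite_singleton (j.1 + 1)).subset ?_) Subtype.val_injective.injOn
    rintro _ ⟨i, hi, rfl⟩
    change i.1 = j.1 + 1
    by_contra h
    exact hi (if_neg (fun h' => h h'.1))⟩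

theorem sigmaD_idDeg {x y : SigmaObj C} {n m : ℤ} (h : n + 1 = m) (f : sigmaHom x y n)
    (hf : ∀ j i, C.d _ (m + y.a j - x.a i) (by omega) (f.1 j i) = 0) : sigmaD x y n m h f = 0 := by
  ext j i
  change ((y.a j).negOnePow : ℤ) • C.d _ _ _ (f.1 j i) = 0
  rw [hf, smul_zero]

theorem sigmaComp_eq_zero {x y z : SigmaObj C} {q p n : ℤ} (h : q + p = n)
    (g : sigmaHom y z q) (f : sigmaHom x y p)
    (H : ∀ l j i, g.1 l j = 0 ∨ f.1 j i = 0) : sigmaComp h g f = 0 := by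
  ext l i
  change sigmaCompEntry h g f l i = 0
  rw [sigmaCompEntry_eq_sum h g f l i ∅ (fun j _ => by rcases H l j i with e | e <;> simp [e]),
    Finset.sum_empty]

theorem towerIn_ne {X : C.Obj} {j : (tower X).I} (hj : j.1 ≠ 0) (i : (single X).I) :
    (towerIn X).1 j i = 0 := by
  refine C.idDeg_of_ne X ?_
  change (0 : ℤ) + -j.1 - 0 ≠ 0
  omega

theorem towerOut_ne {X : C.Obj} {i : (tower X).I} (hi : i.1 ≠ 0) (j : (single X).I) :
    (towerOut X).1 j i = 0 := by
  refine C.idDeg_of_ne X ?_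
  change (0 : ℤ) + 0 - -i.1 ≠ 0
  omega

theorem sigmaId_entry {x : SigmaObj C} (X : C.Obj) (j i : x.I) (h : j = i) (hX : x.X = fun _ => X) :
    HEq ((sigmaId x).1 j i) (C.idDeg X (0 + x.a j - x.a i)) := by
  obtain ⟨I, Y, a⟩ := x
  obtain rfl : Y = fun _ => X := hX
  subst h
  rw [sigmaId_self, idDeg, dif_pos]

theorem sigmaId_tower (X : C.Obj) (j i : (tower X).I) (h : j = i) :
    (sigmaId (tower X)).1 j i = C.idDeg X _ := eq_of_heq (sigmaId_entry X j i h rfl)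

theorem sigmaId_single (X : C.Obj) (j i : (single X).I) :
    (sigmaId (single X)).1 j i = C.idDeg X _ :=
  eq_of_heq (sigmaId_entry X j i (Subsingleton.elim (α := ({0} : Set ℤ)) j i) rfl)

/-- `tw_0(X)` is homotopy equivalent to the image of the identity idempotent of `X`. -/
theorem twSingle_homotopyEquivalent (X : C.Obj) :
    (Tw (SigmaPi C)).HomotopyEquivalent (twSingle X) (AInfIdempotent.ofId X).Z := by
  let zero : (tower X).I := ⟨0, le_refl (0 : ℤ)⟩
  have tw : ∀ j i : (tower X).I, (AInfIdempotent.ofId X).twist.1 j i =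
      if j.1 = i.1 + 1 ∧ Odd i.1 then C.idDeg X _ else 0 :=
    fun j i => AInfIdempotent.ofId_entry X j.1 i.1
  refine ⟨towerIn X, towerOut X, ?_, ?_, ⟨(0 : sigmaHom (single X) (single X) (-1)), ?_⟩,
    ⟨towerHomotopy X, ?_⟩⟩
  · change sigmaD _ _ 0 1 rfl (towerIn X) + sigmaComp (y := tower X) (z := tower X) _
      (AInfIdempotent.ofId X).twist (towerIn X) -
        ((0 : ℤ).negOnePow : ℤ) • sigmaComp (x := single X) (y := single X) _ (towerIn X) 0 = 0
    rw [map_zero, smul_zero, sub_zero, sigmaD_idDeg _ _ (fun j i => d_idDeg _ _ _ _), zero_add]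
    refine sigmaComp_eq_zero _ _ _ (fun l j i => ?_)
    by_cases hj : j.1 = 0
    · left
      rw [tw, if_neg]
      rintro ⟨-, h⟩
      rw [hj] at h
      exact absurd h (by decide)
    · right
      exact towerIn_ne hj i
  · change sigmaD _ _ 0 1 rfl (towerOut X) + sigmaComp (y := single X) (z := single X) _ 0
      (towerOut X) - ((0 : ℤ).negOnePow : ℤ) • sigmaComp (x := tower X) (y := tower X) _
        (towerOut X) (AInfIdempotent.ofId X).twist = 0
    rw [sigmaD_idDeg _ _ (fun j i => d_idDeg _ _ _ _), map_zero, LinearMap.zero_apply,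
      sigmaComp_eq_zero (h := by rfl) (g := towerOut X) (f := (AInfIdempotent.ofId X).twist)
      (fun l j i => ?_)]
    · simp
    · by_cases hj : j.1 = 0
      · right
        have hi : (0 : ℤ) ≤ i.1 := i.2
        rw [tw, if_neg]
        rintro ⟨h, -⟩
        omega
      · left
        exact towerOut_ne hj l
  · refine (map_zero ((Tw (SigmaPi C)).d (X := twSingle X) (Y := twSingle X) _ _ _)).trans ?_
    change 0 = sigmaComp _ (towerOut X) (towerIn X) - sigmaId (single X)
    rw [eq_comm, sub_eq_zero]
    ext j i
    change sigmaCompEntry (zero_add 0) (towerOut X) (towerIn X) j i = _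
    have hj : j.1 = 0 := j.2
    rw [sigmaCompEntry_eq_sum _ _ _ j i {zero} (fun l hl => by
      rw [towerIn_ne (fun h => hl (Finset.mem_singleton.2 (Subtype.ext h))), map_zero]),
      Finset.sum_singleton, comp_eq_tcomp, sigmaId_single]
    refine (idDeg_tcomp (X := X) (Y := X) ?_ ?_ _).trans ?_
    · rfl
    · rfl
    · rfl
  · change sigmaD _ _ (-1) 0 rfl (towerHomotopy X) + sigmaComp (y := tower X) (z := tower X) _
      (AInfIdempotent.ofId X).twist (towerHomotopy X) -
        ((-1 : ℤ).negOnePow : ℤ) • sigmaComp (x := tower X) (y := tower X) _ (towerHomotopy X)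
          (AInfIdempotent.ofId X).twist =
      sigmaComp _ (towerIn X) (towerOut X) - sigmaId (tower X)
    rw [sigmaD_idDeg _ _ (fun j i => by
      change C.d _ _ _ (if i.1 = j.1 + 1 ∧ Odd j.1 then -C.idDeg X _ else 0) = 0
      split_ifs
      · rw [map_neg, d_idDeg, neg_zero]
      · exact map_zero _)]
    ext j i
    have hi0 : 0 ≤ i.1 := i.2
    have hj0 : 0 ≤ j.1 := j.2
    have e1 : sigmaCompEntry (show (1 : ℤ) + -1 = 0 from rfl) (AInfIdempotent.ofId X).twist
        (towerHomotopy X) j i = if i = j ∧ Even j.1 ∧ j.1 ≠ 0 then -C.idDeg X _ else 0 := by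
      by_cases hj : j.1 = 0
      · rw [if_neg (fun h => h.2.2 hj), sigmaCompEntry_eq_sum _ _ _ j i ∅ (fun l _ => ?_),
          Finset.sum_empty]
        have hl : 0 ≤ l.1 := l.2
        rw [tw, if_neg (by omega), map_zero, LinearMap.zero_apply]
      · have hp : 0 ≤ j.1 - 1 := by omega
        rw [sigmaCompEntry_eq_sum _ _ _ j i {(⟨j.1 - 1, hp⟩ : (tower X).I)} (fun l hl => ?_),
          Finset.sum_singleton, tw]
        · change C.comp _ _ (if i.1 = j.1 - 1 + 1 ∧ Odd (j.1 - 1) then -C.idDeg X _ else 0) = _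
          by_cases h : i = j ∧ Even j.1 ∧ j.1 ≠ 0
          · obtain ⟨rfl, h2, -⟩ := h
            have ho : Odd (i.1 - 1) := h2.sub_odd odd_one
            rw [if_pos ⟨by simp, ho⟩, if_pos ⟨by simp, ho⟩, if_pos ⟨rfl, h2, hj⟩, map_neg,
              comp_eq_tcomp, idDeg_tcomp (by dsimp only; ring)
                (by dsimp only; ring)]
            congr 1
            unfold idDeg
            rw [dif_pos (by dsimp only; ring), dif_pos (by dsimp only; ring), castDeg_castDeg]
          · rw [if_neg h]
            by_cases ho : Odd (j.1 - 1)
            · have hje : Even j.1 := by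
                have := ho.add_odd odd_one
                simpa using this
              rw [if_neg (c := i.1 = _ ∧ _), map_zero]
              rintro ⟨h3, -⟩
              exact h ⟨Subtype.ext (by omega), hje, hj⟩
            · rw [if_neg (fun h => ho h.2), map_zero, LinearMap.zero_apply]
        · rw [tw, if_neg, map_zero, LinearMap.zero_apply]
          rintro ⟨h1, -⟩
          exact hl (Finset.mem_singleton.2 (Subtype.ext (by change l.1 = j.1 - 1; omega)))
    have e2 : sigmaCompEntry (show (-1 : ℤ) + 1 = 0 from rfl) (towerHomotopy X)
        (AInfIdempotent.ofId X).twist j i = if i = j ∧ Odd j.1 then -C.idDeg X _ else 0 := by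
      have hp : 0 ≤ j.1 + 1 := by omega
      rw [sigmaCompEntry_eq_sum _ _ _ j i {(⟨j.1 + 1, hp⟩ : (tower X).I)} (fun l hl => ?_),
        Finset.sum_singleton, tw]
      · change C.comp _ (if j.1 + 1 = j.1 + 1 ∧ Odd j.1 then -C.idDeg X _ else 0) _ = _
        by_cases h : i = j ∧ Odd j.1
        · obtain ⟨rfl, h2⟩ := h
          rw [if_pos ⟨rfl, h2⟩, if_pos ⟨rfl, h2⟩, if_pos ⟨rfl, h2⟩, map_neg, LinearMap.neg_apply,
            comp_eq_tcomp, idDeg_tcomp (by dsimp only; ring) (by dsimp only; ring)]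
          congr 1
          unfold idDeg
          rw [dif_pos (by dsimp only; ring), dif_pos (by dsimp only; ring), castDeg_castDeg]
        · rw [if_neg h]
          by_cases ho : Odd j.1
          · rw [if_neg (c := j.1 + 1 = i.1 + 1 ∧ _), map_zero]
            rintro ⟨h3, -⟩
            exact h ⟨Subtype.ext (by omega), ho⟩
          · rw [if_neg (fun h => ho h.2), map_zero, LinearMap.zero_apply]
      · change C.comp _ (if l.1 = j.1 + 1 ∧ Odd j.1 then -C.idDeg X _ else 0) _ = _
        rw [if_neg, map_zero, LinearMap.zero_apply]
        rintro ⟨h1, -⟩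
        exact hl (Finset.mem_singleton.2 (Subtype.ext h1))
    have e3 : sigmaCompEntry (zero_add 0) (towerIn X) (towerOut X) j i =
        if i = j ∧ j.1 = 0 then C.idDeg X _ else 0 := by
      rw [sigmaCompEntry_eq_sum _ _ _ j i {(⟨0, rfl⟩ : (single X).I)} (fun l hl =>
        absurd (Finset.mem_singleton.2 (Subtype.ext (show l.1 = 0 from l.2))) hl), Finset.sum_singleton]
      by_cases hj : j.1 = 0
      · by_cases hi : i.1 = 0
        · have hij : i = j := Subtype.ext (hi.trans hj.symm)
          subst hij
          rw [if_pos ⟨rfl, hj⟩]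
          change C.comp _ (C.idDeg X _) (C.idDeg X _) = _
          rw [comp_eq_tcomp, idDeg_tcomp (by dsimp only; omega) (by dsimp only; omega)]
          unfold idDeg
          rw [dif_pos (by dsimp only; omega), dif_pos (by dsimp only; omega), castDeg_castDeg]
        · rw [towerOut_ne hi, map_zero, if_neg]
          rintro ⟨rfl, -⟩
          exact hi hj
      · rw [towerIn_ne hj, map_zero, LinearMap.zero_apply, if_neg (fun h => hj h.2)]
    change 0 + sigmaCompEntry (show (1 : ℤ) + -1 = 0 from rfl) (AInfIdempotent.ofId X).twist
        (towerHomotopy X) j i - ((-1 : ℤ).negOnePow : ℤ) •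
        sigmaCompEntry (show (-1 : ℤ) + 1 = 0 from rfl) (towerHomotopy X)
          (AInfIdempotent.ofId X).twist j i =
      sigmaCompEntry (zero_add 0) (towerIn X) (towerOut X) j i - (sigmaId (tower X)).1 j i
    rw [e1, e2, e3]
    have hs : ((-1 : ℤ).negOnePow : ℤ) = -1 := by rw [Int.negOnePow_odd _ (by decide)]; rfl
    rw [hs]
    by_cases hij : i = j
    · rw [sigmaId_tower X j i hij.symm]
      by_cases hj : j.1 = 0
      · simp [hij, hj]
      · by_cases he : Even j.1
        · simp [hij, hj, he]
        · have ho := Int.not_even_iff_odd.1 he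
          simp [hij, hj, ho]
    · rw [sigmaId_of_ne _ hij]
      simp [hij]

/-- The embedding `C → Kar^dg(C)`, `X ↦ tw_0(X)`. -/
noncomputable def toKar (C : DGCat.{w, u} k) : C ⟶ C.Kar where
  obj X := ⟨twSingle X, AInfIdempotent.ofId X, twSingle_homotopyEquivalent X⟩
  map n := singleMap n
  map_d {X Y n m} h f := by
    change singleMap m (C.d n m h f) = sigmaD _ _ n m h (singleMap n f) +
      sigmaComp (x := single X) (y := single Y) (z := single Y) _ 0 (singleMap n f) -
      (n.negOnePow : ℤ) • sigmaComp (x := single X) (y := single X) (z := single Y) _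
        (singleMap n f) 0
    rw [map_zero, map_zero, LinearMap.zero_apply, smul_zero, sub_zero, add_zero]
    ext j i
    change C.castDeg _ (C.d n m h f) = ((0 : ℤ).negOnePow : ℤ) • C.d _ _ _ (C.castDeg _ f)
    rw [d_castDeg, castDeg_d, Int.negOnePow_zero, Units.val_one, one_smul]
  map_id X := by
    change singleMap 0 (C.id X) = sigmaId (single X)
    ext j i
    rw [sigmaId_single, idDeg, dif_pos (by simp)]
    rfl
  map_comp {X Y Z q p n} h g f := by
    change singleMap n (C.comp h g f) = sigmaComp h (singleMap q g) (singleMap p f)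
    ext j i
    change _ = sigmaCompEntry h (singleMap q g) (singleMap p f) j i
    rw [sigmaCompEntry_eq_sum _ _ _ j i {(⟨0, rfl⟩ : (single Y).I)} (fun l hl =>
      absurd (Finset.mem_singleton.2 (Subtype.ext (show l.1 = 0 from l.2))) hl), Finset.sum_singleton]
    change C.castDeg _ (C.comp h g f) = C.comp _ (C.castDeg _ g) (C.castDeg _ f)
    rw [castDeg_comp, comp_castDeg_left, comp_castDeg_right]

end Kar

/-! ### The universal property -/

/-- `F` is an embedding onto a full dg subcategory: injective on objects and bijective on
morphisms of every degree. -/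
def DGFunctor.IsFullEmbedding {C D : DGCat.{w, u} k} (F : DGFunctor C D) : Prop :=
  Function.Injective F.obj ∧
    ∀ (X Y : C.Obj) (n : ℤ), Function.Bijective (F.map (X := X) (Y := Y) n)

/-- The universal property of `J : C → K` among dg functors to homotopy idempotent complete
dg categories: every dg functor `F : C → D` with `D` homotopy idempotent complete factors, in
`Hqe`, through `J` by a unique quasi-functor `K → D`. -/
def IsUniversalToComplete {C K : DGCat.{w, u} k} (J : C ⟶ K) : Prop :=
  ∀ (D : DGCat.{w, u} k) (F : C ⟶ D), D.HomotopyIdempotentComplete →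
    ∃! G : (toHqe k).obj K ⟶ (toHqe k).obj D, (toHqe k).map J ≫ G = (toHqe k).map F

end DGCat

/-! The key fact is `exists_homotopyEquivalent_Z_iff`: up to homotopy equivalence, the objects of
the envelope are exactly the homotopy retracts, inside `Tw (SigmaPi C)`, of objects of `C`.

In one direction, `Z(X, e, h)` is an image of `e 0` (`AInfIdempotent.isImage_Z`). Let `δ` be its
twist. Along each diagonal `δ` is periodic up to sign and passage to the complement, so for a
suitable matrix `s` with entries `± id` above the diagonal, `id + δ s + s δ` has only its first
column left. This endomorphism is homotopic to the identity and factors through the first copy of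
`X`; the composite in the other order is its corner entry `e 0`.

In the other direction, let `π σ ≃ id` with `d s = id - π σ`. The morphisms `σ sⁿ π`, with signs,
satisfy the relations of an `A_∞`-idempotent by the Leibniz rule, and the zeroth one is `σ π`
(`exists_aInfIdempotent`). The retract and the corresponding `Z` are then images of the same
endomorphism, hence homotopy equivalent.

Completeness starts from a homotopy idempotent `e` that carries no coherence data, only `d h = e -
e²`. The homotopy limit of `⋯ → X → X`, with all maps `e`, splits it. There are maps with `σ π = e`,
and `id - π σ` is homotopic to a matrix of square zero (`telRest_comp_telRest`); together with `e² ≃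
e` this forces `π σ ≃ id` (`homotopic_id_of_nilpotent`). The telescope is therefore a homotopy
retract of `X` and lies in the envelope. Idempotents on arbitrary objects reduce to this case,
because every object is a retract of one from `C`.

The universal property is that of a reflection. The envelope is a functor preserving
quasi-equivalences, so it descends to `Hqe` together with the natural transformation given by the
embeddings `ι`. Here `ι_D` is invertible for complete `D`, and `Kar(ι_C)` is invertible for every
`C`. Existence is `Kar(F)` followed by the inverse of `ι_D`. For uniqueness, maps agreeing after
`ι_C` agree after `Kar`, and naturality of `ι` recovers them.

To return from `Hqe` to dg categories, cohomology categories are taken modulo natural isomorphism.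
They define functors on `Hqe`, which shows that completeness is invariant there and that a dg
functor invertible in `Hqe` is a quasi-equivalence (`quasiEquivalences_of_isIso`). -/

namespace DGCat

variable {k : Type w} [CommRing k]

/-! ### The category of morphisms of arbitrary, possibly mixed, degree -/

section Tot

/-- The objects of a dg category, as objects of the preadditive category whose morphisms are
finite sums of morphisms of arbitrary degrees. -/
structure Tot (C : DGCat.{w, u} k) where
  /-- the underlying object -/
  obj : C.Obj

variable {C : DGCat.{w, u} k}

/-- Composition of morphisms of mixed degree. -/
noncomputable def totComp (X Y Z : C.Obj) :
    (DirectSum ℤ fun n => C.Hom X Y n) →+ (DirectSum ℤ fun n => C.Hom Y Z n) →+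
      (DirectSum ℤ fun n => C.Hom X Z n) :=
  DirectSum.toAddMonoid fun p => AddMonoidHom.flip <| DirectSum.toAddMonoid fun q =>
    AddMonoidHom.mk' (fun g => ((DirectSum.of (fun n => C.Hom X Z n) (q + p)).comp
      (C.comp (X := X) rfl g).toAddMonoidHom)) (fun g g' => by
        ext f : 1
        simp)

theorem totComp_of {X Y Z : C.Obj} {p q : ℤ} (f : C.Hom X Y p) (g : C.Hom Y Z q) :
    totComp X Y Z (DirectSum.of _ p f) (DirectSum.of _ q g) =
      DirectSum.of _ (q + p) (C.comp rfl g f) := by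
  simp [totComp]

theorem of_castDeg {X Y : C.Obj} {m n : ℤ} (h : m = n) (f : C.Hom X Y m) :
    DirectSum.of (fun n => C.Hom X Y n) n (C.castDeg h f) = DirectSum.of _ m f := by
  subst h; rfl

theorem of_comp {X Y Z : C.Obj} {p q n : ℤ} (h : q + p = n) (g : C.Hom Y Z q) (f : C.Hom X Y p) :
    DirectSum.of (fun n => C.Hom X Z n) n (C.comp h g f) =
      totComp X Y Z (DirectSum.of _ p f) (DirectSum.of _ q g) := by
  subst h; rw [totComp_of]

noncomputable instance : Category (Tot C) where
  Hom X Y := DirectSum ℤ fun n => C.Hom X.obj Y.obj n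
  id X := DirectSum.of _ 0 (C.id X.obj)
  comp f g := totComp _ _ _ f g
  id_comp {X Y} f := by
    induction f using DirectSum.induction_on with
    | zero => exact map_zero _
    | of n f => rw [← of_comp (add_zero n), C.comp_id]
    | add f g hf hg => rw [map_add, hf, hg]
  comp_id {X Y} f := by
    induction f using DirectSum.induction_on with
    | zero => simp
    | of n f => rw [← of_comp (zero_add n), C.id_comp]
    | add f g hf hg => rw [map_add, AddMonoidHom.add_apply, hf, hg]
  assoc {W X Y Z} f g h := by
    induction f using DirectSum.induction_on with
    | zero => simp
    | add f f' hf hf' => simp only [map_add, AddMonoidHom.add_apply, hf, hf']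
    | of p f =>
      induction g using DirectSum.induction_on with
      | zero => simp
      | add f f' hf hf' => simp only [map_add, AddMonoidHom.add_apply, hf, hf']
      | of q g =>
        induction h using DirectSum.induction_on with
        | zero => simp
        | add f f' hf hf' => simp only [map_add, hf, hf']
        | of r h =>
          rw [← of_comp rfl, ← of_comp rfl, ← of_comp rfl, ← of_comp (add_assoc r q p),
            C.assoc]

noncomputable instance : Preadditive (Tot C) where
  homGroup X Y := inferInstanceAs (AddCommGroup (DirectSum ℤ fun n => C.Hom X.obj Y.obj n))
  add_comp X Y Z f f' g :=
    DFunLike.congr_fun ((totComp X.obj Y.obj Z.obj).map_add f f') g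
  comp_add X Y Z f g g' := (totComp X.obj Y.obj Z.obj f).map_add g g'

/-- A homogeneous morphism as a morphism of mixed degree. -/
noncomputable def tot {X Y : C.Obj} {n : ℤ} : C.Hom X Y n →+ ((⟨X⟩ : Tot C) ⟶ ⟨Y⟩) :=
  DirectSum.of (fun n => C.Hom X Y n) n

/-- Degrees are not part of the type in `Tot C`: casts disappear and composition needs no degree
witness. The matrix identities below are therefore checked entrywise after applying `tot`. -/
theorem tot_injective {X Y : C.Obj} {n : ℤ} {f g : C.Hom X Y n} (h : tot f = tot g) : f = g :=
  DirectSum.of_injective _ h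

@[simp] theorem tot_castDeg {X Y : C.Obj} {m n : ℤ} (h : m = n) (f : C.Hom X Y m) :
    tot (C.castDeg h f) = tot f := of_castDeg h f

@[simp] theorem tot_comp {X Y Z : C.Obj} {p q n : ℤ} (h : q + p = n) (g : C.Hom Y Z q)
    (f : C.Hom X Y p) : tot (C.comp h g f) = tot f ≫ tot g := of_comp h g f

@[simp] theorem tot_id (X : C.Obj) : tot (C.id X) = 𝟙 (⟨X⟩ : Tot C) := rfl

/-- The differential of morphisms of mixed degree. -/
noncomputable def totD {X Y : Tot C} : (X ⟶ Y) →+ (X ⟶ Y) :=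
  DirectSum.toAddMonoid (fun n => (DirectSum.of (fun n => C.Hom X.obj Y.obj n) (n + 1)).comp
    (C.d n (n + 1) rfl).toAddMonoidHom)

theorem tot_d {X Y : C.Obj} {n m : ℤ} (h : n + 1 = m) (f : C.Hom X Y n) :
    tot (C.d n m h f) = totD (tot f) := by
  subst h
  exact (DirectSum.toAddMonoid_of (fun n => (DirectSum.of (fun n => C.Hom X Y n) (n + 1)).comp
    (C.d n (n + 1) rfl).toAddMonoidHom) n f).symm

@[simp] theorem totD_id (X : Tot C) : totD (𝟙 X) = 0 := by
  change totD (tot (C.id X.obj)) = 0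
  rw [← tot_d rfl, C.d_id, map_zero]

/-- The order of composition is reversed by `≫`, so the sign comes from the degree of the second
factor `g`, the map applied last. -/
theorem totD_comp {X Y Z : C.Obj} {p q : ℤ} (g : C.Hom Y Z q) (f : C.Hom X Y p) :
    totD (tot f ≫ tot g) = tot f ≫ totD (tot g) +
      (q.negOnePow : ℤ) • (totD (tot f) ≫ tot g) := by
  rw [← tot_comp rfl, ← tot_d rfl, C.leibniz rfl rfl rfl rfl (by omega) (by omega)]
  simp only [map_add, map_zsmul, tot_comp, tot_d]

/-- A homogeneous morphism as a morphism of a given degree; zero if the degrees do not match. -/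
def convDeg {X Y : C.Obj} {m : ℤ} (n : ℤ) (f : C.Hom X Y m) : C.Hom X Y n :=
  if h : m = n then C.castDeg h f else 0

theorem tot_convDeg {X Y : C.Obj} {m n : ℤ} (h : m = n) (f : C.Hom X Y m) :
    tot (convDeg n f) = tot f := by
  rw [convDeg, dif_pos h, tot_castDeg]

theorem isClosed_iff_totD {X Y : C.Obj} {n : ℤ} (f : C.Hom X Y n) :
    C.IsClosed f ↔ totD (tot f) = 0 := by
  rw [← tot_d rfl]
  exact ⟨fun h => by rw [show C.d n (n + 1) rfl f = 0 from h, map_zero],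
    fun h => tot_injective (h.trans (map_zero tot).symm)⟩

theorem Homotopic.exists_totD {X Y : C.Obj} {n m : ℤ} {f g : C.Hom X Y n}
    (H : C.Homotopic f g) (hm : m + 1 = n) :
    ∃ h : C.Hom X Y m, totD (tot h) = tot f - tot g := by
  obtain rfl : m = n - 1 := by omega
  obtain ⟨h, hh⟩ := H
  exact ⟨h, by rw [← tot_d (by omega), hh, map_sub]⟩

end Tot

/-! ### Matrix calculus in the category of mixed degrees. -/

section SigmaPiTot

variable {C : DGCat.{w, u} k}

/-- The set `s` only has to contain the indices with a non-zero term, so either a row of `g` or a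
column of `f` may be used to bound the sum. -/
theorem tot_sigmaComp {x y z : SigmaObj C} {q p n : ℤ} (h : q + p = n)
    (g : sigmaHom y z q) (f : sigmaHom x y p) (l : z.I) (i : x.I) (s : Finset y.I)
    (hs : ∀ j, j ∉ s → tot (f.1 j i) ≫ tot (g.1 l j) = 0) :
    tot ((sigmaComp h g f).1 l i) = ∑ j ∈ s, tot (f.1 j i) ≫ tot (g.1 l j) := by
  change tot (sigmaCompEntry h g f l i) = _
  rw [sigmaCompEntry_eq_sum h g f l i s (fun j hj => tot_injective (by
    rw [tot_comp, hs j hj, map_zero])), map_sum]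
  exact Finset.sum_congr rfl (fun j _ => tot_comp _ _ _)

theorem tot_sigmaD {x y : SigmaObj C} {n m : ℤ} (h : n + 1 = m) (f : sigmaHom x y n)
    (j : y.I) (i : x.I) :
    tot ((sigmaD x y n m h f).1 j i) = ((y.a j).negOnePow : ℤ) • totD (tot (f.1 j i)) := by
  change tot (((y.a j).negOnePow : ℤ) • C.d _ _ _ (f.1 j i)) = _
  rw [map_zsmul, tot_d]

theorem tot_sigmaId_self (x : SigmaObj C) (i : x.I) :
    tot ((sigmaId x).1 i i) = 𝟙 (⟨x.X i⟩ : Tot C) := by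
  rw [sigmaId_self, tot_castDeg, tot_id]

theorem tot_sigmaId_of_ne (x : SigmaObj C) {i j : x.I} (h : i ≠ j) :
    tot ((sigmaId x).1 j i) = 0 := by
  rw [sigmaId_of_ne x h, map_zero]

theorem sigmaHom_ext_tot {x y : SigmaObj C} {n : ℤ} {f g : sigmaHom x y n}
    (h : ∀ j i, tot (f.1 j i) = tot (g.1 j i)) : f = g :=
  sigmaHom_ext fun j i => tot_injective (h j i)

end SigmaPiTot

end DGCat
namespace DGCat

variable {k : Type w} [CommRing k]

/-! ### The `A_∞`-idempotent of a homotopy retract -/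

section Retract

variable {C : DGCat.{w, u} k}

/-- The morphism `sⁿ ∘ π`. -/
def iterComp {X T : C.Obj} (s : C.Hom T T (-1)) (π : C.Hom X T 0) : ∀ n : ℕ, C.Hom X T (-n)
  | 0 => C.castDeg (by simp) π
  | n + 1 => C.comp (by push_cast; ring) s (iterComp s π n)

/-- The morphism `σ ∘ sⁿ ∘ π`. -/
def sandwich {X T : C.Obj} (σ : C.Hom T X 0) (s : C.Hom T T (-1)) (π : C.Hom X T 0) (n : ℕ) :
    C.Hom X X (-n) :=
  C.comp (zero_add _) σ (iterComp s π n)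

section

variable {X T : C.Obj} {σ : C.Hom T X 0} {s : C.Hom T T (-1)} {π : C.Hom X T 0}

theorem tot_iterComp_succ (n : ℕ) :
    tot (iterComp s π (n + 1)) = tot (iterComp s π n) ≫ tot s := tot_comp _ _ _

theorem tot_sandwich (n : ℕ) :
    tot (sandwich σ s π n) = tot (iterComp s π n) ≫ tot σ := tot_comp _ _ _

theorem totD_iterComp_zero (hπ : C.IsClosed π) : totD (tot (iterComp s π 0)) = 0 := by
  rw [iterComp, tot_castDeg]
  exact (isClosed_iff_totD π).1 hπ

/-- Leibniz gives `d(sⁿ⁺¹) = ∑ (-1)^i s^i (id - π σ) sⁿ⁻ⁱ`. The identity terms add up to `∑ (-1)^i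
sⁿ`, which is `sⁿ` for even `n` and zero for odd `n`. -/
theorem totD_iterComp_succ (hπ : C.IsClosed π)
    (hs : totD (tot s) = 𝟙 _ - tot σ ≫ tot π) (n : ℕ) :
    totD (tot (iterComp s π (n + 1))) = (if Even n then tot (iterComp s π n) else 0) -
      ∑ i ∈ Finset.range (n + 1),
        ((-1 : ℤ) ^ i) • (tot (sandwich σ s π (n - i)) ≫ tot (iterComp s π i)) := by
  have h1 : (((-1 : ℤ).negOnePow : ℤˣ) : ℤ) = -1 := by
    rw [Int.negOnePow_odd _ (by decide)]; rfl
  induction n with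
  | zero =>
    rw [tot_iterComp_succ, totD_comp, hs, totD_iterComp_zero hπ]
    simp [tot_sandwich, iterComp]
  | succ n ih =>
    rw [tot_iterComp_succ, totD_comp, hs, ih, h1, Finset.sum_range_succ' _ (n + 1)]
    -- Applying one more `s` to the left raises the index of each old term by one and, since `s` is
    -- odd, changes its sign; the new term at index `0` comes from `d s`.
    have h2 : ∀ i ∈ Finset.range (n + 1), ((-1 : ℤ) ^ (i + 1)) •
        (tot (sandwich σ s π (n + 1 - (i + 1))) ≫ tot (iterComp s π (i + 1))) =
        -((((-1 : ℤ) ^ i) • (tot (sandwich σ s π (n - i)) ≫ tot (iterComp s π i))) ≫ tot s) := by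
      intro i _
      rw [tot_iterComp_succ, Nat.add_sub_add_right, Preadditive.zsmul_comp, Category.assoc,
        pow_succ, mul_neg_one, neg_smul]
    rw [Finset.sum_congr rfl h2, Finset.sum_neg_distrib, ← Preadditive.sum_comp]
    have h3 : tot (iterComp s π 0) = tot π := tot_castDeg _ _
    rw [h3, Preadditive.comp_sub, Category.comp_id, Nat.sub_zero, pow_zero, one_smul,
      tot_sandwich (n + 1), Category.assoc]
    by_cases hn : Even n
    · rw [if_pos hn, if_neg (by rw [Nat.not_even_iff_odd]; exact hn.add_one)]
      simp only [Preadditive.sub_comp, tot_iterComp_succ, Category.assoc, neg_smul, one_smul]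
      abel
    · rw [if_neg hn, if_pos (by rw [Nat.not_even_iff_odd] at hn; exact hn.add_one)]
      simp only [Preadditive.sub_comp, tot_iterComp_succ, Category.assoc, neg_smul, one_smul,
        Limits.zero_comp]
      abel

theorem totD_sandwich_zero (hσ : C.IsClosed σ) (hπ : C.IsClosed π) :
    totD (tot (sandwich σ s π 0)) = 0 := by
  rw [tot_sandwich, totD_comp, (isClosed_iff_totD σ).1 hσ, totD_iterComp_zero hπ]
  simp

/-- After `σ` is applied, every inner factor `π σ` cuts the word into two words of the same kind.
This is why the family `σ sⁿ π` satisfies quadratic relations. -/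
theorem totD_sandwich_succ (hσ : C.IsClosed σ) (hπ : C.IsClosed π)
    (hs : totD (tot s) = 𝟙 _ - tot σ ≫ tot π) (n : ℕ) :
    totD (tot (sandwich σ s π (n + 1))) = (if Even n then tot (sandwich σ s π n) else 0) -
      ∑ i ∈ Finset.range (n + 1),
        ((-1 : ℤ) ^ i) • (tot (sandwich σ s π (n - i)) ≫ tot (sandwich σ s π i)) := by
  rw [tot_sandwich, totD_comp, (isClosed_iff_totD σ).1 hσ, totD_iterComp_succ hπ hs]
  simp only [Limits.comp_zero, zero_add, Int.negOnePow_zero, Units.val_one, one_smul,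
    Preadditive.sub_comp, Preadditive.sum_comp, Preadditive.zsmul_comp, Category.assoc,
    tot_sandwich]
  split_ifs <;> simp

/-- The even components of the `A_∞`-idempotent of a homotopy retract. -/
def retractE (σ : C.Hom T X 0) (s : C.Hom T T (-1)) (π : C.Hom X T 0) (j : ℕ) :
    C.Hom X X (-2 * j) :=
  ((-1 : ℤ) ^ j) • C.castDeg (by push_cast; ring) (sandwich σ s π (2 * j))

/-- The odd components of the `A_∞`-idempotent of a homotopy retract. -/
def retractH (σ : C.Hom T X 0) (s : C.Hom T T (-1)) (π : C.Hom X T 0) (j : ℕ) :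
    C.Hom X X (-1 - 2 * j) :=
  ((-1 : ℤ) ^ j) • C.castDeg (by push_cast; ring) (sandwich σ s π (2 * j + 1))

theorem tot_retractE (j : ℕ) :
    tot (retractE σ s π j) = ((-1 : ℤ) ^ j) • tot (sandwich σ s π (2 * j)) := by
  rw [retractE, map_zsmul, tot_castDeg]

theorem tot_retractH (j : ℕ) :
    tot (retractH σ s π j) = ((-1 : ℤ) ^ j) • tot (sandwich σ s π (2 * j + 1)) := by
  rw [retractH, map_zsmul, tot_castDeg]

/-- The index of the sandwich is even here, so its differential has no linear term. The even
summation indices give the products `e h`, the odd ones `h e`. -/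
theorem totD_retractE (hσ : C.IsClosed σ) (hπ : C.IsClosed π)
    (hs : totD (tot s) = 𝟙 _ - tot σ ≫ tot π) (j : ℕ) :
    totD (tot (retractE σ s π j)) = ∑ a ∈ Finset.range j,
      (tot (retractH σ s π (j - 1 - a)) ≫ tot (retractE σ s π a) -
        tot (retractE σ s π (j - 1 - a)) ≫ tot (retractH σ s π a)) := by
  rw [tot_retractE, map_zsmul]
  rcases j with _ | j
  · rw [Nat.mul_zero, totD_sandwich_zero hσ hπ]
    simp
  · rw [Nat.mul_succ, totD_sandwich_succ hσ hπ hs (2 * j + 1),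
      if_neg (by rw [Nat.not_even_iff_odd]; exact odd_two_mul_add_one j), zero_sub,
      show 2 * j + 1 + 1 = 2 * (j + 1) by ring, AInfIdempotent.sum_range_even,
      ← Finset.sum_neg_distrib, Finset.smul_sum]
    refine Finset.sum_congr rfl (fun b hb => ?_)
    have hb' := Finset.mem_range.1 hb
    obtain ⟨c, rfl⟩ : ∃ c, j = b + c := ⟨j - b, by omega⟩
    rw [show 2 * (b + c) + 1 - 2 * b = 2 * c + 1 by omega,
      show 2 * (b + c) + 1 - (2 * b + 1) = 2 * c by omega, show b + c + 1 - 1 - b = c by omega]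
    simp only [tot_retractE, tot_retractH, Preadditive.zsmul_comp, Preadditive.comp_zsmul,
      smul_smul, pow_add, pow_mul, pow_one, neg_one_sq, one_pow]
    module

/-- This relation dictates the sign `(-1)^j`: the products of two odd sandwiches occur with a plus
sign, and `(-1)^j = -(-1)^b (-1)^(j-1-b)` turns it into the required minus. -/
theorem totD_retractH (hσ : C.IsClosed σ) (hπ : C.IsClosed π)
    (hs : totD (tot s) = 𝟙 _ - tot σ ≫ tot π) (j : ℕ) :
    totD (tot (retractH σ s π j)) = tot (retractE σ s π j) -
      ∑ a ∈ Finset.range (j + 1), tot (retractE σ s π (j - a)) ≫ tot (retractE σ s π a) -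
      ∑ a ∈ Finset.range j, tot (retractH σ s π (j - 1 - a)) ≫ tot (retractH σ s π a) := by
  rw [tot_retractH, map_zsmul, totD_sandwich_succ hσ hπ hs (2 * j), if_pos (even_two_mul j),
    AInfIdempotent.sum_range_odd, tot_retractE, smul_sub, smul_add, Finset.smul_sum,
    Finset.smul_sum, ← sub_sub]
  congr 1
  · congr 1
    refine Finset.sum_congr rfl (fun b hb => ?_)
    have hb' := Finset.mem_range.1 hb
    obtain ⟨c, rfl⟩ : ∃ c, j = b + c := ⟨j - b, by omega⟩
    rw [show 2 * (b + c) - 2 * b = 2 * c by omega, show b + c - b = c by omega]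
    simp only [tot_retractE, Preadditive.zsmul_comp, Preadditive.comp_zsmul,
      smul_smul, pow_add, pow_mul, neg_one_sq, one_pow]
    module
  · refine Finset.sum_congr rfl (fun b hb => ?_)
    have hb' := Finset.mem_range.1 hb
    obtain ⟨c, rfl⟩ : ∃ c, j = b + c + 1 := ⟨j - b - 1, by omega⟩
    rw [show 2 * (b + c + 1) - (2 * b + 1) = 2 * c + 1 by omega,
      show b + c + 1 - 1 - b = c by omega]
    simp only [tot_retractH, Preadditive.zsmul_comp, Preadditive.comp_zsmul,
      smul_smul, pow_add, pow_mul, pow_one, neg_one_sq, one_pow]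
    module

end

/-- A homotopy retract of `F(X)`, with `F` fully faithful at `X`, gives an `A_∞`-idempotent
on `X`. -/
theorem exists_aInfIdempotent {B : DGCat.{w, u} k} (F : DGFunctor C B) (X : C.Obj)
    (hF : ∀ n, Function.Bijective (F.map (X := X) (Y := X) n)) {T : B.Obj}
    (σ : B.Hom T (F.obj X) 0) (π : B.Hom (F.obj X) T 0) (hσ : B.IsClosed σ) (hπ : B.IsClosed π)
    (hπσ : B.Homotopic (B.comp₀ π σ) (B.id T)) :
    ∃ A : AInfIdempotent C, ∃ hX : A.X = X,
      F.map 0 (hX ▸ C.castDeg (by simp) (A.e 0)) = B.comp₀ σ π := by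
  obtain ⟨s', hs'⟩ := hπσ.exists_totD (m := -1) rfl
  -- The homotopy at hand has differential `π σ - id`, hence the change of sign.
  have hs : totD (tot (-s')) = 𝟙 _ - tot σ ≫ tot π := by
    rw [map_neg, map_neg, hs', comp₀, tot_comp, tot_id, neg_sub]
  -- The components are built in `B` and pulled back along the bijections on endomorphisms of `X`;
  -- injectivity then pulls back the relations.
  choose e he using fun j : ℕ => (hF (-2 * j)).2 (retractE σ (-s') π j)
  choose h hh using fun j : ℕ => (hF (-1 - 2 * j)).2 (retractH σ (-s') π j)
  refine ⟨⟨X, e, h, fun j => ?_, fun j => ?_⟩, rfl, ?_⟩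
  · refine (hF _).1 (tot_injective ?_)
    rw [F.map_d, tot_d, he, totD_retractE hσ hπ hs, Finset.sum_range, map_sum, map_sum]
    refine Finset.sum_congr rfl (fun a _ => ?_)
    simp only [map_sub, F.map_comp, tot_comp, he, hh]
  · refine (hF _).1 (tot_injective ?_)
    rw [F.map_d, tot_d, hh, totD_retractH hσ hπ hs, Finset.sum_range, Finset.sum_range]
    simp only [map_sub, map_sum, F.map_comp, tot_comp, he, hh]
  · have key : ∀ (n : ℤ) (hn : n = 0) (f : C.Hom X X n),
        tot (F.map 0 (C.castDeg hn f)) = tot (F.map n f) := by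
      rintro n rfl f; rfl
    refine tot_injective ?_
    refine (key _ (by simp) (e 0)).trans ?_
    rw [he, tot_retractE, comp₀, tot_comp, tot_sandwich, iterComp, tot_castDeg]
    simp

end Retract

end DGCat
namespace DGCat

variable {k : Type w} [CommRing k]

/-! ### The image of an `A_∞`-idempotent -/

/-! ### Twisted differentials of matrices. -/

section TwSigma

variable {C : DGCat.{w, u} k}

/-- The differential of morphisms between twisted matrices. -/
noncomputable def matD {x y : SigmaObj C} (α : sigmaHom x x 1) (β : sigmaHom y y 1) (n m : ℤ)
    (h : n + 1 = m) (f : sigmaHom x y n) : sigmaHom x y m :=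
  sigmaD x y n m h f + sigmaComp (by omega) β f - (n.negOnePow : ℤ) • sigmaComp h f α

theorem tot_matD {x y : SigmaObj C} (α : sigmaHom x x 1) (β : sigmaHom y y 1) {n m : ℤ}
    (h : n + 1 = m) (f : sigmaHom x y n) (j : y.I) (i : x.I) :
    tot ((matD α β n m h f).1 j i) = ((y.a j).negOnePow : ℤ) • totD (tot (f.1 j i)) +
      tot ((sigmaComp (show 1 + n = m by omega) β f).1 j i) -
      (n.negOnePow : ℤ) • tot ((sigmaComp h f α).1 j i) := by
  rw [← tot_sigmaD h f j i, ← map_zsmul, ← map_add, ← map_sub]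
  rfl

/-- The right unit law for matrices, as an equation. -/
theorem sigmaComp_id {x y : SigmaObj C} {p : ℤ} (h : p + 0 = p) (f : sigmaHom x y p) :
    sigmaComp h f (sigmaId x) = f := (SigmaPi C).comp_id h f

theorem sigmaComp_assoc {v x y z : SigmaObj C} {r q p rq qp n : ℤ} (h₁ : r + q = rq)
    (h₂ : q + p = qp) (h₃ : rq + p = n) (h₄ : r + qp = n) (h : sigmaHom y z r)
    (g : sigmaHom x y q) (f : sigmaHom v x p) :
    sigmaComp h₃ (sigmaComp h₁ h g) f = sigmaComp h₄ h (sigmaComp h₂ g f) :=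
  (SigmaPi C).assoc h₁ h₂ h₃ h₄ h g f

theorem tot_singleMap {X Y : C.Obj} {n : ℤ} (f : C.Hom X Y n) (j : (single Y).I)
    (i : (single X).I) : tot ((singleMap n f).1 j i) = tot f :=
  tot_castDeg (X := X) (Y := Y) (by simp) f

/-- An identity of untwisted matrices. For the twist of a general idempotent `towerIn` is not
closed, so it serves below only as a section of `towerOut`. -/
theorem towerOut_towerIn (X : C.Obj) :
    sigmaComp (add_zero 0) (towerOut X) (towerIn X) = sigmaId (single X) := by
  refine sigmaHom_ext_tot (fun j i => ?_)
  have hj : j.1 = 0 := j.2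
  have hi : i.1 = 0 := i.2
  obtain rfl : i = j := Subtype.ext (hi.trans hj.symm)
  rw [tot_sigmaComp _ _ _ _ _ {(⟨0, le_refl (0 : ℤ)⟩ : (tower X).I)} (fun l hl => by
    rw [towerIn_ne (fun h => hl (Finset.mem_singleton.2 (Subtype.ext h))), map_zero,
      Limits.zero_comp]), Finset.sum_singleton, tot_sigmaId_self]
  change tot (C.idDeg X _) ≫ tot (C.idDeg X _) = _
  rw [idDeg, idDeg, dif_pos (by simp), dif_pos (by simp), tot_castDeg, tot_id]
  exact Category.id_comp _

end TwSigma

/-! ### `Z(X, e, h)` as an image of `e 0`. -/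

section Image

variable {C : DGCat.{w, u} k}

namespace AInfIdempotent

variable (A : AInfIdempotent C)

theorem tot_entry_odd_even {j i : ℤ} (m : ℕ) (h : j = i + 1 + 2 * m) (hi : Even i) :
    tot (A.entry j i) = tot (A.e m) - tot (C.idDeg A.X (-2 * m)) := by
  rw [A.entry_odd_even m h hi, tot_castDeg, map_sub]

theorem tot_entry_odd_odd {j i : ℤ} (m : ℕ) (h : j = i + 1 + 2 * m) (hi : ¬ Even i) :
    tot (A.entry j i) = tot (A.e m) := by
  rw [A.entry_odd_odd m h hi, tot_castDeg]

theorem tot_entry_even_even {j i : ℤ} (m : ℕ) (h : j = i + 2 * m + 2) (hi : Even i) :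
    tot (A.entry j i) = tot (A.h m) := by
  rw [A.entry_even_even m h hi, tot_castDeg]

theorem tot_entry_even_odd {j i : ℤ} (m : ℕ) (h : j = i + 2 * m + 2) (hi : ¬ Even i) :
    tot (A.entry j i) = -tot (A.h m) := by
  rw [A.entry_even_odd m h hi, map_neg, tot_castDeg]

open Classical in
/-- The matrix with entries `± id` on the superdiagonal. -/
noncomputable def shiftHomotopy (X : C.Obj) : sigmaHom (tower X) (tower X) (-1) :=
  ⟨fun j i => if i.1 = j.1 + 1 then (j.1.negOnePow : ℤ) • C.idDeg X _ else 0, fun j => by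
    refine Set.Finite.of_finite_image (f := Subtype.val)
      ((Set.finite_singleton (j.1 + 1)).subset ?_) Subtype.val_injective.injOn
    rintro _ ⟨i, hi, rfl⟩
    change i.1 = j.1 + 1
    by_contra h
    exact hi (if_neg h)⟩

theorem tot_idDeg (X : C.Obj) {n : ℤ} (h : n = 0) : tot (C.idDeg X n) = 𝟙 (⟨X⟩ : Tot C) := by
  subst h; rfl

theorem tot_shiftHomotopy (X : C.Obj) (j i : (tower X).I) (h : i.1 = j.1 + 1) :
    tot ((shiftHomotopy X).1 j i) = (j.1.negOnePow : ℤ) • 𝟙 (⟨X⟩ : Tot C) := by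
  change tot (if i.1 = j.1 + 1 then (j.1.negOnePow : ℤ) • C.idDeg X _ else 0) = _
  rw [if_pos h, map_zsmul, tot_idDeg]
  dsimp only
  omega

theorem shiftHomotopy_of_ne (X : C.Obj) (j i : (tower X).I) (h : i.1 ≠ j.1 + 1) :
    (shiftHomotopy X).1 j i = 0 := if_neg h

theorem totD_shiftHomotopy (X : C.Obj) (j i : (tower X).I) :
    totD (tot ((shiftHomotopy X).1 j i)) = 0 := by
  by_cases h : i.1 = j.1 + 1
  · rw [tot_shiftHomotopy X j i h, map_zsmul, totD_id, smul_zero]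
  · rw [shiftHomotopy_of_ne X j i h, map_zero, map_zero]

/-- The endomorphism `σ ∘ π` of `Z(X, e, h)`. -/
noncomputable def imageProj : sigmaHom (tower A.X) (tower A.X) 0 :=
  sigmaId (tower A.X) + matD A.twist A.twist (-1) 0 rfl (shiftHomotopy A.X)

/-- The homotopy is constant of odd degree, so its differential is `δ s + s δ`, and multiplying by
`s` shifts a column or row index of `δ` by one. In column `0` the first term is missing, since there
is no column `-1`; this asymmetry is what makes that column survive. -/
theorem tot_imageProj (j i : (tower A.X).I) :
    tot (A.imageProj.1 j i) = tot ((sigmaId (tower A.X)).1 j i) +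
      (if 0 < i.1 then ((i.1 - 1).negOnePow : ℤ) • tot (A.entry j.1 (i.1 - 1)) else 0) +
      (j.1.negOnePow : ℤ) • tot (A.entry (j.1 + 1) i.1) := by
  have hj0 : 0 ≤ j.1 := j.2
  have hs : ((-1 : ℤ).negOnePow : ℤ) = -1 := by rw [Int.negOnePow_odd _ (by decide)]; rfl
  have h1 : tot ((sigmaComp (show (1 : ℤ) + -1 = 0 from rfl) A.twist (shiftHomotopy A.X)).1 j i) =
      if 0 < i.1 then ((i.1 - 1).negOnePow : ℤ) • tot (A.entry j.1 (i.1 - 1)) else 0 := by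
    split_ifs with hi
    · rw [tot_sigmaComp _ _ _ j i {(⟨i.1 - 1, by change 0 ≤ i.1 - 1; omega⟩ : (tower A.X).I)}
        (fun l hl => by
          rw [shiftHomotopy_of_ne _ _ _ (fun h => hl (Finset.mem_singleton.2
            (Subtype.ext (by change l.1 = i.1 - 1; omega)))), map_zero, Limits.zero_comp]),
        Finset.sum_singleton, tot_shiftHomotopy _ _ _ (by simp), Preadditive.zsmul_comp,
        Category.id_comp]
      rfl
    · rw [tot_sigmaComp _ _ _ j i ∅ (fun l _ => ?_), Finset.sum_empty]
      have hl : 0 ≤ l.1 := l.2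
      rw [shiftHomotopy_of_ne _ _ _ (by omega), map_zero, Limits.zero_comp]
  have h2 : tot ((sigmaComp (show (-1 : ℤ) + 1 = 0 from rfl) (shiftHomotopy A.X) A.twist).1 j i) =
      (j.1.negOnePow : ℤ) • tot (A.entry (j.1 + 1) i.1) := by
    rw [tot_sigmaComp _ _ _ j i {(⟨j.1 + 1, by change 0 ≤ j.1 + 1; omega⟩ : (tower A.X).I)}
      (fun l hl => by
        rw [shiftHomotopy_of_ne _ _ _ (fun h => hl (Finset.mem_singleton.2
            (Subtype.ext h))), map_zero, Limits.comp_zero]),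
      Finset.sum_singleton, tot_shiftHomotopy _ _ _ rfl, Preadditive.comp_zsmul,
      Category.comp_id]
    rfl
  change tot ((sigmaId (tower A.X)).1 j i + (matD A.twist A.twist (-1) 0 rfl (shiftHomotopy A.X)).1 j i) = _
  rw [map_add, tot_matD, totD_shiftHomotopy A.X j i, hs, smul_zero, h1, h2]
  simp only [neg_smul, one_smul]
  abel

/-- The entries `(j, i - 1)` and `(j + 1, i)` of the twist lie on the same diagonal in columns of
opposite parity, where `e` alternates with its complement up to sign and `h` with `-h`. With the
signs of the homotopy, the two contributions add up to `-id` on the main diagonal and cancel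
elsewhere. -/
theorem imageProj_of_ne (j i : (tower A.X).I) (hi : i.1 ≠ 0) : A.imageProj.1 j i = 0 := by
  have hi0 : 0 ≤ i.1 := i.2
  have hid : ∀ m : ℕ, tot (C.idDeg A.X (-2 * (m : ℤ))) = if m = 0 then 𝟙 (⟨A.X⟩ : Tot C) else 0 :=
    fun m => by
      split_ifs with h
      · rw [tot_idDeg _ (by omega)]
      · rw [idDeg_of_ne _ (by omega), map_zero]
  refine tot_injective ?_
  rw [tot_imageProj, if_pos (by omega), map_zero]
  rcases lt_or_ge j.1 i.1 with hji | hji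
  · rw [tot_sigmaId_of_ne _ (by rintro rfl; omega), A.entry_of_le (by omega),
      A.entry_of_le (by omega)]
    simp
  · have h1 : tot ((sigmaId (tower A.X)).1 j i) = if j.1 = i.1 then 𝟙 (⟨A.X⟩ : Tot C) else 0 := by
      split_ifs with h
      · obtain rfl : j = i := Subtype.ext h
        exact tot_sigmaId_self _ _
      · exact tot_sigmaId_of_ne _ (fun h' => h (by rw [h']))
    rw [h1]
    -- Even distance from the diagonal involves the `e m`, odd distance the `h m`.
    obtain ⟨m, hm | hm⟩ : ∃ m : ℕ, j.1 = i.1 + 2 * m ∨ j.1 = i.1 + 2 * m + 1 :=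
      ⟨((j.1 - i.1) / 2).toNat, by omega⟩
    · have hm0 : j.1 = i.1 ↔ m = 0 := by omega
      by_cases he : Even i.1
      · have he' : ¬ Even (i.1 - 1) := by
          rw [Int.not_even_iff_odd]; exact he.sub_odd odd_one
        have hje : Even j.1 := by rw [hm]; exact he.add (even_two_mul _)
        rw [A.tot_entry_odd_odd m (by omega) he', A.tot_entry_odd_even m (by omega) he, hid,
          Int.negOnePow_even _ hje, Int.negOnePow_odd _ (Int.not_even_iff_odd.1 he')]
        simp only [hm0]
        split_ifs
        · simp only [Units.val_neg, Units.val_one, neg_smul, one_smul]; abel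
        · simp
      · have he' : Even (i.1 - 1) := (Int.not_even_iff_odd.1 he).sub_odd odd_one
        have hjo : Odd j.1 := by
          rw [hm]; exact (Int.not_even_iff_odd.1 he).add_even (even_two_mul _)
        rw [A.tot_entry_odd_even m (by omega) he', A.tot_entry_odd_odd m (by omega) he, hid,
          Int.negOnePow_odd _ hjo, Int.negOnePow_even _ he']
        simp only [hm0]
        split_ifs <;> simp
    · rw [if_neg (by omega)]
      by_cases he : Even i.1
      · have he' : ¬ Even (i.1 - 1) := by
          rw [Int.not_even_iff_odd]; exact he.sub_odd odd_one
        have hjo : Odd j.1 := by rw [hm]; exact (he.add (even_two_mul _)).add_one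
        rw [A.tot_entry_even_odd m (by omega) he', A.tot_entry_even_even m (by omega) he,
          Int.negOnePow_odd _ hjo, Int.negOnePow_odd _ (Int.not_even_iff_odd.1 he')]
        simp
      · have he' : Even (i.1 - 1) := (Int.not_even_iff_odd.1 he).sub_odd odd_one
        have hje : Even j.1 := by
          rw [hm]; exact ((Int.not_even_iff_odd.1 he).add_even (even_two_mul _)).add_one
        rw [A.tot_entry_even_even m (by omega) he', A.tot_entry_even_odd m (by omega) he,
          Int.negOnePow_even _ hje, Int.negOnePow_even _ he']
        simp

/-- The closed morphism `X → Z(X, e, h)`. -/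
noncomputable def imageIn : sigmaHom (single A.X) (tower A.X) 0 :=
  sigmaComp (add_zero 0) A.imageProj (towerIn A.X)

/-- A matrix concentrated in column `0` factors through the projection to the first factor. -/
theorem imageIn_towerOut :
    sigmaComp (add_zero 0) A.imageIn (towerOut A.X) = A.imageProj := by
  rw [imageIn, sigmaComp_assoc _ (add_zero 0) _ (add_zero 0)]
  refine sigmaHom_ext_tot (fun j i => ?_)
  have h0 : ∀ l i : (tower A.X).I,
      tot ((sigmaComp (add_zero 0) (towerIn A.X) (towerOut A.X)).1 l i) =
        tot ((towerOut A.X).1 ⟨0, rfl⟩ i) ≫ tot ((towerIn A.X).1 l ⟨0, rfl⟩) := fun l i => by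
    rw [tot_sigmaComp _ _ _ l i {(⟨0, rfl⟩ : (single A.X).I)} (fun l hl =>
      absurd (Finset.mem_singleton.2 (Subtype.ext (show l.1 = 0 from l.2))) hl),
      Finset.sum_singleton]
  rw [tot_sigmaComp _ _ _ j i {(⟨0, le_refl (0 : ℤ)⟩ : (tower A.X).I)} (fun l hl => by
    rw [h0, towerIn_ne (fun h => hl (Finset.mem_singleton.2 (Subtype.ext h))), map_zero,
      Limits.comp_zero, Limits.zero_comp]), Finset.sum_singleton, h0]
  by_cases hi : i.1 = 0
  · obtain rfl : i = ⟨0, le_refl (0 : ℤ)⟩ := Subtype.ext hi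
    change (tot (C.idDeg A.X _) ≫ tot (C.idDeg A.X _)) ≫ _ = _
    rw [tot_idDeg _ (by simp), tot_idDeg _ (by simp), Category.id_comp, Category.id_comp]
  · rw [towerOut_ne hi, map_zero, Limits.zero_comp, Limits.zero_comp, A.imageProj_of_ne j i hi,
      map_zero]

/-- The twist is strictly lower triangular, so its row `0` vanishes. -/
theorem isClosed_towerOut :
    (Tw (SigmaPi C)).IsClosed (X := A.Z) (Y := twSingle A.X) (towerOut A.X) := by
  suffices h : matD A.twist (0 : sigmaHom (single A.X) (single A.X) 1) 0 (0 + 1) rfl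
    (towerOut A.X) = 0 from h
  refine sigmaHom_ext_tot (fun j i => ?_)
  rw [tot_matD]
  have h1 : totD (tot ((towerOut A.X).1 j i)) = 0 := by
    change totD (tot (C.idDeg A.X _)) = 0
    rw [← tot_d rfl, d_idDeg, map_zero]
  rw [h1, smul_zero, zero_add]
  have h2 : sigmaComp (show (0 : ℤ) + 1 = 0 + 1 from rfl) (towerOut A.X) A.twist = 0 := by
    refine sigmaComp_eq_zero _ _ _ (fun l m i => ?_)
    by_cases hm : m.1 = 0
    · right
      have hi : (0 : ℤ) ≤ i.1 := i.2
      exact A.entry_of_le (by omega)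
    · left
      exact towerOut_ne hm l
  rw [h2, map_zero, LinearMap.zero_apply]
  change tot (0 : C.Hom _ _ _) - _ • tot (0 : C.Hom _ _ _) = tot 0
  rw [map_zero, smul_zero, sub_zero]

/-- `imageProj` is closed, being the identity plus a boundary, and it equals `imageIn ∘ towerOut`
with `towerOut` closed. Hence `d(imageIn) ∘ towerOut = 0`, and precomposing with the section
`towerIn` removes `towerOut`. -/
theorem isClosed_imageIn :
    (Tw (SigmaPi C)).IsClosed (X := twSingle A.X) (Y := A.Z) A.imageIn := by
  have h1 : (Tw (SigmaPi C)).d (X := A.Z) (Y := A.Z) 0 (0 + 1) rfl A.imageProj = 0 := by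
    change (Tw (SigmaPi C)).d (X := A.Z) (Y := A.Z) 0 (0 + 1) rfl (sigmaId (tower A.X) +
      matD A.twist A.twist (-1) 0 rfl (shiftHomotopy A.X)) = 0
    refine ((Tw (SigmaPi C)).d (X := A.Z) (Y := A.Z) 0 (0 + 1) rfl).map_add
      (sigmaId (tower A.X)) (matD A.twist A.twist (-1) 0 rfl (shiftHomotopy A.X)) |>.trans ?_
    have := (Tw (SigmaPi C)).d_id (X := A.Z) (m := 0 + 1) rfl
    have h' := (Tw (SigmaPi C)).d_d (X := A.Z) (Y := A.Z) (n := -1) (m := 0) (l := 0 + 1) rfl rfl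
      (shiftHomotopy A.X)
    exact (congrArg₂ (· + ·) this h').trans (add_zero _)
  have h2 := (Tw (SigmaPi C)).leibniz (X := A.Z) (Y := twSingle A.X) (Z := A.Z) (q := 0) (p := 0)
    (n := 0) (q' := 0 + 1) (p' := 0 + 1) (n' := 0 + 1) (add_zero 0) rfl rfl rfl rfl rfl
    A.imageIn (towerOut A.X)
  have h3 : (Tw (SigmaPi C)).d (X := A.Z) (Y := twSingle A.X) 0 (0 + 1) rfl (towerOut A.X) = 0 :=
    A.isClosed_towerOut
  have h4 : (Tw (SigmaPi C)).comp (X := A.Z) (Y := twSingle A.X) (Z := A.Z) (add_zero 0)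
    A.imageIn (towerOut A.X) = A.imageProj := A.imageIn_towerOut
  rw [h3, map_zero, smul_zero, add_zero, h4, h1] at h2
  have h5 := congrArg (fun f => sigmaComp (x := single A.X) (y := tower A.X) (z := tower A.X)
    (show (0 + 1 : ℤ) + 0 = 0 + 1 from rfl) f (towerIn A.X)) h2
  have h6 := sigmaComp_assoc (show (0 + 1 : ℤ) + 0 = 0 + 1 from rfl) (add_zero 0)
    (show (0 + 1 : ℤ) + 0 = 0 + 1 from rfl) (show (0 + 1 : ℤ) + 0 = 0 + 1 from rfl)
    ((Tw (SigmaPi C)).d (X := twSingle A.X) (Y := A.Z) 0 (0 + 1) rfl A.imageIn)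
    (towerOut A.X) (towerIn A.X)
  have h7 : sigmaComp (x := single A.X) (y := tower A.X) (z := tower A.X)
    (show (0 + 1 : ℤ) + 0 = 0 + 1 from rfl) 0 (towerIn A.X) = 0 := by
    rw [map_zero, LinearMap.zero_apply]
  rw [towerOut_towerIn, sigmaComp_id] at h6
  exact (h7.symm.trans (h5.trans h6)).symm

/-- Only the corner entry of `imageProj` contributes, and this is `id + δ₁₀ = id - (id - e 0)`. -/
theorem towerOut_imageIn :
    sigmaComp (add_zero 0) (towerOut A.X) A.imageIn =
      singleMap 0 (C.castDeg (by simp) (A.e 0)) := by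
  refine sigmaHom_ext_tot (fun j i => ?_)
  let z : (tower A.X).I := ⟨0, le_refl (0 : ℤ)⟩
  have hz : (𝟙 (⟨A.X⟩ : Tot C)) = tot (C.idDeg A.X (-2 * (0 : ℕ))) :=
    (tot_idDeg _ (by simp)).symm
  rw [tot_sigmaComp _ _ _ j i {z} (fun l hl => by
    rw [towerOut_ne (fun h => hl (Finset.mem_singleton.2 (Subtype.ext h))), map_zero,
      Limits.comp_zero]), Finset.sum_singleton, imageIn,
    tot_sigmaComp _ _ _ z i {z} (fun l hl => by
    rw [towerIn_ne (fun h => hl (Finset.mem_singleton.2 (Subtype.ext h))), map_zero,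
      Limits.zero_comp]), Finset.sum_singleton, tot_imageProj, if_neg (lt_irrefl _),
    tot_sigmaId_self, A.tot_entry_odd_even 0 (by simp [z]) (by simp [z])]
  have hi : i.1 = 0 := i.2
  have hj : j.1 = 0 := j.2
  have h1 : tot ((towerIn A.X).1 z i) = 𝟙 (⟨A.X⟩ : Tot C) := tot_idDeg _ (by simp [z])
  have h2 : tot ((towerOut A.X).1 j z) = 𝟙 (⟨A.X⟩ : Tot C) := tot_idDeg _ (by simp [z])
  have h3 : tot ((singleMap 0 (C.castDeg (by simp) (A.e 0)) :
      sigmaHom (single A.X) (single A.X) 0).1 j i) = tot (A.e 0) := by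
    rw [tot_singleMap, tot_castDeg]
  rw [h1, h2, h3, Category.id_comp, Category.comp_id, ← hz]
  simp [z]

/-- `Z(X, e, h)` is an image of `e 0`. -/
theorem isImage_Z : (Tw (SigmaPi C)).IsImage (X := twSingle A.X)
    (singleMap 0 (C.castDeg (by simp) (A.e 0)) : sigmaHom (single A.X) (single A.X) 0) A.Z := by
  refine ⟨towerOut A.X, A.imageIn, A.isClosed_towerOut, A.isClosed_imageIn,
    ⟨shiftHomotopy A.X, ?_⟩, ⟨(0 : sigmaHom (single A.X) (single A.X) (0 - 1)), ?_⟩⟩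
  · have := A.imageIn_towerOut
    refine Eq.symm ?_
    change sigmaComp (add_zero 0) A.imageIn (towerOut A.X) - sigmaId (tower A.X) = _
    rw [this]
    exact add_sub_cancel_left (sigmaId (tower A.X)) _
  · refine (map_zero ((Tw (SigmaPi C)).d (X := twSingle A.X) (Y := twSingle A.X) _ _ _)).trans ?_
    exact (sub_eq_zero.2 A.towerOut_imageIn).symm

end AInfIdempotent

end Image

end DGCat
namespace DGCat

variable {k : Type w} [CommRing k]

/-! ### The telescope of a homotopy idempotent -/

/-! ### Degree zero morphisms modulo exact ones. -/

section Exact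

variable {C : DGCat.{w, u} k}

/-- The exact morphisms of degree zero. -/
def exact₀ (C : DGCat.{w, u} k) (X Y : C.Obj) : Submodule k (C.Hom X Y 0) :=
  LinearMap.range (C.d (X := X) (Y := Y) (0 - 1) 0 (by omega))

theorem homotopic_iff_sub_mem {X Y : C.Obj} {f g : C.Hom X Y 0} :
    C.Homotopic f g ↔ f - g ∈ C.exact₀ X Y := Iff.rfl

theorem comp₀_mem_exact₀_left {X Y Z : C.Obj} {g : C.Hom Y Z 0} (hg : C.IsClosed g)
    {f : C.Hom X Y 0} (hf : f ∈ C.exact₀ X Y) : C.comp₀ g f ∈ C.exact₀ X Z := by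
  obtain ⟨h, rfl⟩ := hf
  refine ⟨C.comp (by omega) g h, ?_⟩
  rw [C.leibniz (q' := 0 + 1) (p' := 0) _ rfl (by omega) (by omega) (by omega) (by omega),
    show C.d 0 (0 + 1) rfl g = 0 from hg, map_zero, LinearMap.zero_apply, zero_add,
    Int.negOnePow_zero, Units.val_one, one_smul]
  rfl

theorem comp₀_mem_exact₀_right {X Y Z : C.Obj} {g : C.Hom Y Z 0} (hg : g ∈ C.exact₀ Y Z)
    {f : C.Hom X Y 0} (hf : C.IsClosed f) : C.comp₀ g f ∈ C.exact₀ X Z := by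
  obtain ⟨h, rfl⟩ := hg
  refine ⟨C.comp (by omega) h f, ?_⟩
  rw [C.leibniz (q' := 0) (p' := 0 + 1) _ (by omega) rfl (by omega) (by omega) (by omega),
    show C.d 0 (0 + 1) rfl f = 0 from hf, map_zero, smul_zero, add_zero]
  rfl

theorem comp₀_assoc {W X Y Z : C.Obj} (h : C.Hom Y Z 0) (g : C.Hom X Y 0) (f : C.Hom W X 0) :
    C.comp₀ (C.comp₀ h g) f = C.comp₀ h (C.comp₀ g f) := C.assoc _ _ _ _ h g f

theorem comp₀_sub {X Y Z : C.Obj} (g : C.Hom Y Z 0) (f f' : C.Hom X Y 0) :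
    C.comp₀ g (f - f') = C.comp₀ g f - C.comp₀ g f' := map_sub _ _ _

theorem sub_comp₀ {X Y Z : C.Obj} (g g' : C.Hom Y Z 0) (f : C.Hom X Y 0) :
    C.comp₀ (g - g') f = C.comp₀ g f - C.comp₀ g' f := LinearMap.map_sub₂ _ _ _ _

theorem id_comp₀ {X Y : C.Obj} (f : C.Hom X Y 0) : C.comp₀ (C.id Y) f = f := C.id_comp _ f

theorem comp₀_id {X Y : C.Obj} (f : C.Hom X Y 0) : C.comp₀ f (C.id X) = f := C.comp_id _ f

theorem IsClosed.comp₀ {X Y Z : C.Obj} {g : C.Hom Y Z 0} (hg : C.IsClosed g)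
    {f : C.Hom X Y 0} (hf : C.IsClosed f) : C.IsClosed (C.comp₀ g f) := by
  unfold IsClosed DGCat.comp₀ at *
  rw [C.leibniz (q' := 0 + 1) (p' := 0 + 1) _ rfl rfl rfl (by omega) (by omega), hg, hf]
  simp

/-- If `σ ∘ π` is a homotopy idempotent and `id - π ∘ σ` is nilpotent up to homotopy, then
`π ∘ σ` is homotopic to the identity. -/
theorem homotopic_id_of_nilpotent {X T : C.Obj} {σ : C.Hom T X 0} {π : C.Hom X T 0}
    (hσ : C.IsClosed σ) (hπ : C.IsClosed π)
    (he : C.Homotopic (C.comp₀ (C.comp₀ σ π) (C.comp₀ σ π)) (C.comp₀ σ π))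
    (r : C.Hom T T 0) (hr : C.comp₀ r r = 0) (hrc : C.IsClosed r)
    (hv : C.Homotopic (C.id T - C.comp₀ π σ) r) :
    C.Homotopic (C.comp₀ π σ) (C.id T) := by
  rw [homotopic_iff_sub_mem] at *
  have hvc : C.IsClosed (C.comp₀ π σ) := hπ.comp₀ hσ
  have hvc' : C.IsClosed (C.id T - C.comp₀ π σ) := by
    unfold IsClosed at *
    rw [map_sub, C.d_id, hvc, sub_zero]
  -- Write `v = π σ`. Sandwiching `e² - e` between `π` and `σ` shows that `v³ - v²` is exact. Since
  -- `r² = 0`, the sum `(id - v)(id - v - r) + (id - v - r) r` equals `(id - v)²`, so this is exact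
  -- too.
  have q := comp₀_mem_exact₀_left hπ (comp₀_mem_exact₀_right he hσ)
  have p := add_mem (comp₀_mem_exact₀_left hvc' hv) (comp₀_mem_exact₀_right hv hrc)
  rw [comp₀_sub, sub_comp₀ (C.id T - C.comp₀ π σ) r r, hr, sub_zero, sub_add_cancel, comp₀_sub,
    sub_comp₀, sub_comp₀, comp₀_id, comp₀_id, id_comp₀] at p
  have p' := comp₀_mem_exact₀_left hvc p
  have e : C.comp₀ π (C.comp₀ (C.comp₀ (C.comp₀ σ π) (C.comp₀ σ π)) σ) =
      C.comp₀ (C.comp₀ π σ) (C.comp₀ (C.comp₀ π σ) (C.comp₀ π σ)) := by simp only [comp₀_assoc]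
  have e' : C.comp₀ π (C.comp₀ (C.comp₀ σ π) σ) = C.comp₀ (C.comp₀ π σ) (C.comp₀ π σ) := by
    simp only [comp₀_assoc]
  rw [sub_comp₀, comp₀_sub, e, e'] at q
  generalize C.comp₀ π σ = v at *
  rw [comp₀_sub, comp₀_sub, comp₀_sub, comp₀_id] at p'
  -- The polynomial identity `v - 1 = (v³ - v²) - v (1 - v)² - (1 - v)²`.
  have := sub_mem (sub_mem q p') p
  convert this using 1
  abel

end Exact

/-! ### The homotopy limit of `⋯ → X → X` along `e`. -/

section Telescope

variable {C : DGCat.{w, u} k}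

/-- The shifts in the telescope. -/
def telShift (i : ℤ) : ℤ := if 0 ≤ i then 0 else -1

/-- The product of countably many copies of `X` and countably many copies of `Σ⁻¹ X`. -/
abbrev tel (X : C.Obj) : SigmaObj C where
  I := Set.univ
  X := fun _ => X
  a := fun i => telShift i.1

/-- Supplies the finiteness of rows for matrices out of the telescope, whose non-zero entries
satisfy `|i| ≤ |j| + 1`. -/
theorem finite_of_banded (j : ℤ) (p : ↥(Set.univ : Set ℤ) → Prop)
    (h : ∀ i, p i → |i.1| ≤ |j| + 1) : {i | p i}.Finite := by
  refine Set.Finite.of_finite_image (f := Subtype.val)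
    ((Set.finite_Icc (-(|j| + 1)) (|j| + 1)).subset ?_) Subtype.val_injective.injOn
  rintro _ ⟨i, hi, rfl⟩
  exact abs_le.1 (h i hi)

/-- The twist of the telescope: `x ↦ (x i - e (x (i + 1)))`. -/
def telTwist {X : C.Obj} (e : C.Hom X X 0) : sigmaHom (tel X) (tel X) 1 :=
  ⟨fun j i => if j.1 < 0 ∧ 0 ≤ i.1 then
      if i.1 + j.1 = -1 then C.idDeg X _ else if i.1 + j.1 = 0 then -convDeg _ e else 0
    else 0, fun j => finite_of_banded j.1 _ fun i hi => by
      by_contra hn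
      refine hi ?_
      beta_reduce
      split_ifs with h1 h2 h3
      · rw [abs_of_neg h1.1, abs_of_nonneg h1.2] at hn; omega
      · rw [abs_of_neg h1.1, abs_of_nonneg h1.2] at hn; omega
      · rfl
      · rfl⟩

/-- The homotopy on the telescope. -/
def telHomotopy {X : C.Obj} (e : C.Hom X X 0) (h : C.Hom X X (-1)) :
    sigmaHom (tel X) (tel X) (-1) :=
  ⟨fun j i => if 0 ≤ j.1 then
      if i.1 < 0 then
        if i.1 + j.1 = -1 then C.idDeg X _ - convDeg _ e
        else if 0 ≤ i.1 + j.1 then -convDeg _ e else 0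
      else if 1 ≤ i.1 ∧ i.1 ≤ j.1 + 1 then convDeg _ h else 0
    else if i.1 < 0 ∧ j.1 - 1 ≤ i.1 then -convDeg _ h else 0,
    fun j => finite_of_banded j.1 _ fun i hi => by
      by_contra hn
      refine hi ?_
      beta_reduce
      split_ifs with h1 h2 h3 h4 h5 h6
      · rw [abs_of_nonneg h1, abs_of_neg h2] at hn; omega
      · rw [abs_of_nonneg h1, abs_of_neg h2] at hn; omega
      · rfl
      · rw [abs_of_nonneg h1, abs_of_nonneg (not_lt.1 h2)] at hn; omega
      · rfl
      · rw [abs_of_neg (not_le.1 h1), abs_of_neg h6.1] at hn; omega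
      · rfl⟩

/-- The morphism from `X` to the telescope. -/
def telIn {X : C.Obj} (e : C.Hom X X 0) (h : C.Hom X X (-1)) :
    sigmaHom (single X) (tel X) 0 :=
  ⟨fun j _ => if 0 ≤ j.1 then convDeg _ e else convDeg _ h, fun _ =>
    Set.Finite.subset (Set.finite_univ_iff.2 (inferInstanceAs (Finite ({0} : Set ℤ))))
      (Set.subset_univ _)⟩

/-- The projection of the telescope to its first factor. -/
def telOut (X : C.Obj) : sigmaHom (tel X) (single X) 0 :=
  ⟨fun _ i => if i.1 = 0 then C.idDeg X _ else 0, fun _ => finite_of_banded 0 _ fun i hi => by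
    by_contra hn
    refine hi (if_neg fun h => hn ?_)
    simp [h]⟩

variable {X : C.Obj} (e : C.Hom X X 0) (h : C.Hom X X (-1))

/-- Position `n ≥ 0` holds the `n`-th copy of `X` and position `-1 - n` the `n`-th copy of `Σ⁻¹ X`.
Row `-1 - n` therefore reads `x_n - e x_{n+1}`, as for a homotopy limit along `e`. -/
theorem tot_telTwist (j i : (tel X).I) : tot ((telTwist e).1 j i) =
    if j.1 < 0 ∧ 0 ≤ i.1 then if i.1 + j.1 = -1 then 𝟙 (⟨X⟩ : Tot C)
      else if i.1 + j.1 = 0 then -tot e else 0 else 0 := by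
  change tot (if j.1 < 0 ∧ 0 ≤ i.1 then
      if i.1 + j.1 = -1 then C.idDeg X _ else if i.1 + j.1 = 0 then -convDeg _ e else 0
    else 0) = _
  split_ifs with h1
  · exact AInfIdempotent.tot_idDeg _ (by simp [telShift, h1.1.not_ge, h1.2])
  · rw [map_neg, tot_convDeg (by simp [telShift, h1.1.not_ge, h1.2])]
  · exact map_zero _
  · exact map_zero _

/-- The block from the suspended copies to the others is `y ↦ (y_n - e(y_0 + ⋯ + y_n))_n`, a right
inverse of `x ↦ (x_n - e x_{n+1})_n` when `e² = e`. The two blocks with `± h` correct the error when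
only `e² ≃ e`. -/
theorem tot_telHomotopy (j i : (tel X).I) : tot ((telHomotopy e h).1 j i) =
    if 0 ≤ j.1 then
      if i.1 < 0 then
        if i.1 + j.1 = -1 then 𝟙 (⟨X⟩ : Tot C) - tot e
        else if 0 ≤ i.1 + j.1 then -tot e else 0
      else if 1 ≤ i.1 ∧ i.1 ≤ j.1 + 1 then tot h else 0
    else if i.1 < 0 ∧ j.1 - 1 ≤ i.1 then -tot h else 0 := by
  change tot (if 0 ≤ j.1 then
      if i.1 < 0 then
        if i.1 + j.1 = -1 then C.idDeg X _ - convDeg _ e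
        else if 0 ≤ i.1 + j.1 then -convDeg _ e else 0
      else if 1 ≤ i.1 ∧ i.1 ≤ j.1 + 1 then convDeg _ h else 0
    else if i.1 < 0 ∧ j.1 - 1 ≤ i.1 then -convDeg _ h else 0) = _
  split_ifs with h1 h2 h3 h4 h5 h6
  · rw [map_sub, tot_convDeg (by simp [telShift, h1, h2.not_ge]),
      AInfIdempotent.tot_idDeg _ (by simp [telShift, h1, h2.not_ge])]
  · rw [map_neg, tot_convDeg (by simp [telShift, h1, h2.not_ge])]
  · exact map_zero _
  · rw [tot_convDeg (by simp [telShift, h1, not_lt.1 h2])]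
  · exact map_zero _
  · rw [map_neg, tot_convDeg (by simp [telShift, h1, h6.1.not_ge])]
  · exact map_zero _

theorem tot_telIn (j : (tel X).I) (i : (single X).I) :
    tot ((telIn e h).1 j i) = if 0 ≤ j.1 then tot e else tot h := by
  change tot (if 0 ≤ j.1 then convDeg _ e else convDeg _ h) = _
  split_ifs with h1
  · rw [tot_convDeg (by simp [telShift, h1])]
  · rw [tot_convDeg (by simp [telShift, h1])]

theorem tot_telOut (j : (single X).I) (i : (tel X).I) :
    tot ((telOut X).1 j i) = if i.1 = 0 then 𝟙 (⟨X⟩ : Tot C) else 0 := by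
  change tot (if i.1 = 0 then C.idDeg X _ else 0) = _
  split_ifs with h1
  · exact AInfIdempotent.tot_idDeg _ (by simp [telShift, h1])
  · exact map_zero _

/-- A position in the telescope. -/
abbrev telIx (X : C.Obj) (i : ℤ) : (tel X).I := ⟨i, trivial⟩

theorem telIx_injective : Function.Injective (telIx X) := fun _ _ h => congrArg Subtype.val h

theorem tot_telTwist_comp {x : SigmaObj C} {n m : ℤ} (hm : 1 + n = m) (f : sigmaHom x (tel X) n)
    (j : (tel X).I) (i : x.I) : tot ((sigmaComp hm (telTwist e) f).1 j i) =
      if 0 ≤ j.1 then 0 else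
        tot (f.1 (telIx X (-1 - j.1)) i) - tot (f.1 (telIx X (-j.1)) i) ≫ tot e := by
  split_ifs with hj
  · rw [tot_sigmaComp _ _ _ j i ∅ (fun l _ => by
      rw [tot_telTwist, if_neg (by omega), Limits.comp_zero]), Finset.sum_empty]
  · rw [tot_sigmaComp _ _ _ j i {telIx X (-1 - j.1), telIx X (-j.1)} (fun l hl => by
      simp only [Finset.mem_insert, Finset.mem_singleton, not_or, Subtype.ext_iff] at hl
      rw [tot_telTwist]
      split_ifs
      · omega
      · omega
      · exact Limits.comp_zero
      · exact Limits.comp_zero), Finset.sum_pair (fun h' => by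
        have := telIx_injective h'; omega), tot_telTwist, tot_telTwist, if_pos (by dsimp only; omega),
      if_pos (by dsimp only; omega), if_pos (by dsimp only; omega), if_neg (by dsimp only; omega),
      if_pos (by dsimp only; omega), Category.comp_id, Preadditive.comp_neg, ← sub_eq_add_neg]

/-- Column `0` is exceptional: `x_0` occurs only in the row `x_0 - e x_1`, whereas every later `x_i`
occurs in two rows. -/
theorem tot_comp_telTwist {y : SigmaObj C} {n m : ℤ} (hm : n + 1 = m) (f : sigmaHom (tel X) y n)
    (j : y.I) (i : (tel X).I) : tot ((sigmaComp hm f (telTwist e)).1 j i) =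
      if i.1 < 0 then 0 else
        tot (f.1 j (telIx X (-1 - i.1))) -
          if i.1 = 0 then 0 else tot e ≫ tot (f.1 j (telIx X (-i.1))) := by
  split_ifs with hi hi0
  · rw [tot_sigmaComp _ _ _ j i ∅ (fun l _ => by
      rw [tot_telTwist, if_neg (by omega), Limits.zero_comp]), Finset.sum_empty]
  · rw [tot_sigmaComp _ _ _ j i {telIx X (-1 - i.1)} (fun l hl => by
      simp only [Finset.mem_singleton, Subtype.ext_iff] at hl
      rw [tot_telTwist]
      split_ifs
      · omega
      · omega
      · exact Limits.zero_comp
      · exact Limits.zero_comp), Finset.sum_singleton, tot_telTwist,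
      if_pos (by dsimp only; omega), if_pos (by dsimp only; omega), Category.id_comp, sub_zero]
  · rw [tot_sigmaComp _ _ _ j i {telIx X (-1 - i.1), telIx X (-i.1)} (fun l hl => by
      simp only [Finset.mem_insert, Finset.mem_singleton, not_or, Subtype.ext_iff] at hl
      rw [tot_telTwist]
      split_ifs
      · omega
      · omega
      · exact Limits.zero_comp
      · exact Limits.zero_comp), Finset.sum_pair (fun h' => by
        have := telIx_injective h'; omega), tot_telTwist, tot_telTwist, if_pos (by dsimp only; omega),
      if_pos (by dsimp only; omega), if_pos (by dsimp only; omega), if_neg (by dsimp only; omega),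
      if_pos (by dsimp only; omega), Category.id_comp, Preadditive.neg_comp, ← sub_eq_add_neg]

theorem tot_telIn_telOut (j i : (tel X).I) :
    tot ((sigmaComp (add_zero 0) (telIn e h) (telOut X)).1 j i) =
      if i.1 = 0 then if 0 ≤ j.1 then tot e else tot h else 0 := by
  rw [tot_sigmaComp _ _ _ j i {(⟨0, rfl⟩ : (single X).I)} (fun l hl =>
      absurd (Finset.mem_singleton.2 (Subtype.ext (show l.1 = 0 from l.2))) hl),
    Finset.sum_singleton, tot_telOut, tot_telIn]
  split_ifs <;> simp

theorem telOut_telIn :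
    sigmaComp (add_zero 0) (telOut X) (telIn e h) = singleMap 0 e := by
  refine sigmaHom_ext_tot (fun j i => ?_)
  rw [tot_singleMap, tot_sigmaComp _ _ _ j i {telIx X 0} (fun l hl => by
      simp only [Finset.mem_singleton, Subtype.ext_iff] at hl
      rw [tot_telOut, if_neg hl, Limits.comp_zero]),
    Finset.sum_singleton, tot_telOut, tot_telIn, if_pos rfl, if_pos (le_refl _),
    Category.comp_id]

variable {e h}

/-- The telescope of a homotopy idempotent. -/
noncomputable def telescope (he : C.IsClosed e) : TwObj (SigmaPi C) where
  X := tel X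
  α := telTwist e
  maurerCartan := by
    have hE := (isClosed_iff_totD e).1 he
    change sigmaD (tel X) (tel X) 1 2 rfl (telTwist e) +
      sigmaComp (show (1 : ℤ) + 1 = 2 from rfl) (telTwist e) (telTwist e) = 0
    have h1 : sigmaD (tel X) (tel X) 1 2 rfl (telTwist e) = 0 := by
      refine sigmaHom_ext_tot (fun j i => ?_)
      rw [tot_sigmaD, tot_telTwist]
      change _ = tot 0
      split_ifs <;> simp [hE]
    have h2 : sigmaComp (show (1 : ℤ) + 1 = 2 from rfl) (telTwist e) (telTwist e) = 0 := by
      refine sigmaComp_eq_zero _ _ _ (fun l j i => ?_)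
      by_cases hj : 0 ≤ j.1
      · right
        exact if_neg (by omega)
      · left
        exact if_neg (by omega)
    rw [h1, h2, add_zero]

theorem isClosed_telOut (he : C.IsClosed e) :
    (Tw (SigmaPi C)).IsClosed (X := telescope he) (Y := twSingle X) (telOut X) := by
  suffices h : matD (telTwist e) (0 : sigmaHom (single X) (single X) 1) 0 (0 + 1) rfl
    (telOut X) = 0 from h
  refine sigmaHom_ext_tot (fun j i => ?_)
  have h0 : sigmaComp (show (1 : ℤ) + 0 = 0 + 1 from rfl) (0 : sigmaHom (single X) (single X) 1)
    (telOut X) = 0 := by rw [map_zero, LinearMap.zero_apply]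
  rw [tot_matD, h0, tot_comp_telTwist, tot_telOut, tot_telOut, tot_telOut]
  change _ + tot 0 - _ = tot 0
  by_cases hi : i.1 < 0
  · rw [if_pos hi, if_neg hi.ne]; simp
  · rw [if_neg (c := -1 - i.1 = 0) (by omega)]
    split_ifs <;> first | (dsimp only at *; omega) | simp

/-- In a suspended row the twist contributes `e - e²`, and the sign of `Σ⁻¹` turns `d h` into `-(e -
e²)`. The entries `h` are there for this cancellation. -/
theorem isClosed_telIn (he : C.IsClosed e) (hh : totD (tot h) = tot e - tot e ≫ tot e) :
    (Tw (SigmaPi C)).IsClosed (X := twSingle X) (Y := telescope he) (telIn e h) := by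
  suffices h : matD (0 : sigmaHom (single X) (single X) 1) (telTwist e) 0 (0 + 1) rfl
    (telIn e h) = 0 from h
  have hE := (isClosed_iff_totD e).1 he
  refine sigmaHom_ext_tot (fun j i => ?_)
  rw [tot_matD, map_zero, tot_telTwist_comp, tot_telIn, tot_telIn, tot_telIn]
  change _ + _ - _ • tot 0 = tot 0
  rw [map_zero, smul_zero, sub_zero]
  by_cases hj : 0 ≤ j.1
  · rw [if_pos hj, if_pos hj, hE, smul_zero, add_zero]
  · rw [if_neg hj, if_neg hj, if_pos (by dsimp only; omega), if_pos (by dsimp only; omega), hh]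
    simp [telShift, hj]

/-- The part of `id - π ∘ σ` that the homotopy does not account for. -/
noncomputable def telRest (e : C.Hom X X 0) (h : C.Hom X X (-1)) : sigmaHom (tel X) (tel X) 0 :=
  sigmaId (tel X) - sigmaComp (add_zero 0) (telIn e h) (telOut X) -
    matD (telTwist e) (telTwist e) (-1) 0 rfl (telHomotopy e h)

/-- Three of the four blocks cancel using only `d e = 0` and `d h = e - e²`. The fourth block, from
the copies of `X` to the copies of `Σ⁻¹ X`, contains commutators of `e` and `h`, which need not
vanish. Its source and target positions are disjoint, so its square is zero without any higher
coherence. -/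
theorem telRest_eq_zero (he : C.IsClosed e) (hh : totD (tot h) = tot e - tot e ≫ tot e)
    (j i : (tel X).I) (hji : 0 ≤ j.1 ∨ i.1 < 0) : (telRest e h).1 j i = 0 := by
  have hE := (isClosed_iff_totD e).1 he
  have hs : ((-1 : ℤ).negOnePow : ℤ) = -1 := by rw [Int.negOnePow_odd _ (by decide)]; rfl
  have h1 : tot ((sigmaId (tel X)).1 j i) = if j.1 = i.1 then 𝟙 (⟨X⟩ : Tot C) else 0 := by
    split_ifs with h
    · obtain rfl : j = i := Subtype.ext h
      exact tot_sigmaId_self _ _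
    · exact tot_sigmaId_of_ne _ (fun h' => h (by rw [h']))
  refine tot_injective ?_
  rw [map_zero]
  change tot ((sigmaId (tel X)).1 j i -
    (sigmaComp (add_zero 0) (telIn e h) (telOut X)).1 j i -
    (matD (telTwist e) (telTwist e) (-1) 0 rfl (telHomotopy e h)).1 j i) = 0
  rw [map_sub, map_sub, h1, tot_telIn_telOut, tot_matD, tot_telTwist_comp, tot_comp_telTwist]
  rw [tot_telHomotopy, tot_telHomotopy, tot_telHomotopy, tot_telHomotopy, tot_telHomotopy]
  simp only [hs, neg_smul, one_smul, telIx]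
  rcases le_or_gt 0 j.1 with hj | hj
  · have hsh : ((telShift j.1).negOnePow : ℤ) = 1 := by simp [telShift, hj]
    rcases le_or_gt 0 i.1 with hi | hi
    · simp only [if_pos hj, if_neg hi.not_gt, hsh, one_smul,
        if_pos (show -1 - i.1 < 0 by omega)]
      split_ifs <;> first | (exfalso; omega) | skip
      all_goals simp [hh] <;> abel
    · simp only [if_pos hj, if_pos hi, hsh]
      split_ifs <;> first | (exfalso; omega) | simp [hE]
  · have hsh : ((telShift j.1).negOnePow : ℤ) = -1 := by simp [telShift, hj.not_ge]
    have hi : i.1 < 0 := by omega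
    simp only [if_neg hj.not_ge, if_pos hi, hsh, if_pos (show 0 ≤ -1 - j.1 by omega),
      if_pos (show 0 ≤ - j.1 by omega), if_neg hi.ne, neg_smul, one_smul, sub_zero]
    split_ifs <;> first | (exfalso; omega) | skip
    all_goals simp [hh]

theorem telRest_comp_telRest (he : C.IsClosed e) (hh : totD (tot h) = tot e - tot e ≫ tot e) :
    sigmaComp (add_zero 0) (telRest e h) (telRest e h) = 0 := by
  refine sigmaComp_eq_zero _ _ _ (fun l j i => ?_)
  by_cases hj : 0 ≤ j.1
  · exact Or.inr (telRest_eq_zero he hh j i (Or.inl hj))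
  · exact Or.inl (telRest_eq_zero he hh l j (Or.inr (not_le.1 hj)))

end Telescope

/-! ### The embedding in the twisted envelope and the splitting of homotopy idempotents. -/

section Functor

variable {C D : DGCat.{w, u} k}

theorem DGFunctor.map_isClosed (F : DGFunctor C D) {X Y : C.Obj} {n : ℤ} {f : C.Hom X Y n}
    (hf : C.IsClosed f) : D.IsClosed (F.map n f) := by
  unfold IsClosed at *
  rw [← F.map_d, hf, map_zero]

theorem DGFunctor.map_homotopic (F : DGFunctor C D) {X Y : C.Obj} {n : ℤ} {f g : C.Hom X Y n}
    (hfg : C.Homotopic f g) : D.Homotopic (F.map n f) (F.map n g) := by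
  obtain ⟨h, hh⟩ := hfg
  exact ⟨F.map _ h, by rw [← F.map_d, hh, map_sub]⟩

theorem DGFunctor.map_comp₀ (F : DGFunctor C D) {X Y Z : C.Obj} (g : C.Hom Y Z 0)
    (f : C.Hom X Y 0) : F.map 0 (C.comp₀ g f) = D.comp₀ (F.map 0 g) (F.map 0 f) :=
  F.map_comp _ g f

/-- The embedding of a dg category in the twisted envelope of its additive envelope. -/
noncomputable def toTw (C : DGCat.{w, u} k) : DGFunctor C (Tw (SigmaPi C)) where
  obj X := twSingle X
  map n := singleMap n
  map_d h f := (toKar C).map_d h f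
  map_id X := (toKar C).map_id X
  map_comp h g f := (toKar C).map_comp h g f

theorem toTw_bijective (X Y : C.Obj) (n : ℤ) :
    Function.Bijective ((toTw C).map (X := X) (Y := Y) n) := by
  constructor
  · intro f g hfg
    refine tot_injective ?_
    rw [← tot_singleMap f ⟨0, rfl⟩ ⟨0, rfl⟩, ← tot_singleMap g ⟨0, rfl⟩ ⟨0, rfl⟩]
    exact congrArg (fun f : sigmaHom (single X) (single Y) n => tot (f.1 ⟨0, rfl⟩ ⟨0, rfl⟩)) hfg
  · intro f
    refine ⟨C.castDeg (by simp) ((show sigmaHom (single X) (single Y) n from f).1 ⟨0, rfl⟩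
      ⟨0, rfl⟩), sigmaHom_ext_tot (fun j i => ?_)⟩
    obtain ⟨_, rfl⟩ := i
    obtain ⟨_, rfl⟩ := j
    exact (tot_singleMap _ _ _).trans (tot_castDeg _ _)

/-- A homotopy idempotent of `C` has an image in the twisted envelope. -/
theorem exists_isImage_toTw {X : C.Obj} {e : C.Hom X X 0} (he : C.IsHomotopyIdempotent e) :
    ∃ T, (Tw (SigmaPi C)).IsImage ((toTw C).map 0 e) T := by
  obtain ⟨hec, hee⟩ := he
  obtain ⟨h', hh'⟩ := hee.exists_totD (m := -1) rfl
  obtain ⟨h, hh⟩ : ∃ h : C.Hom X X (-1), totD (tot h) = tot e - tot e ≫ tot e :=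
    ⟨-h', by rw [map_neg, map_neg, hh', comp₀, tot_comp, neg_sub]⟩
  let B := Tw (SigmaPi C)
  let T : B.Obj := telescope hec
  let σ : B.Hom T ((toTw C).obj X) 0 := telOut X
  let π : B.Hom ((toTw C).obj X) T 0 := telIn e h
  let r : B.Hom T T 0 := telRest e h
  let s : B.Hom T T (-1) := telHomotopy e h
  have hσπ : B.comp₀ σ π = (toTw C).map 0 e := telOut_telIn e h
  have hσ : B.IsClosed σ := isClosed_telOut hec
  have hπ : B.IsClosed π := isClosed_telIn hec hh
  have hr : r = B.id T - B.comp₀ π σ - B.d (-1) 0 rfl s := rfl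
  -- By its definition the rest `r` differs from `id - π σ` by a boundary, so `r` is closed and
  -- homotopic to it.
  have hv : B.d (-1) 0 rfl s = B.id T - B.comp₀ π σ - r := by rw [hr, sub_sub_cancel]
  have hrc : B.IsClosed r := by
    have hc : B.d 0 (0 + 1) rfl (B.comp₀ π σ) = 0 := hπ.comp₀ hσ
    rw [IsClosed, hr, map_sub, map_sub, B.d_id, hc, B.d_d, sub_zero, sub_zero]
  have hI : B.Homotopic (B.comp₀ (B.comp₀ σ π) (B.comp₀ σ π)) (B.comp₀ σ π) := by
    rw [hσπ, ← DGFunctor.map_comp₀]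
    exact (toTw C).map_homotopic hee
  exact ⟨T, σ, π, hσ, hπ, homotopic_id_of_nilpotent hσ hπ hI r
    (telRest_comp_telRest hec hh) hrc ⟨s, hv⟩, 0, by rw [map_zero, hσπ, sub_self]⟩

end Functor

end DGCat
namespace DGCat

variable {k : Type w} [CommRing k]

/-! ### Cohomology categories -/

section Homotopic

variable {C : DGCat.{w, u} k}

/-- Write `g f - g' f' = (g - g') f + g' (f - f')`; hence only `g'` and `f` have to be closed. -/
theorem Homotopic.comp {X Y Z : C.Obj} {q p n : ℤ} (h : q + p = n) {g g' : C.Hom Y Z q}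
    {f f' : C.Hom X Y p} (hg : C.Homotopic g g') (hf : C.Homotopic f f') (hg' : C.IsClosed g')
    (hfc : C.IsClosed f) : C.Homotopic (C.comp h g f) (C.comp h g' f') := by
  obtain ⟨a, ha⟩ := hg
  obtain ⟨b, hb⟩ := hf
  refine ⟨C.comp (by omega) a f + (q.negOnePow : ℤ) • C.comp (by omega) g' b, ?_⟩
  rw [map_add, map_zsmul,
    C.leibniz (q' := q) (p' := p + 1) _ (by omega) rfl (by omega) (by omega) (by omega) a f,
    C.leibniz (q' := q + 1) (p' := p) _ rfl (by omega) (by omega) (by omega) (by omega) g' b,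
    ha, hb, show C.d q (q + 1) rfl g' = 0 from hg', show C.d p (p + 1) rfl f = 0 from hfc]
  simp only [map_sub, LinearMap.sub_apply, map_zero, LinearMap.zero_apply, smul_zero, add_zero,
    zero_add, smul_smul, negOnePow_mul_self, one_smul]
  abel

theorem IsClosed.comp {X Y Z : C.Obj} {q p n : ℤ} (h : q + p = n) {g : C.Hom Y Z q}
    {f : C.Hom X Y p} (hg : C.IsClosed g) (hf : C.IsClosed f) : C.IsClosed (C.comp h g f) := by
  unfold IsClosed at *
  rw [C.leibniz (q' := q + 1) (p' := p + 1) _ rfl rfl rfl (by omega) (by omega), hg, hf]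
  simp

theorem isClosed_id (X : C.Obj) : C.IsClosed (C.id X) := C.d_id _

theorem IsClosed.castDeg {X Y : C.Obj} {n m : ℤ} (h : n = m) {f : C.Hom X Y n}
    (hf : C.IsClosed f) : C.IsClosed (C.castDeg h f) := by
  subst h; exact hf

theorem homotopic_comm {X Y : C.Obj} {n : ℤ} {f g : C.Hom X Y n} :
    C.Homotopic f g ↔ C.Homotopic g f := by
  constructor <;>
  · rintro ⟨h, hh⟩
    exact ⟨-h, by rw [map_neg, hh, neg_sub]⟩

theorem Homotopic.refl {X Y : C.Obj} {n : ℤ} (f : C.Hom X Y n) : C.Homotopic f f :=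
  ⟨0, by rw [map_zero, sub_self]⟩

end Homotopic

/-- The objects of `C`, as objects of the category whose morphisms are the cohomology classes
of degree in `S`. -/
@[ext]
structure HCat (S : AddSubmonoid ℤ) (C : DGCat.{w, u} k) where
  /-- the underlying object -/
  obj : C.Obj

section HCat

variable {S : AddSubmonoid ℤ} {C D : DGCat.{w, u} k}

/-- The class of a closed morphism. -/
def cls {X Y : C.Obj} {n : ℤ} (hn : n ∈ S) (f : C.Hom X Y n) (hf : C.IsClosed f) :
    Σ n : S, C.Cohomology X Y n :=
  ⟨⟨n, hn⟩, Submodule.Quotient.mk ⟨f, hf⟩⟩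

theorem exists_cls {X Y : C.Obj} (φ : Σ n : S, C.Cohomology X Y n) :
    ∃ (n : ℤ) (hn : n ∈ S) (f : C.Hom X Y n) (hf : C.IsClosed f), cls hn f hf = φ := by
  obtain ⟨n, a⟩ := φ
  obtain ⟨⟨f, hf⟩, rfl⟩ := Submodule.Quotient.mk_surjective _ a
  exact ⟨n, n.2, f, hf, rfl⟩

theorem mk_eq_mk_iff {X Y : C.Obj} {n : ℤ} {f g : C.Hom X Y n} (hf : C.IsClosed f)
    (hg : C.IsClosed g) :
    (Submodule.Quotient.mk ⟨f, hf⟩ : C.Cohomology X Y n) = Submodule.Quotient.mk ⟨g, hg⟩ ↔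
      C.Homotopic f g :=
  Submodule.Quotient.eq _

theorem cls_eq_iff {X Y : C.Obj} {n : ℤ} (hn : n ∈ S) {f g : C.Hom X Y n} (hf : C.IsClosed f)
    (hg : C.IsClosed g) : cls hn f hf = cls hn g hg ↔ C.Homotopic f g := by
  rw [← mk_eq_mk_iff hf hg, cls, cls, Sigma.mk.injEq]
  exact ⟨fun h => eq_of_heq h.2, fun h => ⟨rfl, heq_of_eq h⟩⟩

theorem cls_castDeg {X Y : C.Obj} {n m : ℤ} (h : n = m) (hn : n ∈ S) (hm : m ∈ S)
    {f : C.Hom X Y n} (hf : C.IsClosed f) :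
    cls hm (C.castDeg h f) (hf.castDeg h) = cls hn f hf := by
  subst h; rfl

variable (S C) in
-- The composite class is characterized against all representatives and all expressions `n` for its
-- degree. A choice of it thus comes with well-definedness built in, and no degree has to be
-- transported.
theorem exists_clsComp {X Y Z : C.Obj} (φ : Σ n : S, C.Cohomology X Y n)
    (ψ : Σ n : S, C.Cohomology Y Z n) : ∃ χ : Σ n : S, C.Cohomology X Z n,
      ∀ (p q n : ℤ) (hp : p ∈ S) (hq : q ∈ S) (hn : n ∈ S) (h : q + p = n)
        (f : C.Hom X Y p) (g : C.Hom Y Z q) (hf : C.IsClosed f) (hg : C.IsClosed g),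
        cls hp f hf = φ → cls hq g hg = ψ → χ = cls hn (C.comp h g f) (hg.comp h hf) := by
  obtain ⟨p, hp, f, hf, rfl⟩ := exists_cls φ
  obtain ⟨q, hq, g, hg, rfl⟩ := exists_cls ψ
  refine ⟨cls (S.add_mem hq hp) (C.comp rfl g f) (hg.comp rfl hf), ?_⟩
  intro p' q' n hp' hq' hn h f' g' hf' hg' hφ hψ
  obtain rfl : p' = p := congrArg Subtype.val (congrArg Sigma.fst hφ)
  obtain rfl : q' = q := congrArg Subtype.val (congrArg Sigma.fst hψ)
  subst h
  rw [cls_eq_iff, ← homotopic_comm] at hφ hψ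
  exact (cls_eq_iff _ _ _).2 (hψ.comp _ hφ hg' hf)

/-- Morphisms are single homogeneous classes. For `S = ⊥` this is `H⁰`, whose isomorphisms are the
homotopy equivalences; `S = ⊤` sees the cohomology in all degrees and detects quasi-full
faithfulness. Both are needed, since an isomorphism in the second category may have non-zero degree.
-/
noncomputable instance : Category (HCat S C) where
  Hom X Y := Σ n : S, C.Cohomology X.obj Y.obj n
  id X := cls S.zero_mem (C.id X.obj) (isClosed_id _)
  comp φ ψ := (exists_clsComp S C φ ψ).choose
  id_comp {X Y} φ := by
    obtain ⟨p, hp, f, hf, rfl⟩ := exists_cls φ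
    refine ((exists_clsComp S C _ _).choose_spec 0 _ _ _ _ hp (add_zero _) _ _ _ _
      rfl rfl).trans ?_
    simp only [C.comp_id]
  comp_id {X Y} φ := by
    obtain ⟨p, hp, f, hf, rfl⟩ := exists_cls φ
    refine ((exists_clsComp S C _ _).choose_spec _ 0 _ _ _ hp (zero_add _) _ _ _ _
      rfl rfl).trans ?_
    simp only [C.id_comp]
  assoc {W X Y Z} φ ψ χ := by
    obtain ⟨p, hp, f, hf, rfl⟩ := exists_cls φ
    obtain ⟨q, hq, g, hg, rfl⟩ := exists_cls ψ
    obtain ⟨r, hr, h, hh, rfl⟩ := exists_cls χ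
    have h1 := S.add_mem hq hp
    have h2 := S.add_mem hr hq
    have h3 := S.add_mem hr h1
    refine ((exists_clsComp S C _ _).choose_spec _ _ _ h1 hr h3 rfl _ _ (hg.comp rfl hf) hh
      ((exists_clsComp S C _ _).choose_spec _ _ _ _ _ _ rfl _ _ _ _ rfl rfl).symm rfl).trans ?_
    refine Eq.symm (((exists_clsComp S C _ _).choose_spec _ _ _ hp h2 h3 (add_assoc _ _ _) _ _
      hf (hh.comp rfl hg) rfl
      ((exists_clsComp S C _ _).choose_spec _ _ _ _ _ _ rfl _ _ _ _ rfl rfl).symm).trans ?_)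
    simp only [C.assoc rfl rfl (add_assoc _ _ _) rfl]

/-- The class of a closed morphism, as a morphism of the cohomology category. -/
def hmk {X Y : C.Obj} {n : ℤ} (hn : n ∈ S) (f : C.Hom X Y n) (hf : C.IsClosed f) :
    (⟨X⟩ : HCat S C) ⟶ ⟨Y⟩ := cls hn f hf

theorem hmk_comp {X Y Z : C.Obj} {p q n : ℤ} (hp : p ∈ S) (hq : q ∈ S) (hn : n ∈ S)
    (h : q + p = n) (f : C.Hom X Y p) (g : C.Hom Y Z q) (hf : C.IsClosed f) (hg : C.IsClosed g) :
    hmk hp f hf ≫ hmk hq g hg = hmk hn (C.comp h g f) (hg.comp h hf) :=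
  (exists_clsComp S C _ _).choose_spec _ _ _ _ _ _ _ _ _ _ _ rfl rfl

theorem hmk_id (X : C.Obj) : hmk S.zero_mem (C.id X) (isClosed_id X) = 𝟙 (⟨X⟩ : HCat S C) := rfl

theorem hmk_eq_iff {X Y : C.Obj} {n : ℤ} (hn : n ∈ S) {f g : C.Hom X Y n} (hf : C.IsClosed f)
    (hg : C.IsClosed g) : hmk hn f hf = hmk hn g hg ↔ C.Homotopic f g := cls_eq_iff hn hf hg

theorem hmk_comp₀ {X Y Z : C.Obj} (f : C.Hom X Y 0) (g : C.Hom Y Z 0) (hf : C.IsClosed f)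
    (hg : C.IsClosed g) : hmk S.zero_mem f hf ≫ hmk S.zero_mem g hg =
      hmk S.zero_mem (C.comp₀ g f) (hg.comp₀ hf) :=
  hmk_comp _ _ _ _ _ _ _ _

theorem exists_hmk₀ {X Y : C.Obj} (φ : (⟨X⟩ : HCat ⊥ C) ⟶ ⟨Y⟩) :
    ∃ (f : C.Hom X Y 0) (hf : C.IsClosed f), hmk (AddSubmonoid.zero_mem _) f hf = φ := by
  obtain ⟨n, hn, f, hf, h⟩ := exists_cls φ
  have h0 : n = 0 := (AddSubmonoid.mem_bot).1 hn
  exact ⟨C.castDeg h0 f, hf.castDeg h0, (cls_castDeg h0 hn _ hf).trans h⟩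

theorem nonempty_iso_iff {X Y : C.Obj} :
    Nonempty ((⟨X⟩ : HCat ⊥ C) ≅ ⟨Y⟩) ↔ C.HomotopyEquivalent X Y := by
  constructor
  · rintro ⟨⟨φ, ψ, h₁, h₂⟩⟩
    obtain ⟨f, hf, rfl⟩ := exists_hmk₀ φ
    obtain ⟨g, hg, rfl⟩ := exists_hmk₀ ψ
    rw [hmk_comp₀, ← hmk_id, hmk_eq_iff] at h₁ h₂
    exact ⟨f, g, hf, hg, h₁, h₂⟩
  · rintro ⟨f, g, hf, hg, h₁, h₂⟩
    exact ⟨⟨hmk (AddSubmonoid.zero_mem _) f hf, hmk (AddSubmonoid.zero_mem _) g hg,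
      by rwa [hmk_comp₀, ← hmk_id, hmk_eq_iff], by rwa [hmk_comp₀, ← hmk_id, hmk_eq_iff]⟩⟩

theorem nonempty_iso_of_homotopyEquivalent {X Y : C.Obj} (h : C.HomotopyEquivalent X Y) :
    Nonempty ((⟨X⟩ : HCat S C) ≅ ⟨Y⟩) := by
  obtain ⟨f, g, hf, hg, h₁, h₂⟩ := h
  exact ⟨⟨hmk (AddSubmonoid.zero_mem _) f hf, hmk (AddSubmonoid.zero_mem _) g hg,
      by rwa [hmk_comp₀, ← hmk_id, hmk_eq_iff], by rwa [hmk_comp₀, ← hmk_id, hmk_eq_iff]⟩⟩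

/-- `T` is a homotopy retract of `X`. -/
def IsHomotopyRetract (C : DGCat.{w, u} k) (T X : C.Obj) : Prop :=
  ∃ (σ : C.Hom T X 0) (π : C.Hom X T 0), C.IsClosed σ ∧ C.IsClosed π ∧
    C.Homotopic (C.comp₀ π σ) (C.id T)

theorem IsHomotopyRetract.nonempty_retract {T X : C.Obj} (h : C.IsHomotopyRetract T X) :
    Nonempty (Retract (⟨T⟩ : HCat S C) ⟨X⟩) := by
  obtain ⟨σ, π, hσ, hπ, h⟩ := h
  exact ⟨⟨hmk S.zero_mem σ hσ, hmk S.zero_mem π hπ, by rwa [hmk_comp₀, ← hmk_id, hmk_eq_iff]⟩⟩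

theorem nonempty_retract_iff {T X : C.Obj} :
    Nonempty (Retract (⟨T⟩ : HCat ⊥ C) ⟨X⟩) ↔ C.IsHomotopyRetract T X := by
  refine ⟨?_, fun h => h.nonempty_retract⟩
  rintro ⟨⟨φ, ψ, h⟩⟩
  obtain ⟨f, hf, rfl⟩ := exists_hmk₀ φ
  obtain ⟨g, hg, rfl⟩ := exists_hmk₀ ψ
  rw [hmk_comp₀, ← hmk_id, hmk_eq_iff] at h
  exact ⟨f, g, hf, hg, h⟩

/-- From here on, homotopy idempotents are treated as ordinary idempotents of `H⁰`. -/
theorem homotopyIdempotentComplete_iff :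
    C.HomotopyIdempotentComplete ↔ IsIdempotentComplete (HCat ⊥ C) := by
  constructor
  · intro hC
    refine ⟨fun ⟨X⟩ φ hφ => ?_⟩
    obtain ⟨e, he, rfl⟩ := exists_hmk₀ φ
    rw [hmk_comp₀, hmk_eq_iff] at hφ
    obtain ⟨Y, σ, π, hσ, hπ, h₁, h₂⟩ := hC X e ⟨he, hφ⟩
    exact ⟨⟨Y⟩, hmk (AddSubmonoid.zero_mem _) σ hσ, hmk (AddSubmonoid.zero_mem _) π hπ,
      by rwa [hmk_comp₀, ← hmk_id, hmk_eq_iff], by rwa [hmk_comp₀, hmk_eq_iff]⟩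
  · rintro ⟨hC⟩ X e ⟨he, hee⟩
    obtain ⟨⟨Y⟩, φ, ψ, h₁, h₂⟩ := hC ⟨X⟩ (hmk (AddSubmonoid.zero_mem _) e he)
      (by rwa [hmk_comp₀, hmk_eq_iff])
    obtain ⟨σ, hσ, rfl⟩ := exists_hmk₀ φ
    obtain ⟨π, hπ, rfl⟩ := exists_hmk₀ ψ
    rw [hmk_comp₀, hmk_eq_iff] at h₂
    rw [hmk_comp₀, ← hmk_id, hmk_eq_iff] at h₁
    exact ⟨Y, σ, π, hσ, hπ, h₁, h₂⟩

/-- The functor on cohomology categories induced by a dg functor. -/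
noncomputable def DGFunctor.mapH (S : AddSubmonoid ℤ) (F : DGFunctor C D) : HCat S C ⥤ HCat S D where
  obj X := ⟨F.obj X.obj⟩
  map {X Y} φ := ⟨φ.1, F.mapCohomology X.obj Y.obj φ.1 φ.2⟩
  map_id X := (cls_eq_iff (S := S) S.zero_mem (F.map_isClosed (isClosed_id X.obj))
    (isClosed_id _)).2 (by rw [F.map_id]; exact Homotopic.refl _)
  map_comp {X Y Z} φ ψ := by
    obtain ⟨p, hp, f, hf, rfl⟩ := exists_cls φ
    obtain ⟨q, hq, g, hg, rfl⟩ := exists_cls ψ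
    have h1 := S.add_mem hq hp
    have e := hmk_comp hp hq h1 rfl f g hf hg
    have e' := hmk_comp hp hq h1 rfl (F.map _ f) (F.map _ g) (F.map_isClosed hf)
      (F.map_isClosed hg)
    refine Eq.trans ?_ e'.symm
    refine (congrArg (fun φ : Σ n : S, C.Cohomology X.obj Z.obj n =>
      (⟨φ.1, F.mapCohomology X.obj Z.obj φ.1 φ.2⟩ :
        Σ n : S, D.Cohomology (F.obj X.obj) (F.obj Z.obj) n)) e).trans ?_
    refine (cls_eq_iff (S := S) h1 (F.map_isClosed (hg.comp rfl hf)) _).2 ?_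
    rw [F.map_comp]
    exact Homotopic.refl _

theorem DGFunctor.mapH_bijective {F : DGFunctor C D} {X Y : C.Obj}
    (hF : ∀ n, Function.Bijective (F.mapCohomology X Y n)) :
    Function.Bijective ((F.mapH S).map (X := ⟨X⟩) (Y := ⟨Y⟩)) := by
  constructor
  · rintro ⟨n, a⟩ ⟨m, b⟩ h
    obtain ⟨h₁, h₂⟩ := Sigma.mk.inj_iff.1 h
    obtain rfl : n = m := h₁
    exact congrArg (Sigma.mk n) ((hF _).1 (eq_of_heq h₂))
  · rintro ⟨n, a⟩
    obtain ⟨b, rfl⟩ := (hF n).2 a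
    exact ⟨⟨n, b⟩, rfl⟩

theorem DGFunctor.mapCohomology_bijective {F : DGFunctor C D} {X Y : C.Obj}
    (hF : Function.Bijective ((F.mapH ⊤).map (X := ⟨X⟩) (Y := ⟨Y⟩))) (n : ℤ) :
    Function.Bijective (F.mapCohomology X Y n) := by
  constructor
  · intro a b h
    have := @hF.1 ⟨⟨n, trivial⟩, a⟩ ⟨⟨n, trivial⟩, b⟩ (Sigma.mk.inj_iff.2 ⟨rfl, heq_of_eq h⟩)
    exact eq_of_heq (Sigma.mk.inj_iff.1 this).2
  · intro a
    obtain ⟨⟨m, b⟩, h⟩ := hF.2 ⟨⟨n, trivial⟩, a⟩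
    obtain ⟨h₁, h₂⟩ := Sigma.mk.inj_iff.1 h
    obtain rfl : m = ⟨n, trivial⟩ := h₁
    exact ⟨b, eq_of_heq h₂⟩

theorem DGFunctor.mapCohomology_bijective_of_bijective {F : DGFunctor C D} {X Y : C.Obj}
    (hF : ∀ n, Function.Bijective (F.map (X := X) (Y := Y) n)) (n : ℤ) :
    Function.Bijective (F.mapCohomology X Y n) := by
  constructor
  · rintro a b h
    obtain ⟨⟨f, hf⟩, rfl⟩ := Submodule.Quotient.mk_surjective _ a
    obtain ⟨⟨g, hg⟩, rfl⟩ := Submodule.Quotient.mk_surjective _ b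
    obtain ⟨c, hc⟩ := (mk_eq_mk_iff (F.map_isClosed hf) (F.map_isClosed hg)).1 h
    obtain ⟨c, rfl⟩ := (hF _).2 c
    exact (mk_eq_mk_iff hf hg).2 ⟨c, (hF _).1 (by rw [F.map_d, hc, map_sub])⟩
  · intro a
    obtain ⟨⟨f, hf⟩, rfl⟩ := Submodule.Quotient.mk_surjective _ a
    obtain ⟨f, rfl⟩ := (hF _).2 f
    exact ⟨Submodule.Quotient.mk ⟨f, (hF _).1 (by
      rw [F.map_d, map_zero]; exact hf)⟩, rfl⟩

theorem quasiFullyFaithful_iff (F : DGFunctor C D) :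
    F.QuasiFullyFaithful ↔ ∀ X Y, Function.Bijective ((F.mapH ⊤).map (X := X) (Y := Y)) :=
  ⟨fun h X Y => DGFunctor.mapH_bijective (h X.obj Y.obj),
    fun h X Y => DGFunctor.mapCohomology_bijective (h ⟨X⟩ ⟨Y⟩)⟩

theorem quasiEssSurj_iff (F : DGFunctor C D) :
    F.QuasiEssSurj ↔ (F.mapH ⊥).EssSurj := by
  constructor
  · refine fun h => ⟨fun ⟨Y⟩ => ?_⟩
    obtain ⟨X, hX⟩ := h Y
    exact ⟨⟨X⟩, nonempty_iso_iff.2 hX⟩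
  · intro h Y
    obtain ⟨⟨X⟩, hX⟩ := h.mem_essImage ⟨Y⟩
    exact ⟨X, nonempty_iso_iff.1 hX⟩

theorem mapH_isEquivalence (S : AddSubmonoid ℤ) {F : DGFunctor C D} (h : F.QuasiFullyFaithful)
    (h' : F.QuasiEssSurj) : (F.mapH S).IsEquivalence where
  faithful := ⟨fun {X Y} _ _ e => (DGFunctor.mapH_bijective (h X.obj Y.obj)).1 e⟩
  full := ⟨fun {X Y} => (DGFunctor.mapH_bijective (h X.obj Y.obj)).2⟩
  essSurj := ⟨fun ⟨Y⟩ => by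
    obtain ⟨X, hX⟩ := h' Y
    exact ⟨⟨X⟩, nonempty_iso_of_homotopyEquivalent hX⟩⟩

theorem quasiEquivalence_of_isEquivalence {F : DGFunctor C D} (h : (F.mapH ⊤).IsEquivalence)
    (h' : (F.mapH ⊥).IsEquivalence) : F.QuasiFullyFaithful ∧ F.QuasiEssSurj :=
  ⟨(quasiFullyFaithful_iff F).2 fun _ _ =>
    ⟨(F.mapH ⊤).map_injective, (F.mapH ⊤).map_surjective⟩, (quasiEssSurj_iff F).2 inferInstance⟩

end HCat

end DGCat

/-! ### Retracts and split idempotents in ordinary categories. -/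

namespace CategoryTheory

variable {A B : Type*} [Category* A] [Category* B]

/-- A functor is fully faithful if it is so on objects of which all others are retracts. -/
theorem Functor.bijective_map_of_retracts (F : A ⥤ B) (P : A → Prop)
    (hP : ∀ X Y, P X → P Y → Function.Bijective (F.map (X := X) (Y := Y)))
    (hA : ∀ X, ∃ Y, P Y ∧ Nonempty (Retract X Y)) (X Y : A) :
    Function.Bijective (F.map (X := X) (Y := Y)) := by
  obtain ⟨X', hX', ⟨r⟩⟩ := hA X
  obtain ⟨Y', hY', ⟨s⟩⟩ := hA Y
  constructor
  · intro f g h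
    -- Conjugation by the retractions extends `f` and `g` to maps `X' ⟶ Y'`, where the hypothesis
    -- applies, and restricts the result back.
    have : r.r ≫ f ≫ s.i = r.r ≫ g ≫ s.i := (hP _ _ hX' hY').1 (by simp [h])
    have := congrArg (fun φ => r.i ≫ φ ≫ s.r) this
    simpa using this
  · intro g
    obtain ⟨f, hf⟩ := (hP _ _ hX' hY').2 (F.map r.r ≫ g ≫ F.map s.i)
    refine ⟨r.i ≫ f ≫ s.r, ?_⟩
    rw [F.map_comp, F.map_comp, hf]
    simp only [Category.assoc, ← F.map_comp, s.retract, F.map_id, Category.comp_id]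
    rw [← Category.assoc, ← F.map_comp, r.retract, F.map_id, Category.id_comp]

/-- Two splittings of one idempotent are compared through the ambient object `X`. -/
theorem isoOfSplit {X Y Y' : A} {i : Y ⟶ X} {p : X ⟶ Y} {i' : Y' ⟶ X} {p' : X ⟶ Y'}
    (h : i ≫ p = 𝟙 Y) (h' : i' ≫ p' = 𝟙 Y') (e : p ≫ i = p' ≫ i') : Nonempty (Y ≅ Y') := by
  refine ⟨⟨i ≫ p', i' ≫ p, ?_, ?_⟩⟩
  · rw [Category.assoc, ← Category.assoc p', ← e, Category.assoc, h, Category.comp_id, h]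
  · rw [Category.assoc, ← Category.assoc p, e, Category.assoc, h', Category.comp_id, h']

/-- A fully faithful functor from an idempotent complete category is essentially surjective if
all objects are retracts of objects in the image. -/
theorem Functor.essSurj_of_retracts (F : A ⥤ B) [F.Full] [F.Faithful] [IsIdempotentComplete A]
    (hB : ∀ Y, ∃ X, Nonempty (Retract Y (F.obj X))) : F.EssSurj := by
  refine ⟨fun Y => ?_⟩
  obtain ⟨X, ⟨r⟩⟩ := hB Y
  -- The idempotent on `F.obj X` that cuts out `Y` lifts to `A` and splits there; `F` maps this
  -- splitting to a second splitting of the same idempotent.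
  obtain ⟨e, he⟩ := F.map_surjective (r.r ≫ r.i)
  obtain ⟨X', i, p, h₁, h₂⟩ := IsIdempotentComplete.idempotents_split X e
    (F.map_injective (by rw [F.map_comp, he, Category.assoc, r.retract_assoc]))
  exact ⟨X', isoOfSplit (i := F.map i) (p := F.map p) (by rw [← F.map_comp, h₁, F.map_id])
    r.retract (by rw [← F.map_comp, h₂, he])⟩

/-- A category is idempotent complete if the idempotents split on objects of which all others
are retracts. -/
theorem isIdempotentComplete_of_retracts (P : A → Prop)
    (hP : ∀ X, P X → ∀ p : X ⟶ X, p ≫ p = p →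
      ∃ (Y : A) (i : Y ⟶ X) (e : X ⟶ Y), i ≫ e = 𝟙 Y ∧ e ≫ i = p)
    (hA : ∀ X, ∃ Y, P Y ∧ Nonempty (Retract X Y)) : IsIdempotentComplete A := by
  refine ⟨fun X p hp => ?_⟩
  obtain ⟨X', hX', ⟨r⟩⟩ := hA X
  -- The idempotent `p` of the retract `X` is extended to `X'` and split there.
  obtain ⟨Y, i, e, h₁, h₂⟩ := hP X' hX' (r.r ≫ p ≫ r.i) (by simp [reassoc_of% hp])
  refine ⟨Y, i ≫ r.r, r.i ≫ e, ?_, ?_⟩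
  · have : i ≫ r.r ≫ r.i = i := by
      have : i = i ≫ e ≫ i := by rw [← Category.assoc, h₁, Category.id_comp]
      rw [this, h₂]; simp
    rw [Category.assoc, ← Category.assoc r.r, ← Category.assoc, this, h₁]
  · rw [Category.assoc, ← Category.assoc e, h₂]; simp

end CategoryTheory

namespace DGCat

variable {k : Type w} [CommRing k]

/-! ### Idempotent completeness of the Karoubi envelope -/

section Kar

variable {C D : DGCat.{w, u} k}

theorem IsImage.homotopyEquivalent {X Y Y' : C.Obj} {e : C.Hom X X 0} (h : C.IsImage e Y)
    (h' : C.IsImage e Y') : C.HomotopyEquivalent Y Y' := by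
  obtain ⟨σ, π, hσ, hπ, h₁, h₂⟩ := h
  obtain ⟨σ', π', hσ', hπ', h₁', h₂'⟩ := h'
  refine nonempty_iso_iff.1 (isoOfSplit (i := hmk (AddSubmonoid.zero_mem _) σ hσ)
    (p := hmk (AddSubmonoid.zero_mem _) π hπ) (i' := hmk (AddSubmonoid.zero_mem _) σ' hσ')
    (p' := hmk (AddSubmonoid.zero_mem _) π' hπ') ?_ ?_ ?_)
  · rwa [hmk_comp₀, ← hmk_id, hmk_eq_iff]
  · rwa [hmk_comp₀, ← hmk_id, hmk_eq_iff]
  · rw [hmk_comp₀, hmk_comp₀, hmk_eq_iff]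
    rw [homotopic_iff_sub_mem] at *
    rw [← sub_sub_sub_cancel_right _ _ e]
    exact sub_mem h₂ h₂'

theorem IsImage.isHomotopyRetract {X Y : C.Obj} {e : C.Hom X X 0} (h : C.IsImage e Y) :
    C.IsHomotopyRetract Y X := by
  obtain ⟨σ, π, hσ, hπ, h₁, -⟩ := h
  exact ⟨σ, π, hσ, hπ, h₁⟩

theorem IsHomotopyRetract.trans {X Y Z : C.Obj} (h : C.IsHomotopyRetract X Y)
    (h' : C.IsHomotopyRetract Y Z) : C.IsHomotopyRetract X Z := by
  rw [← nonempty_retract_iff] at *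
  obtain ⟨r⟩ := h
  obtain ⟨r'⟩ := h'
  exact ⟨r.trans r'⟩

theorem HomotopyEquivalent.isHomotopyRetract {X Y : C.Obj} (h : C.HomotopyEquivalent X Y) :
    C.IsHomotopyRetract X Y := by
  obtain ⟨f, g, hf, hg, h₁, -⟩ := h
  exact ⟨f, g, hf, hg, h₁⟩

theorem DGFunctor.map_isHomotopyRetract (F : DGFunctor C D) {X Y : C.Obj}
    (h : C.IsHomotopyRetract X Y) : D.IsHomotopyRetract (F.obj X) (F.obj Y) := by
  obtain ⟨σ, π, hσ, hπ, h⟩ := h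
  refine ⟨F.map 0 σ, F.map 0 π, F.map_isClosed hσ, F.map_isClosed hπ, ?_⟩
  rw [← F.map_comp₀, ← F.map_id]
  exact F.map_homotopic h

/-- The objects of the Karoubi envelope are the homotopy retracts of objects of `C`. -/
theorem exists_homotopyEquivalent_Z_iff (T : (Tw (SigmaPi C)).Obj) :
    (∃ A : AInfIdempotent C, (Tw (SigmaPi C)).HomotopyEquivalent T A.Z) ↔
      ∃ X, (Tw (SigmaPi C)).IsHomotopyRetract T (twSingle X) := by
  constructor
  · rintro ⟨A, hA⟩
    exact ⟨A.X, hA.isHomotopyRetract.trans A.isImage_Z.isHomotopyRetract⟩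
  · rintro ⟨X, σ, π, hσ, hπ, h⟩
    obtain ⟨A, rfl, hA⟩ := exists_aInfIdempotent (toTw C) X (toTw_bijective X X) σ π hσ hπ h
    -- Both `T` and `A.Z` are images of `A.e 0`, which the embedding sends to `σ π` on the nose.
    refine ⟨A, IsImage.homotopyEquivalent (e := (toTw C).map 0 (C.castDeg (by simp) (A.e 0)))
      ⟨σ, π, hσ, hπ, h, ?_⟩ A.isImage_Z⟩
    exact hA ▸ Homotopic.refl _

theorem exists_isHomotopyRetract_toKar (T : C.Kar.Obj) :
    ∃ X, C.Kar.IsHomotopyRetract T ((toKar C).obj X) :=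
  (exists_homotopyEquivalent_Z_iff T.1).1 T.2

theorem toKar_bijective (X Y : C.Obj) (n : ℤ) :
    Function.Bijective (DGFunctor.map (toKar C) (X := X) (Y := Y) n) := toTw_bijective X Y n

theorem toKar_isFullEmbedding (C : DGCat.{w, u} k) : DGFunctor.IsFullEmbedding (toKar C) := by
  refine ⟨fun X Y h => ?_, toKar_bijective⟩
  have h1 : single X = single Y := congrArg (fun T : C.Kar.Obj => T.1.X) h
  have h2 := (SigmaObj.mk.inj h1).2.1
  exact congrFun (eq_of_heq h2) ⟨0, rfl⟩

/-- The telescope is not itself of the form `Z(X, e, h)`, but it is a homotopy retract of `X`, and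
this is enough to lie in the envelope. -/
theorem exists_isImage_toKar {X : C.Obj} {e : C.Hom X X 0} (he : C.IsHomotopyIdempotent e) :
    ∃ T, C.Kar.IsImage (DGFunctor.map (toKar C) 0 e) T := by
  obtain ⟨T, hT⟩ := exists_isImage_toTw he
  exact ⟨⟨T, (exists_homotopyEquivalent_Z_iff T).2 ⟨X, hT.isHomotopyRetract⟩⟩, hT⟩

/-- On an object of `C` a homotopy idempotent of the envelope comes from `C`, by full faithfulness,
and is split by the telescope. All other objects are retracts of these in `H⁰`, and splitting passes
to retracts. -/
theorem homotopyIdempotentComplete_kar (C : DGCat.{w, u} k) :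
    C.Kar.HomotopyIdempotentComplete := by
  rw [homotopyIdempotentComplete_iff]
  refine isIdempotentComplete_of_retracts (fun T => ∃ X, T = ⟨(toKar C).obj X⟩) ?_ ?_
  · rintro _ ⟨X, rfl⟩ p hp
    obtain ⟨e', he', rfl⟩ := exists_hmk₀ p
    obtain ⟨e, rfl⟩ := (toKar_bijective X X 0).2 e'
    rw [hmk_comp₀, hmk_eq_iff] at hp
    have he : C.IsHomotopyIdempotent e := by
      refine ⟨(toKar_bijective _ _ _).1 ?_, ?_⟩
      · rw [DGFunctor.map_d, map_zero]; exact he'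
      · obtain ⟨h, hh⟩ := hp
        obtain ⟨h, rfl⟩ := (toKar_bijective _ _ _).2 h
        refine ⟨h, (toKar_bijective _ _ _).1 ?_⟩
        rw [DGFunctor.map_d, hh, map_sub, DGFunctor.map_comp₀]
    obtain ⟨T, σ, π, hσ, hπ, h₁, h₂⟩ := exists_isImage_toKar he
    exact ⟨⟨T⟩, hmk (AddSubmonoid.zero_mem _) σ hσ, hmk (AddSubmonoid.zero_mem _) π hπ,
      by rwa [hmk_comp₀, ← hmk_id, hmk_eq_iff], by rwa [hmk_comp₀, hmk_eq_iff]⟩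
  · rintro ⟨T⟩
    obtain ⟨X, hX⟩ := exists_isHomotopyRetract_toKar T
    exact ⟨_, ⟨X, rfl⟩, hX.nonempty_retract⟩

/-- A quasi-fully faithful dg functor from a complete dg category is a quasi-equivalence if all
objects are homotopy retracts of objects in the image. -/
theorem quasiEssSurj_of_retracts {F : DGFunctor C D} (hF : F.QuasiFullyFaithful)
    (hC : C.HomotopyIdempotentComplete)
    (hD : ∀ Y, ∃ X, D.IsHomotopyRetract Y (F.obj X)) : F.QuasiEssSurj := by
  rw [quasiEssSurj_iff]
  have := homotopyIdempotentComplete_iff.1 hC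
  have : (F.mapH ⊥).Full := ⟨fun {X Y} => (DGFunctor.mapH_bijective (hF X.obj Y.obj)).2⟩
  have : (F.mapH ⊥).Faithful := ⟨fun {X Y} _ _ e => (DGFunctor.mapH_bijective (hF X.obj Y.obj)).1 e⟩
  refine (F.mapH ⊥).essSurj_of_retracts (fun ⟨Y⟩ => ?_)
  obtain ⟨X, hX⟩ := hD Y
  exact ⟨⟨X⟩, hX.nonempty_retract⟩

theorem toKar_quasiFullyFaithful (C : DGCat.{w, u} k) :
    DGFunctor.QuasiFullyFaithful (toKar C) :=
  fun X Y => DGFunctor.mapCohomology_bijective_of_bijective (toKar_bijective X Y)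

/-- Completeness can be transported along quasi-equivalences. -/
theorem homotopyIdempotentComplete_iff_of_equivalence
    (h : Nonempty (HCat ⊥ C ≌ HCat ⊥ D)) :
    C.HomotopyIdempotentComplete ↔ D.HomotopyIdempotentComplete := by
  obtain ⟨h⟩ := h
  rw [homotopyIdempotentComplete_iff, homotopyIdempotentComplete_iff]
  exact Idempotents.isIdempotentComplete_iff_of_equivalence h

/-- If `C` is complete, the idempotent of `H⁰(C)` cutting out an object of the envelope already
splits in `C`. Conversely, completeness passes back along the equivalence on `H⁰`. -/
theorem quasiEquivalences_toKar_iff :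
    quasiEquivalences k (toKar C) ↔ C.HomotopyIdempotentComplete := by
  constructor
  · intro h
    have := mapH_isEquivalence ⊥ h.1 h.2
    exact (homotopyIdempotentComplete_iff_of_equivalence
      ⟨(DGFunctor.mapH ⊥ (toKar C)).asEquivalence⟩).2 (homotopyIdempotentComplete_kar C)
  · intro h
    exact ⟨toKar_quasiFullyFaithful C, quasiEssSurj_of_retracts (toKar_quasiFullyFaithful C) h
      exists_isHomotopyRetract_toKar⟩

end Kar

end DGCat

namespace DGCat

variable {k : Type w} [CommRing k]

/-! ### Functoriality of the Karoubi envelope -/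

section Functoriality

variable {C D : DGCat.{w, u} k}

theorem DGFunctor.map_castDeg (F : DGFunctor C D) {X Y : C.Obj} {n m : ℤ} (h : n = m)
    (f : C.Hom X Y n) : F.map m (C.castDeg h f) = D.castDeg h (F.map n f) := by
  subst h; rfl

/-- The action of a dg functor on formal products. -/
abbrev DGFunctor.sigmaObj (F : DGFunctor C D) (x : SigmaObj C) : SigmaObj D where
  I := x.I
  X i := F.obj (x.X i)
  a := x.a

/-- The action of a dg functor on matrices. -/
def DGFunctor.sigmaMap (F : DGFunctor C D) {x y : SigmaObj C} (n : ℤ) :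
    sigmaHom x y n →ₗ[k] sigmaHom (F.sigmaObj x) (F.sigmaObj y) n where
  toFun f := ⟨fun j i => F.map _ (f.1 j i), fun j => (f.2 j).subset fun i hi h => hi (by
    beta_reduce
    rw [h, map_zero])⟩
  map_add' f g := by ext j i; exact map_add (F.map _) (f.1 j i) (g.1 j i)
  map_smul' c f := by ext j i; exact map_smul (F.map _) c (f.1 j i)

/-- The dg functor on additive envelopes induced by a dg functor. -/
noncomputable def DGFunctor.mapSigmaPi (F : DGFunctor C D) :
    DGFunctor (SigmaPi C) (SigmaPi D) where
  obj := F.sigmaObj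
  map n := F.sigmaMap n
  map_d {x y n m} h f := by
    refine sigmaHom_ext (fun j i => ?_)
    change F.map _ (((y.a j).negOnePow : ℤ) • C.d _ _ _ (f.1 j i)) =
      ((y.a j).negOnePow : ℤ) • D.d _ _ _ (F.map _ (f.1 j i))
    rw [map_zsmul, F.map_d]
  map_id x := by
    refine sigmaHom_ext (fun j i => ?_)
    change F.map _ ((sigmaId x).1 j i) = _
    by_cases h : i = j
    · subst h
      rw [sigmaId_self, sigmaId_self, F.map_castDeg, F.map_id]
    · rw [sigmaId_of_ne x h, map_zero]
      exact (sigmaId_of_ne (F.sigmaObj x) h).symm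
  map_comp {x y z q p n} h g f := by
    refine sigmaHom_ext (fun l i => ?_)
    obtain ⟨s, hs⟩ := exists_row g l
    change F.map _ (sigmaCompEntry h g f l i) =
      sigmaCompEntry h (F.sigmaMap q g) (F.sigmaMap p f) l i
    rw [sigmaCompEntry_eq_sum_row h g f l i s hs,
      sigmaCompEntry_eq_sum_row h (F.sigmaMap q g) _ l i s (fun j hj => by
        change F.map _ (g.1 l j) = 0
        rw [hs j hj, map_zero]), map_sum]
    exact Finset.sum_congr rfl (fun j _ => F.map_comp _ _ _)

theorem DGFunctor.map_maurerCartan (F : DGFunctor C D) {X : C.Obj} (α : C.Hom X X 1)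
    (h : C.d 1 2 rfl α + C.comp (show (1 : ℤ) + 1 = 2 from rfl) α α = 0) :
    D.d 1 2 rfl (F.map 1 α) +
      D.comp (show (1 : ℤ) + 1 = 2 from rfl) (F.map 1 α) (F.map 1 α) = 0 := by
  have h1 := F.map_d (show (1 : ℤ) + 1 = 2 from rfl) α
  have h2 := F.map_comp (show (1 : ℤ) + 1 = 2 from rfl) α α
  rw [← h1, ← h2, ← (F.map 2).map_add, h, (F.map 2).map_zero]

/-- The dg functor on twisted envelopes induced by a dg functor. -/
def DGFunctor.mapTw (F : DGFunctor C D) : DGFunctor (Tw C) (Tw D) where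
  obj T :=
    { X := F.obj T.X
      α := F.map 1 T.α
      maurerCartan := F.map_maurerCartan T.α T.maurerCartan }
  map n := F.map n
  map_d {T S n m} h f := by
    change F.map m (twD T S n m h f) = _
    rw [twD_apply, map_sub, map_add, map_zsmul, F.map_d, F.map_comp, F.map_comp]
    rfl
  map_id T := F.map_id T.X
  map_comp h g f := F.map_comp h g f

/-- The restriction of a dg functor to full dg subcategories. -/
def DGFunctor.restrict (F : DGFunctor C D) (P : C.Obj → Prop) (Q : D.Obj → Prop)
    (h : ∀ X, P X → Q (F.obj X)) : DGFunctor (C.FullSub P) (D.FullSub Q) where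
  obj X := ⟨F.obj X.1, h X.1 X.2⟩
  map n := F.map n
  map_d h f := F.map_d h f
  map_id X := F.map_id X.1
  map_comp h g f := F.map_comp h g f

/-- Not a definitional equality: the twist on the left is the image of `0`. -/
theorem DGFunctor.mapTw_twSingle (F : DGFunctor C D) (X : C.Obj) :
    F.mapSigmaPi.mapTw.obj (twSingle X) = twSingle (F.obj X) := by
  have h : F.mapSigmaPi.map 1 (0 : sigmaHom (single X) (single X) 1) =
    (0 : sigmaHom (single (F.obj X)) (single (F.obj X)) 1) := map_zero _
  change TwObj.mk (C := SigmaPi D) (single (F.obj X))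
    (F.mapSigmaPi.map 1 (0 : sigmaHom (single X) (single X) 1)) _ = _
  congr 1

/-- Being a homotopy retract of an object of `C` is preserved by every dg functor, so the image of
`Z(X, e, h)` need not be computed. -/
theorem DGFunctor.mapTw_mem (F : DGFunctor C D) (T : (Tw (SigmaPi C)).Obj)
    (hT : ∃ A : AInfIdempotent C, (Tw (SigmaPi C)).HomotopyEquivalent T A.Z) :
    ∃ A : AInfIdempotent D,
      (Tw (SigmaPi D)).HomotopyEquivalent (F.mapSigmaPi.mapTw.obj T) A.Z := by
  rw [exists_homotopyEquivalent_Z_iff] at hT ⊢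
  obtain ⟨X, hX⟩ := hT
  refine ⟨F.obj X, ?_⟩
  rw [← F.mapTw_twSingle]
  exact F.mapSigmaPi.mapTw.map_isHomotopyRetract hX

/-- The dg functor on Karoubi envelopes induced by a dg functor. -/
noncomputable def DGFunctor.mapKar (F : DGFunctor C D) : DGFunctor C.Kar D.Kar :=
  F.mapSigmaPi.mapTw.restrict _ _ F.mapTw_mem

variable (k) in
/-- The Karoubi envelope as an endofunctor of `dgcat`. -/
noncomputable def kar : DGCat.{w, u} k ⥤ DGCat.{w, u} k where
  obj C := C.Kar
  map F := DGFunctor.mapKar F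
  map_id _ := rfl
  map_comp _ _ := rfl

/-- Two dg functors to a twisted envelope that agree on underlying objects, on twists and on
morphisms are equal. -/
theorem twFunctor_ext {P : (Tw D).Obj → Prop} {o : C.Obj → D.Obj}
    {α α' : ∀ X, D.Hom (o X) (o X) 1} (hα : α = α')
    (mc : ∀ X, D.d 1 2 rfl (α X) + D.comp (show (1 : ℤ) + 1 = 2 from rfl) (α X) (α X) = 0)
    (mc' : ∀ X, D.d 1 2 rfl (α' X) + D.comp (show (1 : ℤ) + 1 = 2 from rfl) (α' X) (α' X) = 0)
    (hP : ∀ X, P ⟨o X, α X, mc X⟩) (hP' : ∀ X, P ⟨o X, α' X, mc' X⟩)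
    {m m' : ∀ (X Y : C.Obj) (n : ℤ), C.Hom X Y n →ₗ[k] D.Hom (o X) (o Y) n} (hm : m = m')
    (h₁ h₂ h₃ h₁' h₂' h₃') :
    (⟨fun X => ⟨⟨o X, α X, mc X⟩, hP X⟩, fun {X Y} => m X Y, h₁, h₂, h₃⟩ :
      DGFunctor C ((Tw D).FullSub P)) =
    ⟨fun X => ⟨⟨o X, α' X, mc' X⟩, hP' X⟩, fun {X Y} => m' X Y, h₁', h₂', h₃'⟩ := by
  subst hα hm
  rfl

/-- The square commutes strictly, but its two composites carry the twists `F(0)` and `0`. Morphisms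
in `Tw` do not depend on the twists, so `twFunctor_ext` can compare the two without transport. -/
theorem toKar_mapKar (F : C ⟶ D) : toKar C ≫ DGFunctor.mapKar F = F ≫ toKar D := by
  refine twFunctor_ext (C := C) (D := SigmaPi D) (o := fun X => single (DGFunctor.obj F X))
    (α := fun X => DGFunctor.sigmaMap F 1 (0 : sigmaHom (single X) (single X) 1))
    (α' := fun X => (0 : sigmaHom (single _) (single _) 1))
    (funext fun X => map_zero _) _ _ _ _
    (m := fun X Y n => (DGFunctor.sigmaMap F n).comp (singleMap n))
    (m' := fun X Y n => (singleMap n).comp (DGFunctor.map F n)) ?_ _ _ _ _ _ _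
  funext X Y n
  refine LinearMap.ext (fun f => sigmaHom_ext (fun j i => ?_))
  exact DGFunctor.map_castDeg F _ f

variable (k) in
/-- The embeddings in Karoubi envelopes, as a natural transformation. -/
noncomputable def toKarNatTrans : 𝟭 (DGCat.{w, u} k) ⟶ kar k where
  app C := toKar C
  naturality _ _ F := (toKar_mapKar F).symm

theorem mapCohomology_comp {E : DGCat.{w, u} k} (F : C ⟶ D) (G : D ⟶ E) (X Y : C.Obj) (n : ℤ) :
    ⇑(DGFunctor.mapCohomology (F ≫ G) X Y n) =
      DGFunctor.mapCohomology G _ _ n ∘ DGFunctor.mapCohomology F X Y n := by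
  funext a
  obtain ⟨a, rfl⟩ := Submodule.Quotient.mk_surjective _ a
  rfl

theorem DGFunctor.QuasiFullyFaithful.comp {E : DGCat.{w, u} k} {F : C ⟶ D} {G : D ⟶ E}
    (hF : DGFunctor.QuasiFullyFaithful F) (hG : DGFunctor.QuasiFullyFaithful G) :
    DGFunctor.QuasiFullyFaithful (F ≫ G) := fun X Y n => by
  rw [mapCohomology_comp]
  exact (hG _ _ n).comp (hF X Y n)

/-- On objects of `C` the claim follows by cancellation in the square of `toKar_mapKar`; retracts
give the remaining objects. -/
theorem mapKar_quasiFullyFaithful {F : C ⟶ D} (hF : DGFunctor.QuasiFullyFaithful F) :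
    DGFunctor.QuasiFullyFaithful (DGFunctor.mapKar F) := by
  rw [quasiFullyFaithful_iff]
  refine Functor.bijective_map_of_retracts _ (fun T => ∃ X, T = ⟨(toKar C).obj X⟩) ?_ ?_
  · rintro _ _ ⟨X, rfl⟩ ⟨Y, rfl⟩
    refine DGFunctor.mapH_bijective (fun n => ?_)
    have h := hF.comp (toKar_quasiFullyFaithful D)
    rw [← toKar_mapKar] at h
    have h' := h X Y n
    rw [mapCohomology_comp] at h'
    exact (Function.Bijective.of_comp_iff _ (toKar_quasiFullyFaithful C X Y n)).1 h'
  · rintro ⟨T⟩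
    obtain ⟨X, hX⟩ := exists_isHomotopyRetract_toKar T
    exact ⟨_, ⟨X, rfl⟩, hX.nonempty_retract⟩

/-- The Karoubi envelope turns a quasi-fully faithful dg functor such that all objects are
homotopy retracts of objects in the image into a quasi-equivalence. -/
theorem quasiEquivalences_mapKar {F : C ⟶ D} (hF : DGFunctor.QuasiFullyFaithful F)
    (hD : ∀ Y, ∃ X, D.IsHomotopyRetract Y (DGFunctor.obj F X)) :
    quasiEquivalences k ((kar k).map F) := by
  refine ⟨mapKar_quasiFullyFaithful hF, quasiEssSurj_of_retracts (mapKar_quasiFullyFaithful hF)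
    (homotopyIdempotentComplete_kar C) (fun T => ?_)⟩
  obtain ⟨Y, hY⟩ := exists_isHomotopyRetract_toKar T
  obtain ⟨X, hX⟩ := hD Y
  have h := hY.trans (DGFunctor.map_isHomotopyRetract (toKar D) hX)
  have e : DGFunctor.obj (toKar D) (DGFunctor.obj F X) =
      DGFunctor.obj (DGFunctor.mapKar F) (DGFunctor.obj (toKar C) X) :=
    congrArg (fun G : C ⟶ D.Kar => DGFunctor.obj G X) (toKar_mapKar F).symm
  exact ⟨_, e ▸ h⟩

theorem quasiEquivalences_mapKar_of_quasiEquivalences {F : C ⟶ D} (hF : quasiEquivalences k F) :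
    quasiEquivalences k ((kar k).map F) := by
  refine quasiEquivalences_mapKar hF.1 (fun Y => ?_)
  obtain ⟨X, f, g, hf, hg, h₁, h₂⟩ := hF.2 Y
  exact ⟨X, g, f, hg, hf, h₂⟩

/-- The idempotence of the construction in the form needed for uniqueness: it is `Kar` applied to
the embedding that is inverted here, not the embedding of `Kar C`. -/
theorem quasiEquivalences_mapKar_toKar (C : DGCat.{w, u} k) :
    quasiEquivalences k ((kar k).map (toKar C)) :=
  quasiEquivalences_mapKar (toKar_quasiFullyFaithful C) exists_isHomotopyRetract_toKar

end Functoriality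

end DGCat

/-! ### Small categories modulo natural isomorphism, where the isomorphisms are the equivalences. -/

namespace CategoryTheory

/-- The relation on functors of being naturally isomorphic. -/
def natIsoRel : HomRel Cat.{u, u} := fun _ _ F G => Nonempty (F.toFunctor ≅ G.toFunctor)

instance : Congruence natIsoRel.{u} where
  comp_left f _ _ := fun ⟨e⟩ => ⟨Functor.isoWhiskerLeft f.toFunctor e⟩
  comp_right g := fun ⟨e⟩ => ⟨Functor.isoWhiskerRight e g.toFunctor⟩
  equivalence := ⟨fun _ => ⟨Iso.refl _⟩, fun ⟨e⟩ => ⟨e.symm⟩, fun ⟨e⟩ ⟨e'⟩ => ⟨e.trans e'⟩⟩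

/-- Lifts of the two inverse morphisms are functors whose composites are naturally isomorphic to
identities. -/
theorem exists_isEquivalence_of_iso {A B : Cat.{u, u}}
    (φ : (Quotient.functor natIsoRel).obj A ≅ (Quotient.functor natIsoRel).obj B) :
    ∃ F : A ⟶ B, (Quotient.functor natIsoRel).map F = φ.hom ∧ F.toFunctor.IsEquivalence := by
  obtain ⟨F, hF⟩ := (Quotient.functor natIsoRel).map_surjective φ.hom
  obtain ⟨G, hG⟩ := (Quotient.functor natIsoRel).map_surjective φ.inv
  have h₁ := φ.hom_inv_id
  have h₂ := φ.inv_hom_id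
  rw [← hF, ← hG, ← Functor.map_comp, ← Functor.map_id, Quotient.functor_map_eq_iff] at h₁ h₂
  obtain ⟨e₁⟩ := h₁
  obtain ⟨e₂⟩ := h₂
  exact ⟨F, hF, (CategoryTheory.Equivalence.mk F.toFunctor G.toFunctor e₁.symm e₂).isEquivalence_functor⟩

theorem isEquivalence_of_isIso {A B : Cat.{u, u}} (F : A ⟶ B)
    [IsIso ((Quotient.functor natIsoRel).map F)] : F.toFunctor.IsEquivalence := by
  obtain ⟨G, hG, h⟩ := exists_isEquivalence_of_iso (asIso ((Quotient.functor natIsoRel).map F))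
  obtain ⟨e⟩ := (Quotient.functor_map_eq_iff natIsoRel _ _).1 hG
  exact Functor.isEquivalence_of_iso e

theorem isIso_of_isEquivalence {A B : Cat.{u, u}} (F : A ⟶ B) (h : F.toFunctor.IsEquivalence) :
    IsIso ((Quotient.functor natIsoRel).map F) := by
  let G : B ⟶ A := F.toFunctor.inv.toCatHom
  refine ⟨(Quotient.functor natIsoRel).map G, ?_, ?_⟩
  · exact ((Quotient.functor natIsoRel).map_comp F G).symm.trans
      (((Quotient.functor_map_eq_iff natIsoRel (F ≫ G) (𝟙 A)).2
        ⟨F.toFunctor.asEquivalence.unitIso.symm⟩).trans ((Quotient.functor natIsoRel).map_id A))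
  · exact ((Quotient.functor natIsoRel).map_comp G F).symm.trans
      (((Quotient.functor_map_eq_iff natIsoRel (G ≫ F) (𝟙 B)).2
        ⟨F.toFunctor.asEquivalence.counitIso⟩).trans ((Quotient.functor natIsoRel).map_id B))

end CategoryTheory

namespace DGCat

variable {k : Type w} [CommRing k]

/-! ### Isomorphisms in the localization -/

section Saturation

variable {C D : DGCat.{w, u} k}

variable (k) in
/-- The cohomology category of a dg category, up to equivalence. -/
noncomputable def cohomologyFunctor (S : AddSubmonoid ℤ) :
    DGCat.{w, u} k ⥤ Quotient natIsoRel.{u} where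
  obj C := (Quotient.functor natIsoRel).obj (Cat.of (HCat S C))
  map F := (Quotient.functor natIsoRel).map (DGFunctor.mapH S F).toCatHom
  map_id C := by
    rw [← (Quotient.functor natIsoRel).map_id, Quotient.functor_map_eq_iff]
    refine ⟨NatIso.ofComponents (fun X => Iso.refl _) ?_⟩
    intro X Y φ
    obtain ⟨p, hp, f, hf, rfl⟩ := exists_cls φ
    exact (Category.comp_id _).trans (Category.id_comp _).symm
  map_comp F G := by
    rw [← Functor.map_comp, Quotient.functor_map_eq_iff]
    refine ⟨NatIso.ofComponents (fun X => Iso.refl _) ?_⟩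
    intro X Y φ
    obtain ⟨p, hp, f, hf, rfl⟩ := exists_cls φ
    exact (Category.comp_id _).trans (Category.id_comp _).symm

theorem cohomologyFunctor_isInvertedBy (S : AddSubmonoid ℤ) :
    (quasiEquivalences.{w, u} k).IsInvertedBy (cohomologyFunctor k S) :=
  fun _ _ F hF => isIso_of_isEquivalence (DGFunctor.mapH S F).toCatHom
    (mapH_isEquivalence S hF.1 hF.2)

/-- The cohomology category of an object of `Hqe`, up to equivalence. -/
noncomputable def hqeCohomology (S : AddSubmonoid ℤ) : Hqe.{w, u} k ⥤ Quotient natIsoRel.{u} :=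
  Localization.lift (cohomologyFunctor k S) (cohomologyFunctor_isInvertedBy S) (toHqe k)

/-- The comparison of the cohomology functors on `dgcat` and on `Hqe`. -/
noncomputable def hqeCohomologyIso (S : AddSubmonoid ℤ) :
    toHqe.{w, u} k ⋙ hqeCohomology S ≅ cohomologyFunctor k S :=
  Localization.fac _ (cohomologyFunctor_isInvertedBy S) (toHqe k)

/-- A dg functor that becomes invertible in `Hqe` is a quasi-equivalence. -/
theorem quasiEquivalences_of_isIso (F : C ⟶ D) [IsIso ((toHqe k).map F)] :
    quasiEquivalences k F := by
  -- The cohomology functors factor through `Hqe`, so they send `F` to isomorphisms in the quotient,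
  -- that is, to equivalences of categories. The cases `⊤` and `⊥` together give a
  -- quasi-equivalence.
  have h : ∀ S, (DGFunctor.mapH S F).IsEquivalence := fun S => by
    have : IsIso ((toHqe k ⋙ hqeCohomology S).map F) :=
      inferInstanceAs (IsIso ((hqeCohomology S).map ((toHqe k).map F)))
    have : IsIso ((cohomologyFunctor k S).map F) :=
      (NatIso.isIso_map_iff (hqeCohomologyIso S) F).1 this
    exact @isEquivalence_of_isIso _ _ (DGFunctor.mapH S F).toCatHom this
  exact quasiEquivalence_of_isEquivalence (h ⊤) (h ⊥)

/-- Homotopy idempotent completeness is invariant under isomorphism in `Hqe`. -/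
theorem homotopyIdempotentComplete_iff_of_iso (φ : (toHqe k).obj C ≅ (toHqe k).obj D) :
    C.HomotopyIdempotentComplete ↔ D.HomotopyIdempotentComplete := by
  let ψ : (cohomologyFunctor k ⊥).obj C ≅ (cohomologyFunctor k ⊥).obj D :=
    ((hqeCohomologyIso ⊥).app C).symm ≪≫ (hqeCohomology ⊥).mapIso φ ≪≫
      (hqeCohomologyIso ⊥).app D
  obtain ⟨F, -, hF⟩ := exists_isEquivalence_of_iso ψ
  exact homotopyIdempotentComplete_iff_of_equivalence ⟨F.toFunctor.asEquivalence⟩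

end Saturation

/-! ### The Karoubi envelope on the localization -/

section Universal

variable {C D K : DGCat.{w, u} k}

theorem isIso_toHqe_map {F : C ⟶ D} (hF : quasiEquivalences k F) : IsIso ((toHqe k).map F) :=
  Localization.inverts (toHqe k) (quasiEquivalences k) F hF

theorem kar_isInvertedBy :
    (quasiEquivalences.{w, u} k).IsInvertedBy (kar k ⋙ toHqe k) :=
  fun _ _ _ hF => isIso_toHqe_map (quasiEquivalences_mapKar_of_quasiEquivalences hF)

variable (k) in
/-- The Karoubi envelope as an endofunctor of `Hqe`. -/
noncomputable def hqeKar : Hqe.{w, u} k ⥤ Hqe.{w, u} k :=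
  Localization.lift (kar k ⋙ toHqe k) kar_isInvertedBy (toHqe k)

variable (k) in
/-- The comparison of the Karoubi envelopes on `dgcat` and on `Hqe`. -/
noncomputable def hqeKarIso : toHqe.{w, u} k ⋙ hqeKar k ≅ kar k ⋙ toHqe k :=
  Localization.fac _ kar_isInvertedBy (toHqe k)

noncomputable instance : Localization.Lifting (toHqe.{w, u} k) (quasiEquivalences k)
    (kar k ⋙ toHqe k) (hqeKar k) := ⟨hqeKarIso k⟩

variable (k) in
/-- The embeddings in Karoubi envelopes, as a natural transformation on `Hqe`. -/
noncomputable def hqeToKar : 𝟭 (Hqe.{w, u} k) ⟶ hqeKar k :=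
  Localization.liftNatTrans (toHqe k) (quasiEquivalences k) (toHqe k) (kar k ⋙ toHqe k) _ _
    (Functor.whiskerRight (toKarNatTrans k) (toHqe k))

/-- Complete dg categories are the local objects of the reflection: the component at the image of
`D` is the class of `toKar D`, up to the comparison isomorphisms. -/
theorem isIso_hqeToKar (hD : D.HomotopyIdempotentComplete) :
    IsIso ((hqeToKar k).app ((toHqe k).obj D)) := by
  have : IsIso ((toHqe k).map (toKar D)) := isIso_toHqe_map (quasiEquivalences_toKar_iff.2 hD)
  have : IsIso ((Functor.whiskerRight (toKarNatTrans k) (toHqe k)).app D) := this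
  rw [hqeToKar, Localization.liftNatTrans_app]
  infer_instance

theorem isIso_hqeKar_map {F : C ⟶ D} (hF : quasiEquivalences k ((kar k).map F)) :
    IsIso ((hqeKar k).map ((toHqe k).map F)) :=
  (NatIso.isIso_map_iff (hqeKarIso k) F).2 (isIso_toHqe_map hF)

/-- Existence uses only strict functoriality. Uniqueness concerns arbitrary quasi-functors and
therefore uses the envelope and its unit as a functor and a natural transformation on `Hqe`. -/
theorem toKar_universal (C : DGCat.{w, u} k) : IsUniversalToComplete (toKar C) := by
  intro D F hD
  have h₁ : IsIso ((toHqe k).map (toKar D)) := isIso_toHqe_map (quasiEquivalences_toKar_iff.2 hD)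
  refine ⟨(toHqe k).map (DGFunctor.mapKar F : C.Kar ⟶ D.Kar) ≫ inv ((toHqe k).map (toKar D)),
    ?_, ?_⟩
  · beta_reduce
    rw [← Category.assoc, ← Functor.map_comp, toKar_mapKar, Functor.map_comp, Category.assoc,
      IsIso.hom_inv_id, Category.comp_id]
  · have h₂ := isIso_hqeToKar hD
    have h₃ := isIso_hqeKar_map (quasiEquivalences_mapKar_toKar C)
    have key : ∀ G G' : (toHqe k).obj C.Kar ⟶ (toHqe k).obj D,
        (toHqe k).map (toKar C) ≫ G = (toHqe k).map F →
        (toHqe k).map (toKar C) ≫ G' = (toHqe k).map F → G = G' := by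
      intro G G' hG hG'
      -- `Kar(ι_C)` is invertible, so it can be cancelled although `ι_C` itself need not be.
      have e : (hqeKar k).map G = (hqeKar k).map G' := by
        rw [← cancel_epi ((hqeKar k).map ((toHqe k).map (toKar C))), ← Functor.map_comp,
          ← Functor.map_comp, hG, hG']
      -- Naturality gives `G ≫ η_D = η ≫ Kar(G)`, whose right side depends only on `Kar(G)`, and
      -- `η_D` is invertible because `D` is complete.
      rw [← cancel_mono ((hqeToKar k).app ((toHqe k).obj D))]
      exact ((hqeToKar k).naturality G).trans
        ((congrArg _ e).trans ((hqeToKar k).naturality G').symm)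
    intro G hG
    refine key _ _ hG ?_
    rw [← Category.assoc, ← Functor.map_comp, toKar_mapKar, Functor.map_comp, Category.assoc,
      IsIso.hom_inv_id, Category.comp_id]

theorem exists_iso_of_universal {J : C ⟶ K} (hK : K.HomotopyIdempotentComplete)
    (hJ : IsUniversalToComplete J) : ∃ φ : (toHqe k).obj C.Kar ≅ (toHqe k).obj K,
      (toHqe k).map (toKar C) ≫ φ.hom = (toHqe k).map J := by
  have hC := homotopyIdempotentComplete_kar C
  obtain ⟨φ, hφ, -⟩ := toKar_universal C K J hK
  obtain ⟨ψ, hψ, -⟩ := hJ C.Kar (toKar C) hC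
  refine ⟨⟨φ, ψ, ?_, ?_⟩, hφ⟩
  · refine (toKar_universal C C.Kar (toKar C) hC).unique ?_ (Category.comp_id _)
    rw [← Category.assoc, hφ, hψ]
  · refine (hJ K J hK).unique ?_ (Category.comp_id _)
    rw [← Category.assoc, hψ, hφ]

theorem isUniversalToComplete_of_iso {J : C ⟶ K} (φ : (toHqe k).obj C.Kar ≅ (toHqe k).obj K)
    (hφ : (toHqe k).map (toKar C) ≫ φ.hom = (toHqe k).map J) : IsUniversalToComplete J := by
  intro D F hD
  obtain ⟨G, hG, hG'⟩ := toKar_universal C D F hD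
  refine ⟨φ.inv ≫ G, ?_, fun H hH => ?_⟩
  · beta_reduce
    rw [← hφ, Category.assoc, φ.hom_inv_id_assoc, hG]
  · rw [← hG' (φ.hom ≫ H) (by rw [← hH, ← hφ, Category.assoc]), φ.inv_hom_id_assoc]

/-- The zigzag is explicit, `Kar C → Kar K ← K`, with arrows `Kar(J)` and the embedding of `K`. No
description of the morphisms of `Hqe` by fractions is needed. -/
theorem quasiEquivalent_of_universal {J : C ⟶ K} (hK : K.HomotopyIdempotentComplete)
    (hJ : IsUniversalToComplete J) : QuasiEquivalent C.Kar K := by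
  obtain ⟨φ, hφ⟩ := exists_iso_of_universal hK hJ
  have h₁ := isIso_hqeKar_map (quasiEquivalences_mapKar_toKar C)
  -- In `Hqe`, `J` is `ι_C` followed by an isomorphism, and `Kar(ι_C)` is invertible.
  have h₂ : IsIso ((hqeKar k).map ((toHqe k).map J)) := by
    rw [← hφ, Functor.map_comp]
    infer_instance
  have h₃ : IsIso ((toHqe k).map ((kar k).map J)) := (NatIso.isIso_map_iff (hqeKarIso k) J).1 h₂
  exact Relation.EqvGen.trans _ K.Kar _ (.rel _ _ ⟨_, quasiEquivalences_of_isIso ((kar k).map J)⟩)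
    (.symm _ _ (.rel _ _ ⟨toKar K, quasiEquivalences_toKar_iff.2 hK⟩))

end Universal

end DGCat

theorem mainTheorem6 {k : Type w} [CommRing k] (C : DGCat.{w, u} k) :
    -- the canonical dg functor embeds `C` in its envelope
    DGCat.DGFunctor.IsFullEmbedding (DGCat.toKar C) ∧
    -- the envelope is homotopy idempotent complete
    C.Kar.HomotopyIdempotentComplete ∧
    -- the envelope has the universal property
    DGCat.IsUniversalToComplete (DGCat.toKar C) ∧
    -- the universal property characterizes it, up to isomorphism under `C` in `Hqe` ...
    (∀ (K : DGCat.{w, u} k) (J : C ⟶ K),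
      (K.HomotopyIdempotentComplete ∧ DGCat.IsUniversalToComplete J) ↔
        ∃ φ : (DGCat.toHqe k).obj C.Kar ≅ (DGCat.toHqe k).obj K,
          (DGCat.toHqe k).map (DGCat.toKar C) ≫ φ.hom = (DGCat.toHqe k).map J) ∧
    -- ... and up to quasi-equivalence
    (∀ (K : DGCat.{w, u} k) (J : C ⟶ K),
      K.HomotopyIdempotentComplete → DGCat.IsUniversalToComplete J →
        DGCat.QuasiEquivalent C.Kar K) ∧
    -- `C` is complete exactly when the canonical functor is a quasi-equivalence
    (C.HomotopyIdempotentComplete ↔ DGCat.quasiEquivalences k (DGCat.toKar C)) := by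
  have hC := DGCat.homotopyIdempotentComplete_kar C
  exact ⟨DGCat.toKar_isFullEmbedding C, hC, DGCat.toKar_universal C,
    fun K J => ⟨fun h => DGCat.exists_iso_of_universal h.1 h.2, fun ⟨φ, hφ⟩ =>
      ⟨(DGCat.homotopyIdempotentComplete_iff_of_iso φ).1 hC,
        DGCat.isUniversalToComplete_of_iso φ hφ⟩⟩,
    fun K J hK hJ => DGCat.quasiEquivalent_of_universal hK hJ,
    DGCat.quasiEquivalences_toKar_iff.symm⟩
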